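/- Let $\mu$ be an arbitrary Borel probability measure on $\mathbb{C}$, and let $Z_1, Z_2, \dots$ be independent complex random variables, defined on a common probability space, each with law $\mu$. For $n \ge 1$ put $P_n(z) = \prod_{j=1}^{n} (z - Z_j)$, and for integers $k \ge 0$ and $n > k$ let $$\nu_n^{(k)} = \frac{1}{n-k} \sum_{z \in \mathbb{C}\,:\, P_n^{(k)}(z) = 0} \delta_z$$ be the empirical measure of the zeros of the $k$-th derivative $P_n^{(k)}$, where the zeros are counted with multiplicity and $\delta_z$ is the point mass at $z$. Then, almost surely, for every integer $k \ge 0$ simultaneously, $\nu_n^{(k)}$ converges weakly to $\mu$ as $n \to \infty$; that is, $\int f \, d\nu_n^{(k)} \to \int f \, d\mu$ for every bounded continuous $f : \mathbb{C} \to \mathbb{R}$. -/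

import Mathlib

open MeasureTheory ProbabilityTheory Filter Topology Polynomial
open scoped NNReal

noncomputable section

/-- The polynomial `(X - z 0) ⋯ (X - z (n - 1))` with the first `n` terms of `z` as roots. -/
def rootPoly (z : ℕ → ℂ) (n : ℕ) : ℂ[X] :=
  ∏ j ∈ Finset.range n, (X - C (z j))

/-- The empirical measure `(n - k)⁻¹ ∑ δ_w` of the zeros `w`, counted with multiplicity, of the
`k`-th derivative of `rootPoly z n`. For `n > k` this is a probability measure; for `n ≤ k` the
`k`-th derivative is constant, `roots` is empty and the measure is zero. -/
def derivZeroMeasure (z : ℕ → ℂ) (k n : ℕ) : FiniteMeasure ℂ :=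
  ((n - k : ℕ) : ℝ≥0)⁻¹ •
    ((derivative^[k] (rootPoly z n)).roots.map fun w => (diracProba w).toFiniteMeasure).sum

end

/-! Potential theory in the plane: the zeros of `P_n^(k)` follow those of `P_n` as soon as `log
|P_n^(k) / P_n| = o(n)` in the mean on every disc. The quotient is `k!` times the `k`-th elementary
symmetric function `e_k` of the numbers `1 / (z - Z_j)`, so `e_k` has to be neither exponentially
large nor exponentially small, except on sets of vanishing area.

The upper bound holds for every sequence of roots, because `|e_k| ≤ (∑ 1 / |z - Z_j|)^k` and `1 /
|z|` is locally integrable (`tendsto_volume_large_derivative`).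

The lower bound is probabilistic. Use only `k` blocks of `m = √n` variables and condition on the
rest. Resampling one block and subtracting turns a coefficient of order `k + 1` into one of order
`k`, whose constant term has been multiplied by the difference `H(z)` of two independent sums `∑ 1 /
(z - ζ_j)` (`SmallCoeff.pair`). A second-moment argument (`lintegral_decoupling_le`) makes this an
induction on `k`, and everything reduces to `H` being rarely as small as `e^(-εn)`
(`rapidAnticoncentration`). If the two samples have different numbers of points in some disc, then
the contour integral of `H` around it is a nonzero multiple of `2πi`, so `H` is not small at some
point of the circle. After clearing denominators `H` is a polynomial of degree at most `2m`, which
can be much smaller than at that point only on a small area (`volume_norm_sum_sub_sum_le`); here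
`e^(-εn)` wins because `n ≥ m²`. Equal counts in all of `L` disjoint discs of positive mass form a
collision of two random walks in `ℤ^L`, of probability `O(m^(-L/2))` (`collision_probability_le`).
With infinite support `L` is arbitrary, so the bounds beat every power of `m`, and summing over `n`
gives an almost sure statement (`ae_tendsto_volume_small_derivative`).

Smallness in measure is upgraded to smallness in mean by uniform integrability of logarithms of
polynomials (`exists_lintegral_log_ratio_le`). Jensen's formula expresses a compactly supported
radial bump, summed over the roots, through circle averages of `log |p|`. Hence the roots of `P_n`
and of `P_n^(k)`, counted with the bump, differ by `o(n)` (`abs_sum_annulusProfile_sub_le`).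
Averaging over translates of narrow bumps gives the portmanteau lower bound on open sets
(`measure_le_liminf_of_kernel`), starting from the law of large numbers for `k = 0`.

If the support is finite, the discs run out, but a multiplicity drops by at most one at each
differentiation, so the weight of every atom survives. -/

open scoped ENNReal

noncomputable section

/-! ### Elementary symmetric functions of the numbers `1 / (z - ζ_j)`. -/

/-- The generating polynomial `∏ (1 + T / (z - ζ j))` of the elementary symmetric functions of the
numbers `1 / (z - ζ j)`. -/
def genPoly {N : ℕ} (z : ℂ) (ζ : Fin N → ℂ) : ℂ[X] :=
  ∏ j, (1 + C (z - ζ j)⁻¹ * X)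

lemma coeff_prod_one_add_succ {ι : Type*} [DecidableEq ι] (s : Finset ι) (x : ι → ℂ) (a : ι)
    (ha : a ∉ s) (i : ℕ) :
    (∏ j ∈ insert a s, (1 + C (x j) * X) : ℂ[X]).coeff (i + 1) =
      (∏ j ∈ s, (1 + C (x j) * X) : ℂ[X]).coeff (i + 1) +
        x a * (∏ j ∈ s, (1 + C (x j) * X) : ℂ[X]).coeff i := by
  rw [Finset.prod_insert ha, add_mul, one_mul, coeff_add, mul_assoc, coeff_C_mul, coeff_X_mul]

lemma coeff_prod_one_add_zero {ι : Type*} (s : Finset ι) (x : ι → ℂ) :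
    (∏ j ∈ s, (1 + C (x j) * X) : ℂ[X]).coeff 0 = 1 := by
  simp [coeff_zero_eq_eval_zero, eval_prod]

lemma coeff_prod_one_add_one {ι : Type*} (s : Finset ι) (x : ι → ℂ) :
    (∏ j ∈ s, (1 + C (x j) * X) : ℂ[X]).coeff 1 = ∑ j ∈ s, x j := by
  classical
  induction s using Finset.induction_on with
  | empty => simp [coeff_one]
  | insert a s ha ih =>
    rw [coeff_prod_one_add_succ s x a ha 0, coeff_prod_one_add_zero, ih, Finset.sum_insert ha]
    ring

/-- Each monomial of the `i`-th elementary symmetric function occurs in the expanded power. This is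
the deterministic upper bound for the derivatives. -/
lemma norm_coeff_prod_one_add_le {ι : Type*} (s : Finset ι) (x : ι → ℂ) (i : ℕ) :
    ‖(∏ j ∈ s, (1 + C (x j) * X) : ℂ[X]).coeff i‖ ≤ (∑ j ∈ s, ‖x j‖) ^ i := by
  classical
  induction s using Finset.induction_on generalizing i with
  | empty => rcases i with _ | i <;> simp [coeff_one]
  | insert a s ha ih =>
    rcases i with _ | i
    · simp [coeff_prod_one_add_zero]
    · rw [coeff_prod_one_add_succ s x a ha i, Finset.sum_insert ha]
      have h0 : 0 ≤ ∑ j ∈ s, ‖x j‖ := Finset.sum_nonneg fun _ _ => norm_nonneg _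
      have hx := norm_nonneg (x a)
      calc _ ≤ (∑ j ∈ s, ‖x j‖) ^ (i + 1) + ‖x a‖ * (∑ j ∈ s, ‖x j‖) ^ i := by
            refine (norm_add_le _ _).trans (add_le_add (ih _) ?_)
            rw [norm_mul]
            exact mul_le_mul_of_nonneg_left (ih _) hx
        _ = (‖x a‖ + ∑ j ∈ s, ‖x j‖) * (∑ j ∈ s, ‖x j‖) ^ i := by ring
        _ ≤ (‖x a‖ + ∑ j ∈ s, ‖x j‖) * (‖x a‖ + ∑ j ∈ s, ‖x j‖) ^ i := by
            gcongr
            linarith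
        _ = _ := by ring

lemma measurable_coeff_prod_one_add {ι Y : Type*} [MeasurableSpace Y] (s : Finset ι)
    (x : ι → Y → ℂ) (hx : ∀ j, Measurable (x j)) (i : ℕ) :
    Measurable fun y => (∏ j ∈ s, (1 + C (x j y) * X) : ℂ[X]).coeff i := by
  classical
  induction s using Finset.induction_on generalizing i with
  | empty => simp
  | insert a s ha ih =>
    rcases i with _ | i
    · simp [coeff_prod_one_add_zero]
    · simp_rw [fun y => coeff_prod_one_add_succ s (fun j => x j y) a ha i]
      exact (ih _).add ((hx a).mul (ih _))

lemma measurable_coeff_genPoly {N : ℕ} {Y : Type*} [MeasurableSpace Y] {f : Y → ℂ}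
    {g : Y → Fin N → ℂ} (hf : Measurable f) (hg : Measurable g) (i : ℕ) :
    Measurable fun y => (genPoly (f y) (g y)).coeff i := by
  refine measurable_coeff_prod_one_add Finset.univ (fun j y => (f y - g y j)⁻¹) (fun j => ?_) i
  exact (hf.sub ((measurable_pi_apply j).comp hg)).inv

lemma coeff_zero_genPoly {N : ℕ} (z : ℂ) (ζ : Fin N → ℂ) : (genPoly z ζ).coeff 0 = 1 :=
  coeff_prod_one_add_zero _ _

lemma coeff_one_genPoly {N : ℕ} (z : ℂ) (ζ : Fin N → ℂ) :
    (genPoly z ζ).coeff 1 = ∑ j, (z - ζ j)⁻¹ :=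
  coeff_prod_one_add_one _ _

lemma genPoly_append {N M : ℕ} (z : ℂ) (a : Fin N → ℂ) (b : Fin M → ℂ) :
    genPoly z (Fin.append a b) = genPoly z a * genPoly z b := by
  simp [genPoly, Fin.prod_univ_add]

/-- Appending independent samples of sizes `N` and `M` gives a sample of size `N + M`. -/
lemma measurePreserving_append (μ : Measure ℂ) [IsProbabilityMeasure μ] (N M : ℕ) :
    MeasurePreserving (fun p : (Fin N → ℂ) × (Fin M → ℂ) => Fin.append p.1 p.2)
      ((Measure.pi fun _ => μ).prod (Measure.pi fun _ => μ)) (Measure.pi fun _ => μ) := by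
  have hm : Measurable fun p : (Fin N → ℂ) × (Fin M → ℂ) => Fin.append p.1 p.2 := by
    refine measurable_pi_lambda _ fun i => ?_
    refine Fin.addCases (fun j => ?_) (fun j => ?_) i
    · simp only [Fin.append_left]
      fun_prop
    · simp only [Fin.append_right]
      fun_prop
  refine ⟨hm, (Measure.pi_eq fun s hs => ?_).symm⟩
  rw [Measure.map_apply hm (MeasurableSet.univ_pi hs)]
  have : (fun p : (Fin N → ℂ) × (Fin M → ℂ) => Fin.append p.1 p.2) ⁻¹' (Set.univ.pi s) =
      (Set.univ.pi fun i => s (Fin.castAdd M i)) ×ˢ (Set.univ.pi fun i => s (Fin.natAdd N i)) := by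
    ext p
    simp only [Set.mem_preimage, Set.mem_pi, Set.mem_univ, forall_const, Set.mem_prod]
    constructor
    · intro h
      exact ⟨fun i => by simpa using h (Fin.castAdd M i), fun i => by simpa using h (Fin.natAdd N i)⟩
    · rintro ⟨h1, h2⟩ i
      refine Fin.addCases (fun j => ?_) (fun j => ?_) i
      · simpa using h1 j
      · simpa using h2 j
  rw [this, Measure.prod_prod, Measure.pi_pi, Measure.pi_pi, Fin.prod_univ_add]

/-! ### Decoupling: resampling one block of variables. -/

lemma ENNReal.le_add_sq_div (x : ℝ≥0∞) {t : ℝ≥0∞} (ht : t ≠ 0) (ht' : t ≠ ∞) :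
    x ≤ t + t⁻¹ * (x * x) := by
  rcases le_total x t with h | h
  · exact h.trans le_self_add
  · refine le_trans ?_ le_add_self
    calc x = (t⁻¹ * t) * x := by rw [ENNReal.inv_mul_cancel ht ht', one_mul]
      _ ≤ (t⁻¹ * x) * x := by gcongr
      _ = _ := by ring

/-- The event that the `k`-th coefficient of `c * genPoly z ζ` is small compared with `c(0) ≠ 0`. -/
def SmallCoeff {N : ℕ} (k : ℕ) (η : ℝ) (c : ℂ[X]) (z : ℂ) (ζ : Fin N → ℂ) : Prop :=
  ‖(c * genPoly z ζ).coeff k‖ ≤ η * ‖c.coeff 0‖ ∧ c.coeff 0 ≠ 0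

lemma measurableSet_smallCoeff {N : ℕ} {Y : Type*} [MeasurableSpace Y] {f : Y → ℂ}
    {g : Y → Fin N → ℂ} {c : Y → ℂ[X]} (hf : Measurable f) (hg : Measurable g)
    (hc : ∀ i, Measurable fun y => (c y).coeff i) (k : ℕ) (η : ℝ) :
    MeasurableSet {y | SmallCoeff k η (c y) (f y) (g y)} := by
  have h1 : Measurable fun y => (c y * genPoly (f y) (g y)).coeff k := by
    simp_rw [coeff_mul]
    exact Finset.measurable_sum _ fun p _ => (hc _).mul (measurable_coeff_genPoly hf hg _)
  refine MeasurableSet.inter (measurableSet_le h1.norm ((hc 0).norm.const_mul η)) ?_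
  exact (hc 0) (measurableSet_singleton 0).compl

/-- The quotient of the difference of two generating polynomials by the indeterminate. -/
def genQuot {M : ℕ} (z : ℂ) (b d : Fin M → ℂ) : ℂ[X] :=
  (genPoly z b - genPoly z d).divX

/-- Resampling one block lowers the degree by one. -/
lemma SmallCoeff.pair {N M k : ℕ} {η : ℝ} (hη : 0 ≤ η) {c : ℂ[X]} {z : ℂ} {a : Fin N → ℂ}
    {b b' : Fin M → ℂ} (h : SmallCoeff (k + 1) η c z (Fin.append a b))
    (h' : SmallCoeff (k + 1) η c z (Fin.append a b')) :
    ‖∑ j, (z - b j)⁻¹ - ∑ j, (z - b' j)⁻¹‖ ≤ 2 * √η ∨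
      SmallCoeff k (√η) (c * genQuot z b b') z a := by
  rw [or_iff_not_imp_left, not_le]
  intro hΔ
  rw [genQuot]
  set d := genPoly z b - genPoly z b' with hd
  have hd0 : d.coeff 0 = 0 := by simp [hd, coeff_zero_genPoly]
  have hdX : d.divX * X = d := by
    conv_rhs => rw [← divX_mul_X_add d, hd0, C_0, add_zero]
  have h1 : d.divX.coeff 0 = ∑ j, (z - b j)⁻¹ - ∑ j, (z - b' j)⁻¹ := by
    rw [coeff_divX, hd, coeff_sub, zero_add, coeff_one_genPoly, coeff_one_genPoly]
  have h2 : (c * d.divX).coeff 0 = c.coeff 0 * (∑ j, (z - b j)⁻¹ - ∑ j, (z - b' j)⁻¹) := by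
    rw [mul_coeff_zero, h1]
  have hs := Real.sqrt_nonneg η
  have hne : ∑ j, (z - b j)⁻¹ - ∑ j, (z - b' j)⁻¹ ≠ 0 := by
    rw [← norm_pos_iff]
    linarith
  refine ⟨?_, by rw [h2]; exact mul_ne_zero h.2 hne⟩
  -- Both generating polynomials have constant term `1`, so their difference is divisible by `X`;
  -- this is the shift from `k + 1` to `k`.
  have h3 : (c * d.divX * genPoly z a).coeff k =
      (c * genPoly z (Fin.append a b)).coeff (k + 1) -
        (c * genPoly z (Fin.append a b')).coeff (k + 1) := by
    rw [← coeff_sub, genPoly_append, genPoly_append, ← mul_sub, ← mul_sub, ← hd,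
      ← coeff_mul_X (c * d.divX * genPoly z a)]
    congr 1
    conv_rhs => rw [← hdX]
    ring
  rw [h3, h2, norm_mul]
  have hc := norm_nonneg (c.coeff 0)
  calc _ ≤ η * ‖c.coeff 0‖ + η * ‖c.coeff 0‖ := (norm_sub_le _ _).trans (add_le_add h.1 h'.1)
    -- The threshold `2 * √η` is tuned to this identity: the error `2η` splits into the new
    -- tolerance `√η` and a lower bound for the new constant term.
    _ = √η * (‖c.coeff 0‖ * (2 * √η)) := by
        nth_rewrite 1 2 [← Real.mul_self_sqrt hη]
        ring
    _ ≤ _ := by gcongr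

/-- Decoupling inequality: if `S` holds for two independent copies of the last variable only when
`A` or `B` holds, then the measure of `S` is controlled by those of `A` and `B`. -/
lemma lintegral_decoupling_le {X Y W : Type*} [MeasurableSpace X] [MeasurableSpace Y]
    [MeasurableSpace W] (lam : Measure X) [IsFiniteMeasure lam] (ν : Measure Y)
    [IsProbabilityMeasure ν] (ρ : Measure W) [IsProbabilityMeasure ρ]
    {S : X → Y → W → Prop} {A : X → W × W → Prop} {B : W × W → X → Y → Prop}
    (hS : MeasurableSet {q : X × Y × W | S q.1 q.2.1 q.2.2})
    (hA : MeasurableSet {q : X × W × W | A q.1 q.2})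
    (hB : MeasurableSet {q : ((W × W) × X) × Y | B q.1.1 q.1.2 q.2})
    (hSAB : ∀ x y w w', S x y w → S x y w' → A x (w, w') ∨ B (w, w') x y)
    {t α β : ℝ≥0∞} (ht : t ≠ 0) (ht' : t ≠ ∞)
    (hα : ∫⁻ x, (ρ.prod ρ) {p | A x p} ∂lam ≤ α)
    (hβ : ∀ p, ∫⁻ x, ν {y | B p x y} ∂lam ≤ β) :
    ∫⁻ x, (ν.prod ρ) {q | S x q.1 q.2} ∂lam ≤ lam Set.univ * t + t⁻¹ * (α + β) := by
  have hSx : ∀ x, MeasurableSet {q : Y × W | S x q.1 q.2} := fun x =>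
    hS.preimage measurable_prodMk_left
  have hSf : ∀ x, Measurable fun y => ρ {w | S x y w} := fun x =>
    measurable_measure_prodMk_left (hSx x)
  have hBf : Measurable fun q : (W × W) × X => ν {y | B q.1 q.2 y} :=
    measurable_measure_prodMk_left hB
  have e2 : ∀ x, ∫⁻ y, ρ {w | S x y w} * ρ {w | S x y w} ∂ν ≤
      (ρ.prod ρ) {p | A x p} + ∫⁻ p, ν {y | B p x y} ∂(ρ.prod ρ) := by
    intro x
    have hSz : MeasurableSet {r : Y × W × W | S x r.1 r.2.1 ∧ S x r.1 r.2.2} := by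
      refine MeasurableSet.inter ?_ ?_
      · exact hS.preimage (f := fun r : Y × W × W => (x, r.1, r.2.1)) (by fun_prop)
      · exact hS.preimage (f := fun r : Y × W × W => (x, r.1, r.2.2)) (by fun_prop)
    have hBz : MeasurableSet {r : Y × W × W | B r.2 x r.1} :=
      hB.preimage (f := fun r : Y × W × W => ((r.2, x), r.1)) (by fun_prop)
    -- The square of a probability is the probability that two independent copies of `w` both
    -- satisfy `S`; `hSAB` applies to such pairs.
    calc ∫⁻ y, ρ {w | S x y w} * ρ {w | S x y w} ∂ν
        = (ν.prod (ρ.prod ρ)) {r | S x r.1 r.2.1 ∧ S x r.1 r.2.2} := by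
          rw [Measure.prod_apply hSz]
          refine lintegral_congr fun a => ?_
          rw [← Measure.prod_prod]
          rfl
      _ ≤ (ν.prod (ρ.prod ρ)) ((Set.univ ×ˢ {p | A x p}) ∪ {r | B r.2 x r.1}) := by
          refine measure_mono fun r hr => ?_
          rcases hSAB x r.1 r.2.1 r.2.2 hr.1 hr.2 with h | h
          · exact Or.inl ⟨trivial, h⟩
          · exact Or.inr h
      _ ≤ _ := by
          refine (measure_union_le _ _).trans (add_le_add ?_ ?_)
          · rw [Measure.prod_prod, measure_univ, one_mul]
          · rw [Measure.prod_apply_symm hBz]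
            rfl
  calc _ = ∫⁻ x, ∫⁻ y, ρ {w | S x y w} ∂ν ∂lam := by
        refine lintegral_congr fun x => ?_
        rw [Measure.prod_apply (hSx x)]
        rfl
    -- A linearised Cauchy–Schwarz: `x ≤ t + x² / t` replaces a square root, with `t` left free.
    _ ≤ ∫⁻ x, ∫⁻ y, (t + t⁻¹ * (ρ {w | S x y w} * ρ {w | S x y w})) ∂ν ∂lam := by
        gcongr with x y
        exact ENNReal.le_add_sq_div _ ht ht'
    _ = ∫⁻ x, (t + t⁻¹ * ∫⁻ y, ρ {w | S x y w} * ρ {w | S x y w} ∂ν) ∂lam := by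
        refine lintegral_congr fun x => ?_
        have := hSf x
        have hm : Measurable fun y => ρ {w | S x y w} * ρ {w | S x y w} := this.mul this
        rw [lintegral_add_left measurable_const, lintegral_const, measure_univ, mul_one,
          lintegral_const_mul _ hm]
    _ ≤ ∫⁻ x, (t + t⁻¹ * ((ρ.prod ρ) {p | A x p} + ∫⁻ p, ν {y | B p x y} ∂(ρ.prod ρ))) ∂lam := by
        gcongr with x
        exact e2 x
    _ = lam Set.univ * t + t⁻¹ * (∫⁻ x, (ρ.prod ρ) {p | A x p} ∂lam +
          ∫⁻ x, ∫⁻ p, ν {y | B p x y} ∂(ρ.prod ρ) ∂lam) := by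
        have m1 : Measurable fun x => (ρ.prod ρ) {p | A x p} := measurable_measure_prodMk_left hA
        have m2 : Measurable fun x => ∫⁻ p, ν {y | B p x y} ∂(ρ.prod ρ) :=
          Measurable.lintegral_prod_left hBf
        rw [lintegral_add_left measurable_const, lintegral_const, lintegral_const_mul _ (by fun_prop),
          lintegral_add_left m1, mul_comm t]
    _ ≤ _ := by
        gcongr
        have hsw : Measurable (Function.uncurry fun (x : X) (p : W × W) => ν {y | B p x y}) :=
          hBf.comp measurable_swap
        -- With the resampled pair `p` outermost it can be frozen, and `hβ` holds uniformly in `p`.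
        rw [lintegral_lintegral_swap hsw.aemeasurable]
        calc _ ≤ ∫⁻ p, β ∂(ρ.prod ρ) := by
              gcongr with p
              exact hβ p
          _ = β := by simp

lemma measurable_coeff_mul_divX_sub {M : ℕ} {Y : Type*} [MeasurableSpace Y] {c : Y → ℂ[X]}
    {f : Y → ℂ} {b b' : Y → Fin M → ℂ} (hc : ∀ i, Measurable fun y => (c y).coeff i)
    (hf : Measurable f) (hb : Measurable b) (hb' : Measurable b') (i : ℕ) :
    Measurable fun y => (c y * genQuot (f y) (b y) (b' y)).coeff i := by
  simp only [coeff_mul, genQuot, coeff_divX, coeff_sub]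
  refine Finset.measurable_sum _ fun p _ => (hc _).mul (.sub ?_ ?_)
  · exact measurable_coeff_genPoly hf hb _
  · exact measurable_coeff_genPoly hf hb' _

/-- One step of the decoupling: the probability of `SmallCoeff (k + 1)` is controlled by that of
`SmallCoeff k` and by the concentration of a difference of two independent sums. -/
lemma lintegral_smallCoeff_succ_le (μ : Measure ℂ) [IsProbabilityMeasure μ] (lam : Measure ℂ)
    [IsFiniteMeasure lam] {N M k : ℕ} {η : ℝ} (hη : 0 ≤ η) {c : ℂ → ℂ[X]}
    (hc : ∀ i, Measurable fun z => (c z).coeff i) {t α β : ℝ≥0∞} (ht : t ≠ 0) (ht' : t ≠ ∞)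
    (hα : ∫⁻ z, ((Measure.pi fun _ : Fin M => μ).prod (Measure.pi fun _ : Fin M => μ))
      {p | ‖∑ j, (z - p.1 j)⁻¹ - ∑ j, (z - p.2 j)⁻¹‖ ≤ 2 * √η} ∂lam ≤ α)
    (hβ : ∀ c' : ℂ → ℂ[X], (∀ i, Measurable fun z => (c' z).coeff i) →
      ∫⁻ z, (Measure.pi fun _ : Fin N => μ) {ζ | SmallCoeff k (√η) (c' z) z ζ} ∂lam ≤ β) :
    ∫⁻ z, (Measure.pi fun _ : Fin (N + M) => μ) {ζ | SmallCoeff (k + 1) η (c z) z ζ} ∂lam ≤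
      lam Set.univ * t + t⁻¹ * (α + β) := by
  have happ : Measurable fun p : (Fin N → ℂ) × (Fin M → ℂ) => Fin.append p.1 p.2 :=
    (measurePreserving_append μ N M).measurable
  have e1 : ∀ z, (Measure.pi fun _ : Fin (N + M) => μ) {ζ | SmallCoeff (k + 1) η (c z) z ζ} =
      ((Measure.pi fun _ : Fin N => μ).prod (Measure.pi fun _ : Fin M => μ))
        {q | SmallCoeff (k + 1) η (c z) z (Fin.append q.1 q.2)} := by
    intro z
    have hms : MeasurableSet {ζ : Fin (N + M) → ℂ | SmallCoeff (k + 1) η (c z) z ζ} :=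
      measurableSet_smallCoeff (f := fun _ => z) (c := fun _ => c z) measurable_const measurable_id
        (fun i => measurable_const) _ _
    rw [← (measurePreserving_append μ N M).measure_preimage hms.nullMeasurableSet]
    rfl
  rw [lintegral_congr e1]
  have hS : MeasurableSet {q : ℂ × (Fin N → ℂ) × (Fin M → ℂ) |
      SmallCoeff (k + 1) η (c q.1) q.1 (Fin.append q.2.1 q.2.2)} :=
    measurableSet_smallCoeff measurable_fst (happ.comp measurable_snd)
      (fun i => (hc i).comp measurable_fst) _ _
  have hA : MeasurableSet {q : ℂ × (Fin M → ℂ) × (Fin M → ℂ) |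
      ‖∑ j, (q.1 - q.2.1 j)⁻¹ - ∑ j, (q.1 - q.2.2 j)⁻¹‖ ≤ 2 * √η} := by
    refine measurableSet_le ?_ measurable_const
    fun_prop
  have hB : MeasurableSet {r : (((Fin M → ℂ) × (Fin M → ℂ)) × ℂ) × (Fin N → ℂ) |
      SmallCoeff k (√η) (c r.1.2 * genQuot r.1.2 r.1.1.1 r.1.1.2)
        r.1.2 r.2} :=
    measurableSet_smallCoeff (by fun_prop) measurable_snd
      (measurable_coeff_mul_divX_sub (fun i => (hc i).comp (by fun_prop)) (by fun_prop) (by fun_prop)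
        (by fun_prop)) _ _
  have hβ' : ∀ p : (Fin M → ℂ) × (Fin M → ℂ), ∀ i,
      Measurable fun z => (c z * genQuot z p.1 p.2).coeff i := fun p =>
    measurable_coeff_mul_divX_sub hc measurable_id measurable_const measurable_const
  refine lintegral_decoupling_le
    (S := fun z a b => SmallCoeff (k + 1) η (c z) z (Fin.append a b))
    (A := fun z p => ‖∑ j, (z - p.1 j)⁻¹ - ∑ j, (z - p.2 j)⁻¹‖ ≤ 2 * √η)
    (B := fun p z a => SmallCoeff k (√η) (c z * genQuot z p.1 p.2) z a)
    lam _ _ hS hA hB (fun z a b b' h h' => ?_) ht ht' ?_ (fun p => ?_)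
  · exact SmallCoeff.pair hη h h'
  · exact hα
  · exact hβ _ (hβ' p)

/-! ### Iterating the decoupling over `k` blocks of size `√n`. -/

lemma tendsto_sqrt_atTop : Tendsto Nat.sqrt atTop atTop := by
  refine tendsto_atTop_mono' atTop (f₁ := fun n => Nat.sqrt n) (Eventually.of_forall fun n => le_rfl) ?_
  refine tendsto_atTop.2 fun b => ?_
  filter_upwards [eventually_ge_atTop (b * b)] with n hn
  exact Nat.le_sqrt.2 hn

lemma eventually_const_mul_inv_pow_le (K : ℝ≥0∞) (hK : K ≠ ∞) (A : ℕ) :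
    ∀ᶠ n : ℕ in atTop, K * ((Nat.sqrt n : ℝ≥0∞)⁻¹) ^ (A + 1) ≤ ((Nat.sqrt n : ℝ≥0∞)⁻¹) ^ A := by
  obtain ⟨b, hb⟩ := ENNReal.exists_nat_gt hK
  filter_upwards [tendsto_sqrt_atTop.eventually_ge_atTop (max b 1)] with n hn
  have h1 : (b : ℝ≥0∞) ≤ (Nat.sqrt n : ℝ≥0∞) := by exact_mod_cast (le_max_left b 1).trans hn
  have h2 : (Nat.sqrt n : ℝ≥0∞) ≠ 0 := by
    have := (le_max_right b 1).trans hn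
    simp only [ne_eq, Nat.cast_eq_zero]
    omega
  calc K * ((Nat.sqrt n : ℝ≥0∞)⁻¹) ^ (A + 1)
      ≤ (Nat.sqrt n : ℝ≥0∞) * ((Nat.sqrt n : ℝ≥0∞)⁻¹) ^ (A + 1) := by
        gcongr
        exact hb.le.trans h1
    _ = _ := by
        rw [pow_succ', ← mul_assoc, ENNReal.mul_inv_cancel h2 (ENNReal.natCast_ne_top _), one_mul]

/-- Differences of two independent sums of `√n` terms `1 / (z - ζ j)` are exponentially small only
with a probability that decays faster than any power, on average over `z`. -/
def RapidAnticoncentration (μ : Measure ℂ) (lam : Measure ℂ) : Prop :=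
  ∀ ε > 0, ∀ A : ℕ, ∀ᶠ n : ℕ in atTop,
    ∫⁻ z, ((Measure.pi fun _ : Fin (Nat.sqrt n) => μ).prod
        (Measure.pi fun _ : Fin (Nat.sqrt n) => μ))
      {p | ‖∑ j, (z - p.1 j)⁻¹ - ∑ j, (z - p.2 j)⁻¹‖ ≤ Real.exp (-ε * n)} ∂lam ≤
        ((Nat.sqrt n : ℝ≥0∞)⁻¹) ^ A

lemma eventually_two_mul_sqrt_exp_le {ε : ℝ} (hε : 0 < ε) :
    ∀ᶠ n : ℕ in atTop, 2 * √(Real.exp (-ε * n)) ≤ Real.exp (-(ε / 4) * n) := by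
  have h : Tendsto (fun n : ℕ => (ε / 4) * (n : ℝ)) atTop atTop :=
    tendsto_natCast_atTop_atTop.const_mul_atTop (by linarith)
  filter_upwards [h.eventually_ge_atTop (Real.log 2)] with n hn
  have h2 : (2 : ℝ) ≤ Real.exp (ε / 4 * n) := by
    rw [← Real.exp_log (two_pos), Real.exp_le_exp]
    exact hn
  rw [← Real.exp_half]
  calc 2 * Real.exp (-ε * n / 2) ≤ Real.exp (ε / 4 * n) * Real.exp (-ε * n / 2) := by gcongr
    _ = _ := by
      rw [← Real.exp_add]
      congr 1
      ring

/-- Decoupling: the anticoncentration of sums is inherited by the symmetric functions of order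
`k`, uniformly in the coefficients `c`. -/
lemma RapidAnticoncentration.smallCoeff {μ : Measure ℂ} [IsProbabilityMeasure μ] {lam : Measure ℂ}
    [IsFiniteMeasure lam] (h : RapidAnticoncentration μ lam) (k : ℕ) :
    ∀ ε > 0, ∀ A : ℕ, ∀ᶠ n : ℕ in atTop, ∀ c : ℂ → ℂ[X],
      (∀ i, Measurable fun z => (c z).coeff i) →
      ∫⁻ z, (Measure.pi fun _ : Fin (Nat.sqrt n * k) => μ)
        {ζ | SmallCoeff k (Real.exp (-ε * n)) (c z) z ζ} ∂lam ≤ ((Nat.sqrt n : ℝ≥0∞)⁻¹) ^ A := by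
  induction k with
  | zero =>
    intro ε hε A
    filter_upwards [eventually_gt_atTop 0] with n hn c hc
    -- In order zero the coefficient is `c(0)` itself, which cannot be at most `e^(-εn) |c(0)|`
    -- without vanishing.
    have : ∀ z, {ζ : Fin (Nat.sqrt n * 0) → ℂ | SmallCoeff 0 (Real.exp (-ε * n)) (c z) z ζ} = ∅ := by
      intro z
      ext ζ
      simp only [SmallCoeff, mul_coeff_zero, coeff_zero_genPoly, mul_one, Set.mem_ofPred_eq,
        Set.mem_empty_iff_false, iff_false, not_and, not_not]
      intro h1
      by_contra h2
      have h3 : 0 < ‖(c z).coeff 0‖ := norm_pos_iff.2 h2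
      have h4 : Real.exp (-ε * n) < 1 := by
        rw [Real.exp_lt_one_iff]
        have : (0 : ℝ) < n := by exact_mod_cast hn
        nlinarith
      nlinarith
    simp only [this, measure_empty, lintegral_zero, zero_le]
  | succ k ih =>
    intro ε hε A
    have hK : lam Set.univ + 2 ≠ ∞ := by finiteness
    -- The tolerance becomes `√η = e^(-εn/2)`, whence `ε / 2`; the threshold `2√η` is eventually at
    -- most `e^(-εn/4)`, whence `ε / 4`.
    filter_upwards [h (ε / 4) (by linarith) (2 * A + 2), ih (ε / 2) (by linarith) (2 * A + 2),
      eventually_two_mul_sqrt_exp_le hε, eventually_const_mul_inv_pow_le _ hK A,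
      tendsto_sqrt_atTop.eventually_gt_atTop 0] with n h1 h2 h3 h4 h5 c hc
    set s : ℝ≥0∞ := (Nat.sqrt n : ℝ≥0∞)⁻¹ with hs
    have hs0 : s ≠ 0 := by simp [hs]
    have hs1 : s ≠ ∞ := by
      simp only [hs, ne_eq, ENNReal.inv_eq_top, Nat.cast_eq_zero]
      omega
    -- With these exponents every term of the bound is a multiple of `s ^ (A + 1)`, and the spare
    -- power of `s` absorbs the constant `lam univ + 2`.
    have h6 := lintegral_smallCoeff_succ_le μ lam (N := Nat.sqrt n * k) (M := Nat.sqrt n) (k := k)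
      (Real.exp_pos (-ε * n)).le hc (t := s ^ (A + 1)) (α := s ^ (2 * A + 2)) (β := s ^ (2 * A + 2))
      (pow_ne_zero _ hs0) (ENNReal.pow_ne_top hs1) ?_ ?_
    · refine le_trans h6 (le_trans (le_of_eq ?_) h4)
      have : (s ^ (A + 1))⁻¹ * s ^ (2 * A + 2) = s ^ (A + 1) := by
        rw [show 2 * A + 2 = (A + 1) + (A + 1) by ring, pow_add s (A + 1) (A + 1), ← mul_assoc,
          ENNReal.inv_mul_cancel (pow_ne_zero _ hs0) (ENNReal.pow_ne_top hs1), one_mul]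
      rw [mul_add, this]
      ring
    · refine le_trans ?_ h1
      gcongr
    · intro c' hc'
      convert h2 c' hc' using 6
      rw [← Real.exp_half]
      ring_nf

/-! ### Local integrability of `1 / |z|` and sublevel sets of polynomials. -/

lemma lintegral_inv_norm_ball_one_lt_top :
    ∫⁻ z in Metric.ball (0 : ℂ) 1, ENNReal.ofReal ‖z‖⁻¹ < ∞ := by
  rw [← lintegral_indicator Metric.isOpen_ball.measurableSet,
    ← Complex.lintegral_comp_polarCoord_symm]
  calc _ ≤ ∫⁻ p in polarCoord.target, (Set.Ioc (0 : ℝ) 1 ×ˢ Set.Ioo (-Real.pi) Real.pi).indicator 1 p := by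
        refine setLIntegral_mono ((measurable_one.indicator (by measurability))) fun p hp => ?_
        have hp1 : 0 < p.1 := hp.1
        by_cases h : ‖Complex.polarCoord.symm p‖ < 1
        · have h1 : ‖Complex.polarCoord.symm p‖ = p.1 := by
            simp [abs_of_pos hp1]
          rw [Set.indicator_of_mem (by simpa using h), Set.indicator_of_mem, h1, smul_eq_mul,
            ← ENNReal.ofReal_mul hp1.le, mul_inv_cancel₀ hp1.ne']
          · simp
          · exact ⟨⟨hp1, (h1 ▸ h).le⟩, hp.2⟩
        · rw [Set.indicator_of_notMem (by simpa using h)]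
          simp
    _ ≤ ∫⁻ p, (Set.Ioc (0 : ℝ) 1 ×ˢ Set.Ioo (-Real.pi) Real.pi).indicator 1 p :=
        setLIntegral_le_lintegral _ _
    _ = volume (Set.Ioc (0 : ℝ) 1 ×ˢ Set.Ioo (-Real.pi) Real.pi) := by
        rw [lintegral_indicator_one (by measurability)]
    _ < ∞ := by
        rw [Measure.volume_eq_prod, Measure.prod_prod]
        simp

/-- Within distance `1` of the pole the integral is translation invariant, and elsewhere the
integrand is at most `1`; hence one constant serves all poles. -/
lemma exists_lintegral_inv_norm_sub_le (R : ℝ) :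
    ∃ K : ℝ≥0∞, K ≠ ∞ ∧ ∀ w : ℂ, ∫⁻ z in Metric.ball (0 : ℂ) R, ENNReal.ofReal ‖z - w‖⁻¹ ≤ K := by
  refine ⟨(∫⁻ z in Metric.ball (0 : ℂ) 1, ENNReal.ofReal ‖z‖⁻¹) + volume (Metric.ball (0 : ℂ) R),
    ENNReal.add_ne_top.2 ⟨lintegral_inv_norm_ball_one_lt_top.ne, measure_ball_lt_top.ne⟩,
    fun w => ?_⟩
  have h1 : ∫⁻ z in Metric.ball (0 : ℂ) 1, ENNReal.ofReal ‖z‖⁻¹ =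
      ∫⁻ z, (Metric.ball (0 : ℂ) 1).indicator (fun z => ENNReal.ofReal ‖z‖⁻¹) (z - w) := by
    rw [lintegral_sub_right_eq_self (fun z => (Metric.ball (0 : ℂ) 1).indicator
      (fun z => ENNReal.ofReal ‖z‖⁻¹) z) w, lintegral_indicator Metric.isOpen_ball.measurableSet]
  have h2 : volume (Metric.ball (0 : ℂ) R) = ∫⁻ z in Metric.ball (0 : ℂ) R, 1 := by simp
  rw [h1, h2]
  refine le_trans ?_ (add_le_add_left (setLIntegral_le_lintegral (Metric.ball (0 : ℂ) R) _) _)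
  rw [← lintegral_add_right _ measurable_const]
  refine lintegral_mono fun z => ?_
  by_cases h : ‖z - w‖ < 1
  · rw [Set.indicator_of_mem (by simpa using h)]
    exact le_self_add
  · refine le_trans ?_ le_add_self
    rw [← ENNReal.ofReal_one]
    exact ENNReal.ofReal_le_ofReal (inv_le_one_of_one_le₀ (not_lt.1 h))

lemma exists_lintegral_one_add_inv_norm_le (R ρ : ℝ) (hρ : 0 ≤ ρ) :
    ∃ K : ℝ≥0∞, K ≠ ∞ ∧ ∀ w : ℂ,
      ∫⁻ z in Metric.ball (0 : ℂ) R, ENNReal.ofReal (1 + ρ * ‖z - w‖⁻¹) ≤ K := by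
  obtain ⟨K, hK, h⟩ := exists_lintegral_inv_norm_sub_le R
  refine ⟨volume (Metric.ball (0 : ℂ) R) + ENNReal.ofReal ρ * K,
    ENNReal.add_ne_top.2 ⟨measure_ball_lt_top.ne, ENNReal.mul_ne_top ENNReal.ofReal_ne_top hK⟩,
    fun w => ?_⟩
  calc _ = ∫⁻ z in Metric.ball (0 : ℂ) R, (1 + ENNReal.ofReal ρ * ENNReal.ofReal ‖z - w‖⁻¹) := by
        refine lintegral_congr fun z => ?_
        rw [ENNReal.ofReal_add zero_le_one (by positivity), ENNReal.ofReal_mul hρ,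
          ENNReal.ofReal_one]
    _ = volume (Metric.ball (0 : ℂ) R) +
        ENNReal.ofReal ρ * ∫⁻ z in Metric.ball (0 : ℂ) R, ENNReal.ofReal ‖z - w‖⁻¹ := by
        rw [lintegral_add_left measurable_const, lintegral_const_mul' _ _ ENNReal.ofReal_ne_top]
        simp
    _ ≤ _ := by
        gcongr
        exact h w

/-- AM–GM in tangent form: multiply the inequalities `x ≤ T exp (x / T - 1)`. -/
lemma prod_le_pow_mul_exp {T : ℝ} (hT : 0 < T) {α : Type*} (s : Multiset α) (x : α → ℝ)
    (hx : ∀ a, 0 ≤ x a) :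
    (s.map x).prod ≤ T ^ s.card * Real.exp ((s.map x).sum / T - s.card) := by
  induction s using Multiset.induction_on with
  | empty => simp
  | cons a s ih =>
    have h1 : x a ≤ T * Real.exp (x a / T - 1) := by
      have := Real.add_one_le_exp (x a / T - 1)
      calc x a = T * (x a / T - 1 + 1) := by field_simp; ring
        _ ≤ _ := by gcongr
    have h2 : 0 ≤ (s.map x).prod := Multiset.prod_nonneg (by simp; exact fun a _ => hx a)
    simp only [Multiset.map_cons, Multiset.prod_cons, Multiset.sum_cons, Multiset.card_cons]
    calc _ ≤ (T * Real.exp (x a / T - 1)) *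
          (T ^ s.card * Real.exp ((s.map x).sum / T - s.card)) := by gcongr
      _ = T ^ (s.card + 1) * (Real.exp (x a / T - 1) * Real.exp ((s.map x).sum / T - s.card)) := by
        ring
      _ = _ := by
        rw [← Real.exp_add]
        push_cast
        congr 2
        ring

/-- If `∏ x ≥ T ^ n` for `n` nonnegative numbers, then `∑ x ≥ n T`. -/
lemma card_mul_le_sum_of_pow_le_prod {T : ℝ} (hT : 0 < T) {α : Type*} (s : Multiset α) (x : α → ℝ)
    (hx : ∀ a, 0 ≤ x a) (h : T ^ s.card ≤ (s.map x).prod) : s.card * T ≤ (s.map x).sum := by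
  have h1 := h.trans (prod_le_pow_mul_exp hT s x hx)
  have h2 : 1 ≤ Real.exp ((s.map x).sum / T - s.card) := by
    have : 0 < T ^ s.card := by positivity
    nlinarith
  rw [Real.one_le_exp_iff, sub_nonneg, le_div_iff₀ hT] at h2
  exact h2

lemma norm_eval_eq_prod_roots (p : ℂ[X]) (z : ℂ) :
    ‖p.eval z‖ = ‖p.leadingCoeff‖ * (p.roots.map fun w => ‖z - w‖).prod := by
  conv_lhs => rw [(IsAlgClosed.splits p).eq_prod_roots]
  rw [eval_mul, eval_C, norm_mul, eval_multiset_prod, Multiset.map_map]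
  congr 1
  refine (map_multiset_prod (normHom : ℂ →*₀ ℝ) _).trans ?_
  rw [Multiset.map_map]
  simp [Function.comp_def]

lemma measurable_multiset_sum_map {α β : Type*} [MeasurableSpace α] (s : Multiset β)
    (f : β → α → ℝ≥0∞) (hf : ∀ b, Measurable (f b)) :
    Measurable fun a => (s.map fun b => f b a).sum := by
  induction s using Multiset.induction_on with
  | empty => simp
  | cons b s ih =>
    simp only [Multiset.map_cons, Multiset.sum_cons]
    exact (hf b).add ih

lemma lintegral_multiset_sum {α β : Type*} [MeasurableSpace α] (m : Measure α) (s : Multiset β)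
    (f : β → α → ℝ≥0∞) (hf : ∀ b, Measurable (f b)) :
    ∫⁻ a, (s.map fun b => f b a).sum ∂m = (s.map fun b => ∫⁻ a, f b a ∂m).sum := by
  induction s using Multiset.induction_on with
  | empty => simp
  | cons b s ih =>
    simp only [Multiset.map_cons, Multiset.sum_cons]
    rw [lintegral_add_left (hf b), ih]

/-- A polynomial of degree at most `d` is rarely smaller than `T ^ (-d)` times its value at a given
point. -/
lemma volume_pow_mul_norm_eval_le {R ρ : ℝ} {z₀ : ℂ} {K : ℝ≥0∞} (hρ : R + ‖z₀‖ ≤ ρ)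
    (hK : ∀ w : ℂ, ∫⁻ z in Metric.ball (0 : ℂ) R,
      ENNReal.ofReal (1 + ρ * ‖z - w‖⁻¹) ≤ K)
    {p : ℂ[X]} (hp : p.eval z₀ ≠ 0) {d : ℕ} (hd : 0 < d) (hpd : p.natDegree ≤ d) {T : ℝ}
    (hT : 1 < T) :
    volume {z ∈ Metric.ball (0 : ℂ) R | T ^ d * ‖p.eval z‖ ≤ ‖p.eval z₀‖} ≤ K / ENNReal.ofReal T := by
  have hp0 : p ≠ 0 := by
    rintro rfl
    simp at hp
  have hT0 : 0 < T := by linarith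
  set n := p.roots.card with hn
  have hnd : n = p.natDegree := IsAlgClosed.card_roots_eq_natDegree
  let x : ℂ → ℂ → ℝ := fun z w => 1 + ρ * ‖z - w‖⁻¹
  have hfin : (p.rootSet ℂ).Finite := rootSet_finite p ℂ
  have hnull : volume {z : ℂ | p.eval z = 0} = 0 := by
    refine (Set.Finite.subset hfin fun z hz => ?_).measure_zero _
    rw [mem_rootSet]
    exact ⟨hp0, by simpa using hz⟩
  -- Passing from `z` to `z₀` multiplies each factor `|z - w|` by at most `x z w`. A drop by `T ^ d`
  -- therefore forces the product of the `x z w` to reach `T ^ n`, and AM–GM turns this into a sum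
  -- to which Markov's inequality applies.
  have hkey : ∀ z ∈ Metric.ball (0 : ℂ) R, p.eval z ≠ 0 → T ^ d * ‖p.eval z‖ ≤ ‖p.eval z₀‖ →
      0 < n ∧ n * T ≤ (p.roots.map (x z)).sum := by
    intro z hz hpz h
    have hzR : ‖z‖ < R := by simpa using hz
    have hR : 0 ≤ R := (norm_nonneg z).trans hzR.le
    have hρ0 : 0 ≤ ρ := le_trans (by positivity) hρ
    have hn0 : 0 < n := by
      rw [hnd, Nat.pos_iff_ne_zero]
      intro h0
      rw [eq_C_of_natDegree_eq_zero h0] at h hpz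
      simp only [eval_C] at h hpz
      have h1 : 1 < T ^ d := one_lt_pow₀ hT hd.ne'
      have := norm_pos_iff.2 hpz
      nlinarith
    refine ⟨hn0, card_mul_le_sum_of_pow_le_prod hT0 _ _ (fun w => by positivity) ?_⟩
    have h1 : T ^ n * ‖p.eval z‖ ≤ ‖p.eval z₀‖ := by
      refine le_trans ?_ h
      gcongr
      · exact hT.le
      · omega
    have h2 : ‖p.eval z₀‖ ≤ (p.roots.map (x z)).prod * ‖p.eval z‖ := by
      rw [norm_eval_eq_prod_roots p z, norm_eval_eq_prod_roots p z₀, mul_left_comm,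
        ← Multiset.prod_map_mul]
      gcongr
      refine Multiset.prod_map_le_prod_map₀ _ _ (fun w _ => norm_nonneg _) fun w hw => ?_
      have hzw : z - w ≠ 0 := by
        intro h0
        rw [sub_eq_zero] at h0
        subst h0
        exact hpz ((mem_roots hp0).1 hw)
      have h3 : ‖z - w‖ ≠ 0 := norm_ne_zero_iff.2 hzw
      simp only [x]
      calc ‖z₀ - w‖ = ‖(z - w) + (z₀ - z)‖ := by ring_nf
        _ ≤ ‖z - w‖ + ‖z₀ - z‖ := norm_add_le _ _
        _ ≤ ‖z - w‖ + ρ := by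
          gcongr
          refine (norm_sub_le _ _).trans ?_
          linarith
        _ = _ := by field_simp
    exact le_of_mul_le_mul_right (h1.trans h2) (norm_pos_iff.2 hpz)
  rcases Nat.eq_zero_or_pos n with hn0 | hn0
  · refine le_trans (measure_mono_null ?_ hnull).le zero_le
    rintro z ⟨hz, h⟩
    by_contra hpz
    exact absurd (hkey z hz hpz h).1 (by omega)
  have hR : 0 ≤ R ∨ Metric.ball (0 : ℂ) R = ∅ := by
    rcases le_or_gt 0 R with h | h
    · exact Or.inl h
    · exact Or.inr (Metric.ball_eq_empty.2 h.le)
  rcases hR with hR | hR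
  swap
  · simp [hR]
  have hmeas : ∀ w, Measurable fun z => ENNReal.ofReal (x z w) := fun w => by
    simp only [x]
    fun_prop
  have hmeas' : Measurable fun z => (p.roots.map fun w => ENNReal.ofReal (x z w)).sum := by
    exact measurable_multiset_sum_map _ _ hmeas
  have hρ0 : 0 ≤ ρ := le_trans (by positivity) hρ
  have hx0 : ∀ z w, 0 ≤ x z w := fun z w => by positivity
  have hsum : ∀ z, (p.roots.map fun w => ENNReal.ofReal (x z w)).sum =
      ENNReal.ofReal (p.roots.map (x z)).sum := by
    intro z
    induction p.roots using Multiset.induction_on with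
    | empty => simp
    | cons a s ih =>
      simp only [Multiset.map_cons, Multiset.sum_cons]
      rw [ENNReal.ofReal_add (hx0 _ _), ih]
      exact Multiset.sum_nonneg (by
        simp only [Multiset.mem_map, forall_exists_index, and_imp, forall_apply_eq_imp_iff₂]
        exact fun w _ => hx0 _ _)
  have hmarkov : volume {z ∈ Metric.ball (0 : ℂ) R | T ^ d * ‖p.eval z‖ ≤ ‖p.eval z₀‖} ≤
      (volume.restrict (Metric.ball (0 : ℂ) R))
        {z | ENNReal.ofReal (n * T) ≤ (p.roots.map fun w => ENNReal.ofReal (x z w)).sum} := by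
    rw [Measure.restrict_apply (measurableSet_le measurable_const hmeas')]
    refine (measure_mono (t := ({z | ENNReal.ofReal (n * T) ≤
      (p.roots.map fun w => ENNReal.ofReal (x z w)).sum} ∩ Metric.ball (0 : ℂ) R) ∪
      {z : ℂ | p.eval z = 0}) ?_).trans ((measure_union_le _ _).trans ?_)
    · rintro z ⟨hz, h⟩
      by_cases hpz : p.eval z = 0
      · exact Or.inr hpz
      · refine Or.inl ⟨?_, hz⟩
        simp only [Set.mem_ofPred_eq]
        rw [hsum]
        exact ENNReal.ofReal_le_ofReal (hkey z hz hpz h).2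
    · rw [hnull, add_zero]
  refine hmarkov.trans ((meas_ge_le_lintegral_div hmeas'.aemeasurable ?_ ENNReal.ofReal_ne_top).trans ?_)
  · simp only [ne_eq, ENNReal.ofReal_eq_zero, not_le]
    positivity
  · rw [lintegral_multiset_sum _ _ (fun w z => ENNReal.ofReal (x z w)) hmeas,
      ENNReal.ofReal_mul (by positivity), ENNReal.ofReal_natCast]
    calc _ ≤ ((n : ℝ≥0∞) * K) / (n * ENNReal.ofReal T) := by
          gcongr
          have : (p.roots.map fun w => ∫⁻ z in Metric.ball (0 : ℂ) R, ENNReal.ofReal (x z w)).sum ≤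
              (p.roots.map fun w => K).sum := Multiset.sum_map_le_sum_map _ _ fun w _ => hK w
          refine this.trans (le_of_eq ?_)
          simp [hn]
      _ = K / ENNReal.ofReal T := by
          refine ENNReal.mul_div_mul_left _ _ ?_ (ENNReal.natCast_ne_top _)
          simp only [ne_eq, Nat.cast_eq_zero]
          omega

/-! ### Derivatives, Cauchy transforms and point counts in discs. -/

lemma eval_iterate_derivative_prod {ι : Type*} (s : Finset ι) (a : ι → ℂ) (z : ℂ)
    (hz : ∀ j ∈ s, z - a j ≠ 0) (k : ℕ) :
    (derivative^[k] (∏ j ∈ s, (X - C (a j)))).eval z =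
      k.factorial * (∏ j ∈ s, (1 + C (z - a j)⁻¹ * X) : ℂ[X]).coeff k * ∏ j ∈ s, (z - a j) := by
  -- Expanding at `z` makes each factor `(z - a_j) + X`; pulling out `z - a_j` leaves the generating
  -- polynomial, and the derivative is `k!` times a Taylor coefficient.
  have h1 : taylor z (∏ j ∈ s, (X - C (a j))) =
      C (∏ j ∈ s, (z - a j)) * ∏ j ∈ s, (1 + C (z - a j)⁻¹ * X) := by
    rw [map_prod C, ← Finset.prod_mul_distrib]
    have : taylor z (∏ j ∈ s, (X - C (a j))) = ∏ j ∈ s, taylor z (X - C (a j)) :=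
      map_prod (taylorAlgHom z) _ _
    rw [this]
    refine Finset.prod_congr rfl fun j hj => ?_
    rw [mul_add, ← mul_assoc, ← C_mul, mul_inv_cancel₀ (hz j hj), map_sub, taylor_X, taylor_C, C_sub,
      C_1]
    ring
  rw [← factorial_smul_hasseDeriv, LinearMap.smul_apply, eval_smul, ← taylor_coeff, h1, coeff_C_mul,
    nsmul_eq_mul]
  ring

lemma eval_derivative_prod_eq {ι : Type*} (s : Finset ι) (a : ι → ℂ) (z : ℂ)
    (hz : ∀ j ∈ s, z - a j ≠ 0) :
    (derivative (∏ j ∈ s, (X - C (a j)))).eval z =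
      (∑ j ∈ s, (z - a j)⁻¹) * ∏ j ∈ s, (z - a j) := by
  simpa [coeff_prod_one_add_one] using eval_iterate_derivative_prod s a z hz 1

/-- The number of points of `ζ` in the open ball with centre `y` and radius `r`. -/
def ballCount {m : ℕ} (y : ℂ) (r : ℝ) (ζ : Fin m → ℂ) : ℤ :=
  ∑ j, (Metric.ball y r).indicator 1 (ζ j)

lemma circleIntegral_sub_inv_eq {y a : ℂ} {r : ℝ} (hr : 0 < r) (ha : ‖a - y‖ ≠ r) :
    ∮ z in C(y, r), (z - a)⁻¹ =
      2 * Real.pi * Complex.I * ((Metric.ball y r).indicator (1 : ℂ → ℤ) a : ℤ) := by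
  by_cases h : a ∈ Metric.ball y r
  · rw [circleIntegral.integral_sub_inv_of_mem_ball h, Set.indicator_of_mem h]
    simp
  · rw [Set.indicator_of_notMem h]
    simp only [Int.cast_zero, mul_zero]
    have hlt : r < ‖a - y‖ := by
      rw [mem_ball_iff_norm] at h
      exact lt_of_le_of_ne (not_lt.1 h) ha.symm
    have hne : ∀ z ∈ Metric.closedBall y r, z - a ≠ 0 := by
      intro z hz h0
      rw [sub_eq_zero] at h0
      subst h0
      rw [mem_closedBall_iff_norm] at hz
      linarith
    refine Complex.circleIntegral_eq_zero_of_differentiable_on_off_countable hr.le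
      (s := ∅) Set.countable_empty ?_ ?_
    · exact ContinuousOn.inv₀ (by fun_prop) hne
    · intro z hz
      exact DifferentiableAt.inv (by fun_prop) (hne z (Metric.ball_subset_closedBall hz.1))

lemma circleIntegrable_sum_sub_inv {m : ℕ} {y : ℂ} {r : ℝ} (hr : 0 < r) (ζ : Fin m → ℂ)
    (hζ : ∀ j, ‖ζ j - y‖ ≠ r) : CircleIntegrable (fun z => ∑ j, (z - ζ j)⁻¹) y r := by
  have := CircleIntegrable.sum (c := y) (R := r) Finset.univ (f := fun j z => (z - ζ j)⁻¹)
    fun j _ => circleIntegrable_sub_inv_iff.2 (Or.inr (by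
      simpa [abs_of_pos hr, mem_sphere_iff_norm] using hζ j))
  convert this using 1
  ext z
  simp

/-- If two samples have different numbers of points in a disc, then the difference of their Cauchy
transforms is not small everywhere on its boundary. -/
lemma exists_lt_norm_sum_sub_sum {m : ℕ} {y : ℂ} {r : ℝ} (hr : 0 < r) {ζ ζ' : Fin m → ℂ}
    (hζ : ∀ j, ‖ζ j - y‖ ≠ r) (hζ' : ∀ j, ‖ζ' j - y‖ ≠ r)
    (hne : ballCount y r ζ ≠ ballCount y r ζ') :
    ∃ z₀, ‖z₀ - y‖ = r ∧ (2 * r)⁻¹ < ‖∑ j, (z₀ - ζ j)⁻¹ - ∑ j, (z₀ - ζ' j)⁻¹‖ := by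
  by_contra! hcon
  -- The bound `1 / (2r)` on a circle of length `2πr` gives an integral of size at most `π`, whereas
  -- two different counts give at least `2π`.
  have h1 := circleIntegral.norm_integral_le_of_norm_le_const (c := y) hr.le
    (f := fun z => ∑ j, (z - ζ j)⁻¹ - ∑ j, (z - ζ' j)⁻¹) (C := (2 * r)⁻¹) fun z hz =>
      hcon z (mem_sphere_iff_norm.1 hz)
  have h2 : ∀ ξ : Fin m → ℂ, (∀ j, ‖ξ j - y‖ ≠ r) →
      ∮ z in C(y, r), ∑ j, (z - ξ j)⁻¹ = 2 * Real.pi * Complex.I * (ballCount y r ξ : ℤ) := by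
    intro ξ hξ
    rw [circleIntegral.integral_fun_sum fun j _ => circleIntegrable_sub_inv_iff.2 (Or.inr (by
      simpa [abs_of_pos hr, mem_sphere_iff_norm] using hξ j))]
    rw [Finset.sum_congr rfl fun j _ => circleIntegral_sub_inv_eq hr (hξ j), ← Finset.mul_sum,
      ballCount]
    push_cast
    rfl
  rw [circleIntegral.integral_sub (circleIntegrable_sum_sub_inv hr ζ hζ)
    (circleIntegrable_sum_sub_inv hr ζ' hζ'), h2 ζ hζ, h2 ζ' hζ', ← mul_sub, ← Int.cast_sub] at h1
  have h3 : (1 : ℝ) ≤ ‖((ballCount y r ζ - ballCount y r ζ' : ℤ) : ℂ)‖ := by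
    rw [Complex.norm_intCast]
    exact_mod_cast Int.one_le_abs (sub_ne_zero.2 hne)
  rw [norm_mul, norm_mul, norm_mul, Complex.norm_I] at h1
  simp only [Complex.norm_ofNat, Complex.norm_real, Real.norm_eq_abs, abs_of_pos Real.pi_pos,
    mul_one] at h1
  have h4 : 2 * Real.pi * r * (2 * r)⁻¹ = Real.pi := by field_simp
  rw [h4] at h1
  have := Real.pi_pos
  nlinarith

/-- The difference of the Cauchy transforms of two samples with different numbers of points in a
disc is small only on a small set. -/
lemma volume_norm_sum_sub_sum_le {R ρ : ℝ} {K : ℝ≥0∞}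
    (hK : ∀ w : ℂ, ∫⁻ z in Metric.ball (0 : ℂ) R, ENNReal.ofReal (1 + ρ * ‖z - w‖⁻¹) ≤ K)
    {m : ℕ} (hm : 0 < m) {y : ℂ} {r : ℝ} (hr : 0 < r) (hρ : R + (‖y‖ + r) ≤ ρ) {h : ℝ} (hh : 0 < h)
    {ζ ζ' : Fin m → ℂ} (hζ : ∀ j, h ≤ |‖ζ j - y‖ - r|) (hζ' : ∀ j, h ≤ |‖ζ' j - y‖ - r|)
    (hne : ballCount y r ζ ≠ ballCount y r ζ') {T η : ℝ} (hT : 1 < T) (hη : 0 ≤ η)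
    (hTη : (T * (1 + ρ / h)) ^ (2 * m) * (2 * r * η) ≤ 1) :
    volume {z ∈ Metric.ball (0 : ℂ) R | ‖∑ j, (z - ζ j)⁻¹ - ∑ j, (z - ζ' j)⁻¹‖ ≤ η} ≤
      K / ENNReal.ofReal T := by
  have hne' : ∀ a : ℂ, h ≤ |‖a - y‖ - r| → ‖a - y‖ ≠ r := by
    intro a ha h0
    rw [h0, sub_self, abs_zero] at ha
    linarith
  obtain ⟨z₀, hz₀, hH⟩ := exists_lt_norm_sum_sub_sum hr (fun j => hne' _ (hζ j))
    (fun j => hne' _ (hζ' j)) hne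
  -- The sample points keep distance `h` from the circle, hence from `z₀`.
  have hfar : ∀ a : ℂ, h ≤ |‖a - y‖ - r| → h ≤ ‖z₀ - a‖ := by
    intro a ha
    refine ha.trans ?_
    rw [← hz₀, ← norm_neg (z₀ - a)]
    refine (abs_norm_sub_norm_le _ _).trans (le_of_eq ?_)
    congr 1
    ring
  have hz₀n : ‖z₀‖ ≤ ‖y‖ + r := by
    calc ‖z₀‖ = ‖y + (z₀ - y)‖ := by ring_nf
      _ ≤ _ := by rw [← hz₀]; exact norm_add_le _ _
  set q₁ : ℂ[X] := ∏ j, (X - C (ζ j)) with hq₁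
  set q₂ : ℂ[X] := ∏ j, (X - C (ζ' j)) with hq₂
  -- Clearing denominators: away from the sample points `p` is the difference of Cauchy transforms
  -- times `q₁ q₂`.
  set p : ℂ[X] := derivative q₁ * q₂ - q₁ * derivative q₂ with hp
  have hpe : ∀ z, (∀ j, z - ζ j ≠ 0) → (∀ j, z - ζ' j ≠ 0) → p.eval z =
      (∑ j, (z - ζ j)⁻¹ - ∑ j, (z - ζ' j)⁻¹) * ((∏ j, (z - ζ j)) * ∏ j, (z - ζ' j)) := by
    intro z h1 h2
    rw [hp, eval_sub, eval_mul, eval_mul, hq₁, hq₂, eval_derivative_prod_eq _ _ _ fun j _ => h1 j,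
      eval_derivative_prod_eq _ _ _ fun j _ => h2 j, eval_prod, eval_prod]
    simp only [eval_sub, eval_X, eval_C]
    ring
  have hz₁ : ∀ j, z₀ - ζ j ≠ 0 := fun j => norm_pos_iff.1 (hh.trans_le (hfar _ (hζ j)))
  have hz₂ : ∀ j, z₀ - ζ' j ≠ 0 := fun j => norm_pos_iff.1 (hh.trans_le (hfar _ (hζ' j)))
  have hp0 : p.eval z₀ ≠ 0 := by
    rw [hpe z₀ hz₁ hz₂]
    refine mul_ne_zero (norm_pos_iff.1 (lt_trans (by positivity) hH)) (mul_ne_zero ?_ ?_)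
    · exact Finset.prod_ne_zero_iff.2 fun j _ => hz₁ j
    · exact Finset.prod_ne_zero_iff.2 fun j _ => hz₂ j
  have hdeg : p.natDegree ≤ 2 * m := by
    have d1 : q₁.natDegree = m := by
      rw [hq₁, natDegree_prod_of_monic _ _ fun j _ => monic_X_sub_C _]
      simp
    have d2 : q₂.natDegree = m := by
      rw [hq₂, natDegree_prod_of_monic _ _ fun j _ => monic_X_sub_C _]
      simp
    refine (natDegree_sub_le _ _).trans (max_le ?_ ?_)
    · refine natDegree_mul_le.trans ?_
      have := natDegree_derivative_le q₁
      omega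
    · refine natDegree_mul_le.trans ?_
      have := natDegree_derivative_le q₂
      omega
  have hvol := volume_pow_mul_norm_eval_le (R := R) (ρ := ρ) (z₀ := z₀) (by linarith) hK hp0
    (d := 2 * m) (by omega) hdeg hT
  refine le_trans ?_ hvol
  have hnull : volume (Set.range ζ ∪ Set.range ζ') = 0 :=
    ((Set.finite_range ζ).union (Set.finite_range ζ')).measure_zero _
  refine (measure_mono (t := {z ∈ Metric.ball (0 : ℂ) R | T ^ (2 * m) * ‖p.eval z‖ ≤ ‖p.eval z₀‖} ∪
    (Set.range ζ ∪ Set.range ζ')) ?_).trans ((measure_union_le _ _).trans (by rw [hnull, add_zero]))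
  rintro z ⟨hz, hzη⟩
  by_cases hzr : z ∈ Set.range ζ ∪ Set.range ζ'
  · exact Or.inr hzr
  refine Or.inl ⟨hz, ?_⟩
  have h1 : ∀ j, z - ζ j ≠ 0 := fun j h0 => hzr (Or.inl ⟨j, (sub_eq_zero.1 h0).symm⟩)
  have h2 : ∀ j, z - ζ' j ≠ 0 := fun j h0 => hzr (Or.inr ⟨j, (sub_eq_zero.1 h0).symm⟩)
  have hzR : ‖z‖ < R := by simpa using hz
  have hρ0 : 0 ≤ ρ := by linarith [norm_nonneg z, norm_nonneg y]
  -- The denominators at `z` exceed those at `z₀` by at most this factor, so a small difference at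
  -- `z` makes `p` small there relative to `p(z₀)`.
  have hprod : ∀ ξ : Fin m → ℂ, (∀ j, h ≤ |‖ξ j - y‖ - r|) →
      ∏ j, ‖z - ξ j‖ ≤ (1 + ρ / h) ^ m * ∏ j, ‖z₀ - ξ j‖ := by
    intro ξ hξ
    have : (1 + ρ / h) ^ m = ∏ _j : Fin m, (1 + ρ / h) := by simp
    rw [this, ← Finset.prod_mul_distrib]
    refine Finset.prod_le_prod (fun j _ => norm_nonneg _) fun j _ => ?_
    have hb := hfar _ (hξ j)
    calc ‖z - ξ j‖ = ‖(z₀ - ξ j) + (z - z₀)‖ := by ring_nf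
      _ ≤ ‖z₀ - ξ j‖ + ‖z - z₀‖ := norm_add_le _ _
      _ ≤ ‖z₀ - ξ j‖ + ρ := by
        gcongr
        exact (norm_sub_le _ _).trans (by linarith)
      _ = ‖z₀ - ξ j‖ + ρ / h * h := by field_simp
      _ ≤ ‖z₀ - ξ j‖ + ρ / h * ‖z₀ - ξ j‖ := by gcongr
      _ = _ := by ring
  simp only [hpe z h1 h2, hpe z₀ hz₁ hz₂, norm_mul, norm_prod]
  have hP1 : 0 ≤ ∏ j, ‖z - ζ j‖ := Finset.prod_nonneg fun _ _ => norm_nonneg _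
  have hP2 : 0 ≤ ∏ j, ‖z - ζ' j‖ := Finset.prod_nonneg fun _ _ => norm_nonneg _
  have hQ1 : 0 ≤ ∏ j, ‖z₀ - ζ j‖ := Finset.prod_nonneg fun _ _ => norm_nonneg _
  have hQ2 : 0 ≤ ∏ j, ‖z₀ - ζ' j‖ := Finset.prod_nonneg fun _ _ => norm_nonneg _
  calc T ^ (2 * m) * (‖∑ j, (z - ζ j)⁻¹ - ∑ j, (z - ζ' j)⁻¹‖ *
        ((∏ j, ‖z - ζ j‖) * ∏ j, ‖z - ζ' j‖))
      ≤ T ^ (2 * m) * (η * (((1 + ρ / h) ^ m * ∏ j, ‖z₀ - ζ j‖) *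
          ((1 + ρ / h) ^ m * ∏ j, ‖z₀ - ζ' j‖))) := by
        gcongr
        · exact hprod ζ hζ
        · exact hprod ζ' hζ'
    _ = ((T * (1 + ρ / h)) ^ (2 * m) * (2 * r * η)) *
          ((2 * r)⁻¹ * ((∏ j, ‖z₀ - ζ j‖) * ∏ j, ‖z₀ - ζ' j‖)) := by
        have : (2 * r) * (2 * r)⁻¹ = 1 := mul_inv_cancel₀ (by positivity)
        rw [mul_pow]
        linear_combination (- T ^ (2 * m) * η * ((1 + ρ / h) ^ (2 * m)) *
          ((∏ j, ‖z₀ - ζ j‖) * ∏ j, ‖z₀ - ζ' j‖)) * this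
    _ ≤ 1 * ((2 * r)⁻¹ * ((∏ j, ‖z₀ - ζ j‖) * ∏ j, ‖z₀ - ζ' j‖)) := by gcongr
    _ ≤ _ := by
        rw [one_mul]
        gcongr

/-! ### Collisions of lattice random walks, by Fourier analysis on the torus. -/

/-- The product of `L` copies of Lebesgue measure on `(-π, π]`. -/
def torusMeasure (L : ℕ) : Measure (Fin L → ℝ) :=
  Measure.pi fun _ => volume.restrict (Set.Ioc (-Real.pi) Real.pi)

instance (L : ℕ) : IsFiniteMeasure (torusMeasure L) := by
  unfold torusMeasure
  infer_instance

/-- The character `θ ↦ exp (i θ·k)` of the torus. -/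
def torusChar {L : ℕ} (θ : Fin L → ℝ) (k : Fin L → ℤ) : ℂ :=
  Complex.exp (∑ l, Complex.I * (θ l * k l))

lemma norm_torusChar {L : ℕ} (θ : Fin L → ℝ) (k : Fin L → ℤ) : ‖torusChar θ k‖ = 1 := by
  have : ∑ l, Complex.I * (θ l * k l) = Complex.I * ((∑ l, θ l * k l : ℝ) : ℂ) := by
    push_cast
    rw [Finset.mul_sum]
  rw [torusChar, this, mul_comm, Complex.norm_exp_ofReal_mul_I]

lemma torusChar_add {L : ℕ} (θ : Fin L → ℝ) (k k' : Fin L → ℤ) :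
    torusChar θ (k + k') = torusChar θ k * torusChar θ k' := by
  rw [torusChar, torusChar, torusChar, ← Complex.exp_add, ← Finset.sum_add_distrib]
  congr 1
  refine Finset.sum_congr rfl fun l _ => ?_
  push_cast [Pi.add_apply]
  ring

lemma torusChar_zero {L : ℕ} (θ : Fin L → ℝ) : torusChar θ 0 = 1 := by simp [torusChar]

lemma torusChar_sum {L : ℕ} {ι : Type*} (s : Finset ι) (θ : Fin L → ℝ) (k : ι → Fin L → ℤ) :
    torusChar θ (∑ j ∈ s, k j) = ∏ j ∈ s, torusChar θ (k j) := by
  classical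
  induction s using Finset.induction_on with
  | empty => simp [torusChar_zero]
  | insert a s ha ih => rw [Finset.sum_insert ha, Finset.prod_insert ha, torusChar_add, ih]

lemma torusChar_sub {L : ℕ} (θ : Fin L → ℝ) (k k' : Fin L → ℤ) :
    torusChar θ (k - k') = torusChar θ k * starRingEnd ℂ (torusChar θ k') := by
  rw [torusChar, torusChar, torusChar, ← Complex.exp_conj, ← Complex.exp_add, map_sum,
    ← Finset.sum_add_distrib]
  congr 1
  refine Finset.sum_congr rfl fun l _ => ?_
  simp only [map_mul, Complex.conj_I, Complex.conj_ofReal, map_intCast, Pi.sub_apply]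
  push_cast
  ring

lemma measurable_torusChar {L : ℕ} {Y : Type*} [MeasurableSpace Y] {f : Y → Fin L → ℝ}
    {g : Y → Fin L → ℤ} (hf : Measurable f) (hg : Measurable g) :
    Measurable fun y => torusChar (f y) (g y) := by
  refine Complex.measurable_exp.comp (Finset.measurable_sum _ fun l _ => ?_)
  have h1 : Measurable fun y => ((f y l : ℝ) : ℂ) := by fun_prop
  have h2 : Measurable fun y => ((g y l : ℤ) : ℂ) :=
    (measurable_from_top (f := fun k : ℤ => (k : ℂ))).comp ((measurable_pi_apply l).comp hg)
  exact (h1.mul h2).const_mul _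

lemma integral_exp_mul_int (k : ℤ) (hk : k ≠ 0) :
    ∫ x in Set.Ioc (-Real.pi) Real.pi, Complex.exp (Complex.I * (x * k)) = 0 := by
  rw [← intervalIntegral.integral_of_le (by linarith [Real.pi_pos])]
  have hc : Complex.I * (k : ℂ) ≠ 0 := mul_ne_zero Complex.I_ne_zero (by exact_mod_cast hk)
  have h1 : ∀ x : ℝ, Complex.I * ((x : ℂ) * k) = Complex.I * (k : ℂ) * x := fun x => by ring
  simp_rw [h1]
  rw [integral_exp_mul_complex hc]
  have : Complex.exp (Complex.I * k * (Real.pi : ℝ)) =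
      Complex.exp (Complex.I * k * ((-Real.pi : ℝ) : ℂ)) := by
    rw [Complex.exp_eq_exp_iff_exists_int]
    refine ⟨k, ?_⟩
    push_cast
    ring
  rw [this, sub_self, zero_div]

lemma integral_torusChar {L : ℕ} (k : Fin L → ℤ) (hk : k ≠ 0) :
    ∫ θ, torusChar θ k ∂torusMeasure L = 0 := by
  obtain ⟨l, hl⟩ := Function.ne_iff.1 hk
  have h1 : ∀ θ : Fin L → ℝ, torusChar θ k = ∏ i, Complex.exp (Complex.I * (θ i * k i)) := fun θ => by
    rw [torusChar, Complex.exp_sum]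
  simp_rw [h1]
  rw [torusMeasure, integral_fintype_prod_eq_prod (𝕜 := ℂ)
    (fun i (x : ℝ) => Complex.exp (Complex.I * (x * k i)))]
  exact Finset.prod_eq_zero (Finset.mem_univ l) (integral_exp_mul_int _ hl)

lemma torusMeasure_real_univ (L : ℕ) : (torusMeasure L).real Set.univ = (2 * Real.pi) ^ L := by
  rw [measureReal_def, torusMeasure, Measure.pi_univ]
  simp only [Measure.restrict_apply_univ, Real.volume_Ioc, Finset.prod_const, Finset.card_univ,
    Fintype.card_fin, ENNReal.toReal_pow]
  rw [ENNReal.toReal_ofReal (by linarith [Real.pi_pos])]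
  ring

/-- The characteristic function bound: a lattice valued map that takes the values `0` and `e_l`
with probability at least `p`. -/
lemma norm_integral_torusChar_sq_le {Y : Type*} [MeasurableSpace Y] (μ : Measure Y)
    [IsProbabilityMeasure μ] {L : ℕ} {v : Y → Fin L → ℤ} (hv : Measurable v) {U : Fin L → Set Y}
    {U₀ : Set Y} (hU : ∀ l, MeasurableSet (U l)) (hU₀ : MeasurableSet U₀)
    (hvU : ∀ l, ∀ a ∈ U l, v a = Pi.single l 1) (hvU₀ : ∀ a ∈ U₀, v a = 0) {p : ℝ} (hp : 0 ≤ p)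
    (hpU : ∀ l, p ≤ μ.real (U l)) (hpU₀ : p ≤ μ.real U₀) {θ : Fin L → ℝ}
    (hθ : ∀ l, |θ l| ≤ Real.pi) :
    ‖∫ a, torusChar θ (v a) ∂μ‖ ^ 2 ≤ Real.exp (-(2 * p ^ 2 / Real.pi ^ 2) * ∑ l, θ l ^ 2) := by
  have hint : Integrable (fun a => torusChar θ (v a)) μ :=
    Integrable.of_bound (measurable_torusChar measurable_const hv).aestronglyMeasurable 1
      (Eventually.of_forall fun a => (norm_torusChar _ _).le)
  have hint2 : Integrable (fun q : Y × Y => torusChar θ (v q.1 - v q.2)) (μ.prod μ) := by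
    refine Integrable.of_bound ?_ 1 (Eventually.of_forall fun a => (norm_torusChar _ _).le)
    refine (measurable_torusChar measurable_const ?_).aestronglyMeasurable
    exact (hv.comp measurable_fst).sub (hv.comp measurable_snd)
  -- Symmetrisation: the squared modulus is the characteristic function of the difference of two
  -- independent copies.
  have h1 : (((‖∫ a, torusChar θ (v a) ∂μ‖ ^ 2 : ℝ)) : ℂ) =
      ∫ q : Y × Y, torusChar θ (v q.1 - v q.2) ∂(μ.prod μ) := by
    simp_rw [torusChar_sub]
    rw [integral_prod_mul (fun a => torusChar θ (v a)) (fun a => starRingEnd ℂ (torusChar θ (v a))),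
      integral_conj, Complex.mul_conj, Complex.normSq_eq_norm_sq]
  have h2 : ‖∫ a, torusChar θ (v a) ∂μ‖ ^ 2 =
      ∫ q : Y × Y, (torusChar θ (v q.1 - v q.2)).re ∂(μ.prod μ) := by
    have := congrArg Complex.re h1
    rw [Complex.ofReal_re] at this
    rw [this]
    exact (integral_re hint2).symm
  have hind : ∀ l, Integrable ((U l ×ˢ U₀).indicator fun _ => 1 - Real.cos (θ l)) (μ.prod μ) :=
    fun l => (integrable_const _).indicator ((hU l).prod hU₀)
  -- On `U l ×ˢ U₀` the symmetrised step is the basis vector `e_l`, with real part `cos θ_l`;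
  -- elsewhere the trivial bound `1` is used. The rectangles are disjoint, so at most one term of
  -- the sum is present.
  have h3 : ∀ q : Y × Y, (torusChar θ (v q.1 - v q.2)).re ≤
      1 - ∑ l, (U l ×ˢ U₀).indicator (fun _ => 1 - Real.cos (θ l)) q := by
    intro q
    by_cases hq : ∃ l, q ∈ U l ×ˢ U₀
    · obtain ⟨l, hl⟩ := hq
      have hval : (torusChar θ (v q.1 - v q.2)).re = Real.cos (θ l) := by
        rw [hvU l q.1 hl.1, hvU₀ q.2 hl.2, sub_zero, torusChar,
          Finset.sum_eq_single l (fun i _ hi => by simp [Pi.single_eq_of_ne hi]) (by simp)]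
        simp only [Pi.single_eq_same, Int.cast_one, mul_one]
        rw [mul_comm, Complex.exp_ofReal_mul_I_re]
      rw [Finset.sum_eq_single l, Set.indicator_of_mem hl, hval]
      · linarith
      · intro i _ hi
        refine Set.indicator_of_notMem (fun hmem => ?_) _
        have e := (hvU i q.1 hmem.1).symm.trans (hvU l q.1 hl.1)
        have := congrFun e i
        simp [Pi.single_eq_of_ne hi] at this
      · simp
    · push Not at hq
      rw [Finset.sum_eq_zero fun l _ => Set.indicator_of_notMem (hq l) _, sub_zero]
      exact (Complex.re_le_norm _).trans (norm_torusChar _ _).le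
  have h4 : ‖∫ a, torusChar θ (v a) ∂μ‖ ^ 2 ≤ 1 - ∑ l, p ^ 2 * (1 - Real.cos (θ l)) := by
    rw [h2]
    have hint3 : Integrable (fun q : Y × Y => 1 -
        ∑ l, (U l ×ˢ U₀).indicator (fun _ => 1 - Real.cos (θ l)) q) (μ.prod μ) :=
      (integrable_const 1).sub (integrable_finsetSum _ fun l _ => hind l)
    refine (integral_mono hint2.re hint3 h3).trans ?_
    rw [integral_sub (integrable_const 1) (integrable_finsetSum _ fun l _ => hind l),
      integral_finsetSum _ fun l _ => hind l]
    simp only [integral_const, probReal_univ, smul_eq_mul, mul_one]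
    gcongr with l
    rw [integral_indicator_const _ ((hU l).prod hU₀), measureReal_prod_prod, smul_eq_mul]
    have := Real.cos_le_one (θ l)
    have h5 : p ^ 2 ≤ μ.real (U l) * μ.real U₀ := by
      rw [sq]
      exact mul_le_mul (hpU l) hpU₀ hp (hp.trans (hpU l))
    exact mul_le_mul_of_nonneg_right h5 (by linarith)
  refine h4.trans (le_trans ?_ (Real.one_sub_le_exp_neg ((2 * p ^ 2 / Real.pi ^ 2) * ∑ l, θ l ^ 2)
    |>.trans_eq (by ring_nf)))
  gcongr
  rw [Finset.mul_sum]
  refine Finset.sum_le_sum fun l _ => ?_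
  have := Real.cos_le_one_sub_mul_cos_sq (hθ l)
  calc 2 * p ^ 2 / Real.pi ^ 2 * θ l ^ 2 = p ^ 2 * (2 / Real.pi ^ 2 * θ l ^ 2) := by ring
    _ ≤ _ := by
      gcongr
      linarith

lemma measurable_sum_lattice {Y : Type*} [MeasurableSpace Y] {L m : ℕ} {v : Y → Fin L → ℤ}
    (hv : Measurable v) : Measurable fun ζ : Fin m → Y => ∑ j, v (ζ j) :=
  Finset.measurable_sum _ fun j _ => hv.comp (measurable_pi_apply j)

/-- The probability that two independent lattice random walks meet at time `m`. -/
lemma collision_probability_le {Y : Type*} [MeasurableSpace Y] (μ : Measure Y)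
    [IsProbabilityMeasure μ] {L : ℕ} {v : Y → Fin L → ℤ} (hv : Measurable v) {U : Fin L → Set Y}
    {U₀ : Set Y} (hU : ∀ l, MeasurableSet (U l)) (hU₀ : MeasurableSet U₀)
    (hvU : ∀ l, ∀ a ∈ U l, v a = Pi.single l 1) (hvU₀ : ∀ a ∈ U₀, v a = 0) {p : ℝ} (hp : 0 < p)
    (hpU : ∀ l, p ≤ μ.real (U l)) (hpU₀ : p ≤ μ.real U₀) {m : ℕ} (hm : 0 < m) :
    ((Measure.pi fun _ : Fin m => μ).prod (Measure.pi fun _ : Fin m => μ)).real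
      {q | ∑ j, v (q.1 j) = ∑ j, v (q.2 j)} ≤
        √(Real.pi / (2 * p ^ 2 / Real.pi ^ 2 * m)) ^ L := by
  set ν := Measure.pi fun _ : Fin m => μ
  set c := 2 * p ^ 2 / Real.pi ^ 2 with hc
  have hc0 : 0 < c := by positivity
  have hS : MeasurableSet {q : (Fin m → Y) × (Fin m → Y) | ∑ j, v (q.1 j) = ∑ j, v (q.2 j)} :=
    measurableSet_eq_fun ((measurable_sum_lattice hv).comp measurable_fst)
      ((measurable_sum_lattice hv).comp measurable_snd)
  have hmeas : Measurable fun r : ((Fin m → Y) × (Fin m → Y)) × (Fin L → ℝ) =>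
      torusChar r.2 (∑ j, v (r.1.1 j) - ∑ j, v (r.1.2 j)) := by
    refine measurable_torusChar measurable_snd (.sub ?_ ?_)
    · exact (measurable_sum_lattice hv).comp (measurable_fst.comp measurable_fst)
    · exact (measurable_sum_lattice hv).comp (measurable_snd.comp measurable_fst)
  have hint : Integrable (fun r : ((Fin m → Y) × (Fin m → Y)) × (Fin L → ℝ) =>
      torusChar r.2 (∑ j, v (r.1.1 j) - ∑ j, v (r.1.2 j))) ((ν.prod ν).prod (torusMeasure L)) :=
    Integrable.of_bound hmeas.aestronglyMeasurable 1
      (Eventually.of_forall fun a => (norm_torusChar _ _).le)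
  -- Orthogonality of characters: integrating over the torus detects collisions.
  have h1 : ∀ q : (Fin m → Y) × (Fin m → Y),
      ∫ θ, torusChar θ (∑ j, v (q.1 j) - ∑ j, v (q.2 j)) ∂torusMeasure L =
        {q : (Fin m → Y) × (Fin m → Y) | ∑ j, v (q.1 j) = ∑ j, v (q.2 j)}.indicator
          (fun _ => (((2 * Real.pi) ^ L : ℝ) : ℂ)) q := by
    intro q
    by_cases hq : ∑ j, v (q.1 j) = ∑ j, v (q.2 j)
    · have hq' : q ∈ {q : (Fin m → Y) × (Fin m → Y) | ∑ j, v (q.1 j) = ∑ j, v (q.2 j)} := hq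
      rw [Set.indicator_of_mem hq', hq, sub_self]
      simp only [torusChar_zero, integral_const, torusMeasure_real_univ]
      simp
    · have hq' : q ∉ {q : (Fin m → Y) × (Fin m → Y) | ∑ j, v (q.1 j) = ∑ j, v (q.2 j)} := hq
      rw [Set.indicator_of_notMem hq']
      exact integral_torusChar _ (sub_ne_zero.2 hq)
  have h2 : ∀ θ : Fin L → ℝ,
      ∫ q : (Fin m → Y) × (Fin m → Y), torusChar θ (∑ j, v (q.1 j) - ∑ j, v (q.2 j)) ∂(ν.prod ν) =
        (((‖∫ a, torusChar θ (v a) ∂μ‖ ^ 2) ^ m : ℝ) : ℂ) := by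
    intro θ
    simp_rw [torusChar_sub]
    rw [integral_prod_mul (fun ζ : Fin m → Y => torusChar θ (∑ j, v (ζ j)))
      (fun ζ : Fin m → Y => starRingEnd ℂ (torusChar θ (∑ j, v (ζ j)))),
      integral_conj, Complex.mul_conj, Complex.normSq_eq_norm_sq]
    simp_rw [torusChar_sum]
    rw [integral_fintype_prod_eq_pow (𝕜 := ℂ) (fun a => torusChar θ (v a)), norm_pow,
      Fintype.card_fin]
    push_cast
    ring
  have h3 : ((2 * Real.pi) ^ L * (ν.prod ν).real
      {q | ∑ j, v (q.1 j) = ∑ j, v (q.2 j)} : ℝ) =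
        ∫ θ, (‖∫ a, torusChar θ (v a) ∂μ‖ ^ 2) ^ m ∂torusMeasure L := by
    have e := integral_integral_swap (f := fun (q : (Fin m → Y) × (Fin m → Y)) θ =>
      torusChar θ (∑ j, v (q.1 j) - ∑ j, v (q.2 j))) hint
    simp_rw [h1, h2] at e
    rw [integral_indicator_const _ hS, integral_complex_ofReal] at e
    rw [← Complex.ofReal_inj, ← e, Complex.real_smul]
    push_cast
    ring
  have hbound : ∫ θ, (‖∫ a, torusChar θ (v a) ∂μ‖ ^ 2) ^ m ∂torusMeasure L ≤
      ∫ θ, ∏ l, Real.exp (-(c * m) * θ l ^ 2) ∂torusMeasure L := by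
    have hsupp : ∀ᵐ θ ∂torusMeasure L, ∀ l, |θ l| ≤ Real.pi := by
      rw [ae_all_iff]
      intro l
      have : ∀ᵐ x ∂(volume.restrict (Set.Ioc (-Real.pi) Real.pi)), |x| ≤ Real.pi := by
        filter_upwards [ae_restrict_mem measurableSet_Ioc] with x hx
        exact abs_le.2 ⟨hx.1.le, hx.2⟩
      exact (Measure.quasiMeasurePreserving_eval
        (fun _ : Fin L => volume.restrict (Set.Ioc (-Real.pi) Real.pi)) l).ae this
    refine integral_mono_of_nonneg (Eventually.of_forall fun θ => by positivity) ?_ ?_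
    · refine Integrable.of_bound ?_ 1 (Eventually.of_forall fun θ => ?_)
      · exact (Measurable.aestronglyMeasurable (by fun_prop))
      · rw [Real.norm_of_nonneg (Finset.prod_nonneg fun _ _ => (Real.exp_pos _).le)]
        refine Finset.prod_le_one (fun _ _ => (Real.exp_pos _).le) fun l _ => ?_
        rw [Real.exp_le_one_iff]
        have : 0 ≤ c * m * θ l ^ 2 := by positivity
        linarith
    · filter_upwards [hsupp] with θ hθ
      have h5 := norm_integral_torusChar_sq_le μ hv hU hU₀ hvU hvU₀ hp.le hpU hpU₀ hθ
      calc _ ≤ (Real.exp (-c * ∑ l, θ l ^ 2)) ^ m := by gcongr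
        _ = _ := by
          rw [← Real.exp_nat_mul, ← Real.exp_sum]
          congr 1
          rw [Finset.mul_sum, Finset.mul_sum]
          refine Finset.sum_congr rfl fun l _ => ?_
          ring
  -- Each coordinate integral is enlarged to a Gaussian integral over the whole line.
  have hgauss : ∫ θ, ∏ l, Real.exp (-(c * m) * θ l ^ 2) ∂torusMeasure L ≤
      √(Real.pi / (c * m)) ^ L := by
    rw [torusMeasure, integral_fintype_prod_eq_prod (𝕜 := ℝ)
      (fun _ (x : ℝ) => Real.exp (-(c * m) * x ^ 2)), Finset.prod_const, Finset.card_univ,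
      Fintype.card_fin]
    gcongr
    rw [← integral_gaussian]
    refine setIntegral_le_integral (integrable_exp_neg_mul_sq (by positivity))
      (Eventually.of_forall fun x => (Real.exp_pos _).le)
  have h2pi : (1 : ℝ) ≤ (2 * Real.pi) ^ L := one_le_pow₀ (by linarith [Real.pi_gt_three])
  calc _ ≤ (2 * Real.pi) ^ L * (ν.prod ν).real {q | ∑ j, v (q.1 j) = ∑ j, v (q.2 j)} :=
        le_mul_of_one_le_left measureReal_nonneg h2pi
    _ ≤ _ := h3.trans_le (hbound.trans hgauss)

/-! ### Disjoint discs of positive mass with light boundaries. -/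

/-- Most circles around `y` have thin neighbourhoods of small measure. -/
lemma exists_radius_measure_annulus_le (μ : Measure ℂ) [IsProbabilityMeasure μ] (y : ℂ) {a b : ℝ}
    (hab : a < b) : ∃ r ∈ Set.Ioo a b, ∃ K : ℝ≥0∞, K ≠ ∞ ∧
      ∀ i : ℕ, μ {w | |‖w - y‖ - r| < (1 / 4) ^ i} ≤ K * 2⁻¹ ^ i := by
  -- By Fubini an annulus of half-width `4^(-i)` has mean mass of order `4^(-i)` over the radii. The
  -- weight `2 ^ i` keeps the series summable, so almost every radius has a finite sum, which serves
  -- as the constant `K`.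
  let g : ℕ → ℝ → ℝ≥0∞ := fun i r => 2 ^ i * μ {w | |‖w - y‖ - r| < (1 / 4) ^ i}
  have hms : ∀ i : ℕ, MeasurableSet {q : ℝ × ℂ | |‖q.2 - y‖ - q.1| < (1 / 4) ^ i} := fun i =>
    measurableSet_lt (by fun_prop) measurable_const
  have hg : ∀ i, Measurable (g i) := fun i =>
    (measurable_measure_prodMk_left (hms i)).const_mul _
  have hgi : ∀ i, ∫⁻ r in Set.Ioo a b, g i r ≤ 2 * 2⁻¹ ^ i := by
    intro i
    calc ∫⁻ r in Set.Ioo a b, g i r ≤ ∫⁻ r, g i r := setLIntegral_le_lintegral _ _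
      _ = 2 ^ i * ∫⁻ r, μ {w | |‖w - y‖ - r| < (1 / 4) ^ i} :=
          lintegral_const_mul _ (measurable_measure_prodMk_left (hms i))
      _ = 2 ^ i * ∫⁻ w, volume {r : ℝ | |‖w - y‖ - r| < (1 / 4) ^ i} ∂μ := by
          congr 1
          have h1 := Measure.prod_apply (μ := (volume : Measure ℝ)) (ν := μ) (hms i)
          have h2 := Measure.prod_apply_symm (μ := (volume : Measure ℝ)) (ν := μ) (hms i)
          exact h1.symm.trans h2
      _ = 2 ^ i * ∫⁻ w, ENNReal.ofReal (2 * (1 / 4) ^ i) ∂μ := by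
          congr 1
          refine lintegral_congr fun w => ?_
          rw [← Real.volume_ball ‖w - y‖]
          congr 1
          ext r
          simp only [Set.mem_ofPred_eq, Metric.mem_ball, Real.dist_eq, abs_sub_comm]
      _ = 2 * 2⁻¹ ^ i := by
          rw [lintegral_const, measure_univ, mul_one, ENNReal.ofReal_mul zero_le_two,
            ENNReal.ofReal_pow (by norm_num), ENNReal.ofReal_div_of_pos (by norm_num)]
          simp only [ENNReal.ofReal_ofNat, ENNReal.ofReal_one, one_div]
          have h4 : (4 : ℝ≥0∞)⁻¹ = 2⁻¹ * 2⁻¹ := by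
            rw [← ENNReal.mul_inv (by simp) (by simp)]
            norm_num
          rw [h4, mul_pow, mul_left_comm, ← mul_assoc (2 ^ i : ℝ≥0∞), ← mul_pow,
            ENNReal.mul_inv_cancel two_ne_zero (by simp), one_pow, one_mul]
  have hsum : ∫⁻ r in Set.Ioo a b, ∑' i, g i r ≠ ∞ := by
    rw [lintegral_tsum fun i => (hg i).aemeasurable]
    refine ne_top_of_le_ne_top ?_ (ENNReal.tsum_le_tsum hgi)
    rw [ENNReal.tsum_mul_left, ENNReal.tsum_geometric]
    norm_num
  have hae := ae_lt_top (Measurable.tsum hg) hsum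
  have hpos : (volume.restrict (Set.Ioo a b)) ≠ 0 := by
    rw [Ne, Measure.restrict_eq_zero, Real.volume_Ioo]
    simp [hab]
  have : (ae (volume.restrict (Set.Ioo a b))).NeBot := ae_neBot.2 hpos
  obtain ⟨r, hr1, hr2⟩ := (hae.and (ae_restrict_mem measurableSet_Ioo)).exists
  refine ⟨r, hr2, ∑' i, g i r, hr1.ne, fun i => ?_⟩
  calc μ {w | |‖w - y‖ - r| < (1 / 4) ^ i} = g i r * 2⁻¹ ^ i := by
        simp only [g]
        rw [mul_right_comm, ← mul_pow, ENNReal.mul_inv_cancel two_ne_zero (by simp), one_pow,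
          one_mul]
    _ ≤ _ := by
        gcongr
        exact ENNReal.le_tsum i

/-- The data used to separate samples: disjoint discs of positive mass, with thin boundaries. -/
lemma exists_separated_discs (μ : Measure ℂ) [IsProbabilityMeasure μ] (hμ : μ.support.Infinite)
    (L : ℕ) : ∃ (y : Fin L → ℂ) (r : Fin L → ℝ) (U₀ : Set ℂ) (p : ℝ) (K : ℝ≥0∞),
      (∀ l, 0 < r l) ∧ 0 < p ∧ K ≠ ∞ ∧ MeasurableSet U₀ ∧ p ≤ μ.real U₀ ∧
      (∀ l, p ≤ μ.real (Metric.ball (y l) (r l))) ∧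
      (∀ l, Disjoint (Metric.ball (y l) (r l)) U₀) ∧
      (∀ l l', l ≠ l' → Disjoint (Metric.ball (y l) (r l)) (Metric.ball (y l') (r l'))) ∧
      ∀ l, ∀ i : ℕ, μ {w | |‖w - y l‖ - r l| < (1 / 4) ^ i} ≤ K * 2⁻¹ ^ i := by
  -- The extra point of the support carries `U₀`, where the random walk stands still.
  obtain ⟨t, ht, htc⟩ := hμ.exists_subset_card_eq (L + 1)
  let e : Fin (L + 1) ≃ t := (t.equivFinOfCardEq htc).symm
  let x : Fin (L + 1) → ℂ := fun i => (e i : ℂ)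
  have hxs : ∀ i, x i ∈ μ.support := fun i => ht (e i).2
  have hxi : Function.Injective x := Subtype.val_injective.comp e.injective
  have hsep : ∃ s > (0 : ℝ), ∀ i j, i ≠ j → 4 * s ≤ dist (x i) (x j) := by
    have : ∀ᶠ s in 𝓝[>] (0 : ℝ), ∀ i j, i ≠ j → 4 * s ≤ dist (x i) (x j) := by
      simp only [eventually_all]
      intro i j hij
      have hd : 0 < dist (x i) (x j) := dist_pos.2 (hxi.ne hij)
      have : Tendsto (fun s : ℝ => 4 * s) (𝓝[>] 0) (𝓝 0) := by
        have : Tendsto (fun s : ℝ => 4 * s) (𝓝 0) (𝓝 (4 * 0)) := (continuous_const_mul 4).tendsto 0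
        rw [mul_zero] at this
        exact this.mono_left nhdsWithin_le_nhds
      exact (this.eventually (gt_mem_nhds hd)).mono fun _ h => h.le
    obtain ⟨s, hs, hs0⟩ := (this.and self_mem_nhdsWithin).exists
    exact ⟨s, hs0, hs⟩
  obtain ⟨s, hs, hsep⟩ := hsep
  have hmass : ∀ i, ∀ r > 0, 0 < μ.real (Metric.ball (x i) r) := by
    intro i r hr
    rw [measureReal_def, ENNReal.toReal_pos_iff]
    exact ⟨Measure.mem_support_iff_forall _ |>.1 (hxs i) _ (Metric.ball_mem_nhds _ hr),
      measure_lt_top _ _⟩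
  -- Radii below `2 * s` keep the discs disjoint, since the centres are at least `4 * s` apart.
  choose r hr K hK hrK using fun l : Fin L =>
    exists_radius_measure_annulus_le μ (x l.castSucc) (show s < 2 * s by linarith)
  have hr0 : ∀ l, 0 < r l := fun l => hs.trans (hr l).1
  let M : Fin (L + 1) → ℝ := Fin.lastCases (μ.real (Metric.ball (x (Fin.last L)) s))
    fun l => μ.real (Metric.ball (x l.castSucc) (r l))
  have hM : ∀ i, 0 < M i := by
    intro i
    refine Fin.lastCases ?_ (fun l => ?_) i
    · simpa [M] using hmass _ _ hs
    · simpa [M] using hmass _ _ (hr0 l)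
  obtain ⟨i₀, -, hi₀⟩ := Finset.exists_min_image Finset.univ M ⟨0, Finset.mem_univ _⟩
  refine ⟨fun l => x l.castSucc, r, Metric.ball (x (Fin.last L)) s, M i₀, ∑ l, K l, hr0, hM i₀,
    ENNReal.sum_ne_top.2 fun l _ => hK l, Metric.isOpen_ball.measurableSet, ?_, ?_, ?_, ?_, ?_⟩
  · simpa [M] using hi₀ (Fin.last L) (Finset.mem_univ _)
  · intro l
    simpa [M] using hi₀ l.castSucc (Finset.mem_univ _)
  · intro l
    refine Metric.ball_disjoint_ball ?_
    have := hsep l.castSucc (Fin.last L) (Fin.castSucc_ne_last l)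
    linarith [(hr l).2]
  · intro l l' hl
    refine Metric.ball_disjoint_ball ?_
    have := hsep l.castSucc l'.castSucc (fun h => hl (Fin.castSucc_injective L h))
    linarith [(hr l).2, (hr l').2]
  · intro l i
    refine (hrK l i).trans ?_
    gcongr
    exact Finset.single_le_sum (f := K) (fun _ _ => zero_le) (Finset.mem_univ l)

/-! ### Anticoncentration of differences of Cauchy transforms. -/

lemma eventually_pow_le_two_pow_sqrt (B : ℕ) : ∀ᶠ m : ℕ in atTop, m ^ B ≤ 2 ^ Nat.sqrt m := by
  have h1 : Tendsto (fun i : ℕ => (i : ℝ) ^ (2 * B) / 2 ^ i) atTop (𝓝 0) :=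
    tendsto_pow_const_div_const_pow_of_one_lt _ one_lt_two
  have h2 := ((tendsto_add_atTop_nat 1).comp tendsto_sqrt_atTop)
  filter_upwards [(h1.comp h2).eventually (gt_mem_nhds (show (0 : ℝ) < 1 / 2 by norm_num))] with m hm
  simp only [Function.comp_apply] at hm
  rw [div_lt_iff₀ (by positivity), pow_succ (2 : ℝ)] at hm
  have h3 : (((Nat.sqrt m + 1) ^ (2 * B) : ℕ) : ℝ) ≤ ((2 ^ Nat.sqrt m : ℕ) : ℝ) := by
    push_cast at hm ⊢
    linarith
  have h4 : m ≤ (Nat.sqrt m + 1) ^ 2 := by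
    have := Nat.lt_succ_sqrt m
    rw [sq]
    exact this.le
  calc m ^ B ≤ ((Nat.sqrt m + 1) ^ 2) ^ B := Nat.pow_le_pow_left h4 B
    _ = (Nat.sqrt m + 1) ^ (2 * B) := by rw [pow_mul]
    _ ≤ _ := by exact_mod_cast h3

/-- With `m = √n` and `i = √m`, the area gain `T = 2^i` and boundary distance `h = 4^(-i)` cost `exp
(O(m i))`, and `m i ≤ m^(3/2)` is negligible against `εm² ≤ εn`. -/
lemma eventually_mul_pow_mul_exp_le {ε ρ r : ℝ} (hε : 0 < ε) (hρ : 0 ≤ ρ) (hr : 0 < r) :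
    ∀ᶠ n : ℕ in atTop, ((2 : ℝ) ^ Nat.sqrt (Nat.sqrt n) *
      (1 + ρ / (1 / 4) ^ Nat.sqrt (Nat.sqrt n))) ^ (2 * Nat.sqrt n) *
        (2 * r * Real.exp (-ε * n)) ≤ 1 := by
  set c := Real.log 8 + Real.log (1 + ρ) with hc
  have hsq : Tendsto (fun n : ℕ => (Nat.sqrt n : ℝ)) atTop atTop :=
    tendsto_natCast_atTop_atTop.comp tendsto_sqrt_atTop
  have hsq2 : Tendsto (fun n : ℕ => (Nat.sqrt (Nat.sqrt n) : ℝ)) atTop atTop :=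
    hsq.comp tendsto_sqrt_atTop
  filter_upwards [hsq2.eventually_ge_atTop 1, hsq2.eventually_ge_atTop (4 * c / ε),
    hsq.eventually_ge_atTop 1, hsq.eventually_ge_atTop (2 * Real.log (2 * r) / ε)]
    with n h1 h2 h3 h4
  set m := Nat.sqrt n with hm
  set i := Nat.sqrt m with hi
  have him : (i : ℝ) ^ 2 ≤ m := by exact_mod_cast Nat.sqrt_le' m
  have hmn : (m : ℝ) ^ 2 ≤ n := by exact_mod_cast Nat.sqrt_le' n
  have hlog : 0 ≤ Real.log (1 + ρ) := Real.log_nonneg (by linarith)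
  have hbase : (2 : ℝ) ^ i * (1 + ρ / (1 / 4) ^ i) ≤ Real.exp (i * c) := by
    have e1 : Real.exp (i * c) = 8 ^ i * (1 + ρ) ^ i := by
      rw [hc, mul_add, Real.exp_add, Real.exp_nat_mul, Real.exp_nat_mul, Real.exp_log (by norm_num),
        Real.exp_log (by linarith)]
    have e2 : ρ / (1 / 4) ^ i = ρ * 4 ^ i := by
      rw [one_div, inv_pow, div_inv_eq_mul]
    rw [e1, e2]
    have h41 : (1 : ℝ) ≤ 4 ^ i := one_le_pow₀ (by norm_num)
    have h1ρ : 1 + ρ ≤ (1 + ρ) ^ i := by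
      refine le_self_pow₀ (by linarith) ?_
      have : (1 : ℝ) ≤ i := h1
      intro h0
      rw [h0] at this
      norm_num at this
    calc (2 : ℝ) ^ i * (1 + ρ * 4 ^ i) ≤ 2 ^ i * ((1 + ρ) * 4 ^ i) := by
          gcongr
          linarith
      _ = 8 ^ i * (1 + ρ) := by
          rw [show (8 : ℝ) = 2 * 4 by norm_num, mul_pow]
          ring
      _ ≤ _ := by gcongr
  have hlogr : 2 * r = Real.exp (Real.log (2 * r)) := (Real.exp_log (by linarith)).symm
  calc _ ≤ Real.exp (i * c) ^ (2 * m) * (Real.exp (Real.log (2 * r)) * Real.exp (-ε * n)) := by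
        rw [← hlogr]
        gcongr
    _ = Real.exp (((2 * m : ℕ) : ℝ) * (i * c) + (Real.log (2 * r) + -ε * n)) := by
        rw [← Real.exp_nat_mul, ← Real.exp_add, ← Real.exp_add]
    _ ≤ 1 := by
        rw [Real.exp_le_one_iff]
        push_cast
        rw [div_le_iff₀ hε] at h2 h4
        have hm0 : (0 : ℝ) ≤ m := by positivity
        have k1 : (i : ℝ) * c ≤ i * (i * ε / 4) := by
          gcongr
          linarith
        have k2 : (i : ℝ) * c ≤ m * ε / 4 := by nlinarith
        have k3 : 2 * (m : ℝ) * (i * c) ≤ 2 * m * (m * ε / 4) := by gcongr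
        have k4 : (m : ℝ) * ε ≤ m * (m * ε) := le_mul_of_one_le_left (by positivity) h3
        have k5 : ε * (m : ℝ) ^ 2 ≤ ε * n := by gcongr
        nlinarith

/-- A measure with infinite support has rapid anticoncentration. -/
lemma rapidAnticoncentration (μ : Measure ℂ) [IsProbabilityMeasure μ] (hμ : μ.support.Infinite)
    {R : ℝ} (hR : 0 ≤ R) : RapidAnticoncentration μ (volume.restrict (Metric.ball (0 : ℂ) R)) := by
  intro ε hε A
  -- A collision in `ℤ^L` has probability of order `m^(-L/2) = m^(-(A + 1))`; the spare power
  -- absorbs the constant `KK`.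
  obtain ⟨L, hL⟩ : ∃ L, L = 2 * (A + 1) := ⟨_, rfl⟩
  obtain ⟨y, r, U₀, p, K, hr, hp, hK, hU₀, hpU₀, hpU, hd₀, hd, hann⟩ :=
    exists_separated_discs μ hμ L
  set ρ : ℝ := R + ∑ l, (‖y l‖ + r l) with hρ
  have hρl : ∀ l, R + (‖y l‖ + r l) ≤ ρ := fun l => by
    rw [hρ]
    gcongr
    exact Finset.single_le_sum (f := fun l => ‖y l‖ + r l)
      (fun l _ => add_nonneg (norm_nonneg _) (hr l).le) (Finset.mem_univ l)
  have hρ0 : 0 ≤ ρ := add_nonneg hR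
    (Finset.sum_nonneg fun l _ => add_nonneg (norm_nonneg _) (hr l).le)
  obtain ⟨K', hK', hKw⟩ := exists_lintegral_one_add_inv_norm_le R ρ hρ0
  set D : ℝ≥0∞ := volume (Metric.ball (0 : ℂ) R) with hD
  have hDtop : D ≠ ∞ := measure_ball_lt_top.ne
  set c := 2 * p ^ 2 / Real.pi ^ 2 with hc
  have hc0 : 0 < c := by positivity
  let v : ℂ → Fin L → ℤ := fun a l => (Metric.ball (y l) (r l)).indicator 1 a
  have hv : Measurable v := measurable_pi_lambda _ fun l =>
    measurable_one.indicator Metric.isOpen_ball.measurableSet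
  have hvU : ∀ l, ∀ a ∈ Metric.ball (y l) (r l), v a = Pi.single l 1 := by
    intro l a ha
    ext l'
    by_cases h : l' = l
    · subst h
      simp [v, Set.indicator_of_mem ha]
    · rw [Pi.single_eq_of_ne h]
      exact Set.indicator_of_notMem (Set.disjoint_left.1 (hd l l' (Ne.symm h)) ha) _
  have hvU₀ : ∀ a ∈ U₀, v a = 0 := by
    intro a ha
    ext l
    exact Set.indicator_of_notMem (Set.disjoint_right.1 (hd₀ l) ha) _
  set KK : ℝ≥0∞ := D * (2 * (L * K)) + D * ENNReal.ofReal ((Real.pi / c) ^ (A + 1)) + K' with hKK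
  have hKKtop : KK ≠ ∞ := by
    simp only [hKK, ne_eq, ENNReal.add_eq_top, not_or]
    refine ⟨⟨?_, ?_⟩, hK'⟩
    · exact ENNReal.mul_ne_top hDtop (ENNReal.mul_ne_top (by simp)
        (ENNReal.mul_ne_top (ENNReal.natCast_ne_top _) hK))
    · exact ENNReal.mul_ne_top hDtop ENNReal.ofReal_ne_top
  filter_upwards [eventually_all.2 fun l => eventually_mul_pow_mul_exp_le hε hρ0 (hr l),
    tendsto_sqrt_atTop.eventually (eventually_pow_le_two_pow_sqrt (A + 2)),
    (tendsto_sqrt_atTop.comp tendsto_sqrt_atTop).eventually_ge_atTop 1,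
    tendsto_sqrt_atTop.eventually_ge_atTop 1, eventually_const_mul_inv_pow_le KK hKKtop A]
    with n h1 h2 h3 h4 h5
  set m := Nat.sqrt n with hm
  simp only [Function.comp_apply] at h3
  rw [← hm] at h3
  set i := Nat.sqrt m with hi
  set ν := Measure.pi fun _ : Fin m => μ with hν
  set η := Real.exp (-ε * n) with hη
  let H : ℂ → (Fin m → ℂ) × (Fin m → ℂ) → ℂ :=
    fun z q => ∑ j, (z - q.1 j)⁻¹ - ∑ j, (z - q.2 j)⁻¹
  -- The two exceptional events: `G₁`, some point close to a boundary circle, and `G₂`, equal counts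
  -- in every disc. Outside both, the area estimate applies to one disc.
  let G₁ : Set ((Fin m → ℂ) × (Fin m → ℂ)) :=
    ⋃ l, ⋃ j, {q | |‖q.1 j - y l‖ - r l| < (1 / 4) ^ i} ∪ {q | |‖q.2 j - y l‖ - r l| < (1 / 4) ^ i}
  let G₂ : Set ((Fin m → ℂ) × (Fin m → ℂ)) := {q | ∑ j, v (q.1 j) = ∑ j, v (q.2 j)}
  have hannm : ∀ l, MeasurableSet {w : ℂ | |‖w - y l‖ - r l| < (1 / 4) ^ i} := fun l =>
    measurableSet_lt (by fun_prop) measurable_const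
  have hG₁m : MeasurableSet G₁ := by
    refine MeasurableSet.iUnion fun l => MeasurableSet.iUnion fun j => MeasurableSet.union ?_ ?_
    · exact (hannm l).preimage (f := fun q : (Fin m → ℂ) × (Fin m → ℂ) => q.1 j) (by fun_prop)
    · exact (hannm l).preimage (f := fun q : (Fin m → ℂ) × (Fin m → ℂ) => q.2 j) (by fun_prop)
  have hG₂m : MeasurableSet G₂ :=
    measurableSet_eq_fun ((measurable_sum_lattice hv).comp measurable_fst)
      ((measurable_sum_lattice hv).comp measurable_snd)
  have hm0 : (m : ℝ≥0∞) ≠ 0 := by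
    simp only [ne_eq, Nat.cast_eq_zero]
    omega
  have hmtop : (m : ℝ≥0∞) ≠ ∞ := ENNReal.natCast_ne_top _
  -- The exponent is `A + 2` because the union bound over the `m` sample points costs one power of
  -- `m`.
  have hpow : (2⁻¹ : ℝ≥0∞) ^ i ≤ (m : ℝ≥0∞)⁻¹ ^ (A + 2) := by
    rw [← ENNReal.inv_pow, ← ENNReal.inv_pow, ENNReal.inv_le_inv]
    exact_mod_cast h2
  have hpow' : (2⁻¹ : ℝ≥0∞) ^ i ≤ (m : ℝ≥0∞)⁻¹ ^ (A + 1) := by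
    refine hpow.trans (pow_le_pow_right_of_le_one' ?_ (Nat.le_succ (A + 1)))
    rw [ENNReal.inv_le_one]
    exact_mod_cast h4
  have hG₁ : (ν.prod ν) G₁ ≤ 2 * (L * K) * (m : ℝ≥0∞)⁻¹ ^ (A + 1) := by
    have hone : ∀ l (j : Fin m), (ν.prod ν) ({q | |‖q.1 j - y l‖ - r l| < (1 / 4) ^ i} ∪
        {q | |‖q.2 j - y l‖ - r l| < (1 / 4) ^ i}) ≤ 2 * (K * 2⁻¹ ^ i) := by
      intro l j
      refine (measure_union_le _ _).trans ?_
      have e1 := ((measurePreserving_eval (fun _ : Fin m => μ) j).comp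
        (measurePreserving_fst (μ := ν) (ν := ν))).measure_preimage (hannm l).nullMeasurableSet
      have e2 := ((measurePreserving_eval (fun _ : Fin m => μ) j).comp
        (measurePreserving_snd (μ := ν) (ν := ν))).measure_preimage (hannm l).nullMeasurableSet
      rw [two_mul]
      exact add_le_add (e1.trans_le (hann l i)) (e2.trans_le (hann l i))
    calc (ν.prod ν) G₁ ≤ ∑ l : Fin L, ∑ j : Fin m, 2 * (K * 2⁻¹ ^ i) := by
          refine (measure_iUnion_fintype_le _ _).trans (Finset.sum_le_sum fun l _ => ?_)
          exact (measure_iUnion_fintype_le _ _).trans (Finset.sum_le_sum fun j _ => hone l j)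
      _ = 2 * (L * K) * (m * 2⁻¹ ^ i) := by
          simp only [Finset.sum_const, Finset.card_univ, Fintype.card_fin, nsmul_eq_mul]
          ring
      _ ≤ 2 * (L * K) * (m * (m : ℝ≥0∞)⁻¹ ^ (A + 2)) := by gcongr
      _ = _ := by
          rw [pow_succ' _ (A + 1), ← mul_assoc (m : ℝ≥0∞), ENNReal.mul_inv_cancel hm0 hmtop, one_mul]
  have hG₂ : (ν.prod ν) G₂ ≤ ENNReal.ofReal ((Real.pi / c) ^ (A + 1)) * (m : ℝ≥0∞)⁻¹ ^ (A + 1) := by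
    have e1 := collision_probability_le μ hv
      (U := fun l => Metric.ball (y l) (r l)) (fun l => Metric.isOpen_ball.measurableSet) hU₀ hvU
      hvU₀ hp hpU hpU₀ (m := m) h4
    have hmpos : (0 : ℝ) < m := by exact_mod_cast h4
    have e2 : √(Real.pi / (c * m)) ^ L = (Real.pi / c) ^ (A + 1) * ((m : ℝ)⁻¹) ^ (A + 1) := by
      rw [hL, pow_mul, Real.sq_sqrt (by positivity), ← mul_pow]
      congr 1
      field_simp
    rw [← ofReal_measureReal]
    refine (ENNReal.ofReal_le_ofReal (e1.trans_eq e2)).trans_eq ?_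
    rw [ENNReal.ofReal_mul (by positivity), ENNReal.ofReal_pow (inv_nonneg.2 hmpos.le),
      ENNReal.ofReal_inv_of_pos hmpos, ENNReal.ofReal_natCast]
  have hmain : ∀ q : (Fin m → ℂ) × (Fin m → ℂ),
      (volume.restrict (Metric.ball (0 : ℂ) R)) {z | ‖H z q‖ ≤ η} ≤
        G₁.indicator (fun _ => D) q + (G₂.indicator (fun _ => D) q + K' * 2⁻¹ ^ i) := by
    intro q
    have hle : (volume.restrict (Metric.ball (0 : ℂ) R)) {z | ‖H z q‖ ≤ η} ≤ D :=
      (measure_mono (Set.subset_univ _)).trans (by simp [hD])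
    by_cases hq1 : q ∈ G₁
    · rw [Set.indicator_of_mem hq1]
      exact hle.trans le_self_add
    by_cases hq2 : q ∈ G₂
    · rw [Set.indicator_of_mem hq2]
      exact hle.trans (le_self_add.trans le_add_self)
    have hq3 : ∃ l, ballCount (y l) (r l) q.1 ≠ ballCount (y l) (r l) q.2 := by
      by_contra! hcon
      refine hq2 (show ∑ j, v (q.1 j) = ∑ j, v (q.2 j) from ?_)
      ext l
      simpa [ballCount, v] using hcon l
    obtain ⟨l, hl⟩ := hq3
    simp only [G₁, Set.mem_iUnion, Set.mem_union, not_exists, not_or] at hq1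
    refine le_trans ?_ (le_add_self.trans le_add_self)
    have hT : (1 : ℝ) < 2 ^ i := one_lt_pow₀ one_lt_two (by omega)
    have e1 := volume_norm_sum_sub_sum_le hKw (m := m) h4 (hr l) (hρl l)
      (h := (1 / 4) ^ i) (by positivity) (ζ := q.1) (ζ' := q.2)
      (fun j => not_lt.1 (hq1 l j).1) (fun j => not_lt.1 (hq1 l j).2) hl hT (Real.exp_pos _).le (h1 l)
    have hms : MeasurableSet {z | ‖H z q‖ ≤ η} := by
      refine measurableSet_le ?_ measurable_const
      simp only [H]
      fun_prop
    rw [Measure.restrict_apply hms, Set.inter_comm]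
    refine e1.trans_eq ?_
    rw [ENNReal.ofReal_pow zero_le_two, ENNReal.ofReal_ofNat, div_eq_mul_inv, ENNReal.inv_pow]
  have hmsH : MeasurableSet {s : ℂ × (Fin m → ℂ) × (Fin m → ℂ) | ‖H s.1 s.2‖ ≤ η} := by
    refine measurableSet_le ?_ measurable_const
    simp only [H]
    fun_prop
  calc ∫⁻ z in Metric.ball (0 : ℂ) R, (ν.prod ν) {q | ‖H z q‖ ≤ η}
      = ∫⁻ q, (volume.restrict (Metric.ball (0 : ℂ) R)) {z | ‖H z q‖ ≤ η} ∂(ν.prod ν) :=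
        (Measure.prod_apply hmsH).symm.trans (Measure.prod_apply_symm hmsH)
    _ ≤ ∫⁻ q, (G₁.indicator (fun _ => D) q + (G₂.indicator (fun _ => D) q + K' * 2⁻¹ ^ i))
          ∂(ν.prod ν) := lintegral_mono hmain
    _ = D * (ν.prod ν) G₁ + (D * (ν.prod ν) G₂ + K' * 2⁻¹ ^ i) := by
        rw [lintegral_add_left (measurable_const.indicator hG₁m),
          lintegral_add_left (measurable_const.indicator hG₂m), lintegral_indicator_const hG₁m,
          lintegral_indicator_const hG₂m, lintegral_const, measure_univ, mul_one]
    _ ≤ D * (2 * (L * K) * (m : ℝ≥0∞)⁻¹ ^ (A + 1)) +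
        (D * (ENNReal.ofReal ((Real.pi / c) ^ (A + 1)) * (m : ℝ≥0∞)⁻¹ ^ (A + 1)) +
          K' * (m : ℝ≥0∞)⁻¹ ^ (A + 1)) := by
        gcongr
    _ = KK * (m : ℝ≥0∞)⁻¹ ^ (A + 1) := by
        rw [hKK]
        ring
    _ ≤ _ := h5

/-! ### Almost sure lower bounds for the derivatives. -/

lemma summable_sqrt_inv_pow_four : Summable fun n : ℕ => ((Nat.sqrt n : ℝ)⁻¹) ^ 4 := by
  have h : Summable fun n : ℕ => 16 * ((n : ℝ) ^ 2)⁻¹ :=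
    (Real.summable_nat_pow_inv.2 one_lt_two).mul_left 16
  refine Summable.of_nonneg_of_le (fun n => by positivity) (fun n => ?_) h
  rcases Nat.eq_zero_or_pos n with rfl | hn
  · simp
  have hm : 1 ≤ Nat.sqrt n := Nat.sqrt_pos.2 hn
  have h1 : n ≤ 4 * Nat.sqrt n ^ 2 := by
    have := Nat.lt_succ_sqrt n
    simp only [Nat.succ_eq_add_one] at this
    nlinarith
  have h2 : (n : ℝ) ≤ 4 * (Nat.sqrt n : ℝ) ^ 2 := by exact_mod_cast h1
  have hm0 : (0 : ℝ) < Nat.sqrt n := by exact_mod_cast hm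
  have hn0 : (0 : ℝ) < n := by exact_mod_cast hn
  rw [inv_pow, ← div_eq_mul_inv, le_div_iff₀ (by positivity), inv_mul_le_iff₀ (by positivity)]
  calc (n : ℝ) ^ 2 ≤ (4 * (Nat.sqrt n : ℝ) ^ 2) ^ 2 := by gcongr
    _ = _ := by ring

/-- Borel–Cantelli in mean: the expectations are summable, so almost surely the series converges and
its terms tend to zero. -/
lemma ae_tendsto_zero_of_lintegral_le {Ω : Type*} [MeasurableSpace Ω] (P : Measure Ω)
    {f : ℕ → Ω → ℝ≥0∞} (hf : ∀ n, Measurable (f n))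
    (h : ∀ᶠ n in atTop, ∫⁻ ω, f n ω ∂P ≤ (Nat.sqrt n : ℝ≥0∞)⁻¹ ^ 4) :
    ∀ᵐ ω ∂P, Tendsto (fun n => f n ω) atTop (𝓝 0) := by
  obtain ⟨N, hN⟩ := eventually_atTop.1 h
  have hfin : ∫⁻ ω, ∑' n, f (n + (N + 1)) ω ∂P ≠ ∞ := by
    rw [lintegral_tsum fun n => (hf _).aemeasurable]
    have hs := ((summable_nat_add_iff (N + 1)).2 summable_sqrt_inv_pow_four).tsum_ofReal_ne_top
    refine ne_top_of_le_ne_top hs (ENNReal.tsum_le_tsum fun n => ?_)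
    refine (hN _ (by omega)).trans_eq ?_
    have hpos : (0 : ℝ) < Nat.sqrt (n + (N + 1)) := by
      exact_mod_cast Nat.sqrt_pos.2 (by omega)
    rw [ENNReal.ofReal_pow (inv_nonneg.2 hpos.le), ENNReal.ofReal_inv_of_pos hpos,
      ENNReal.ofReal_natCast]
  filter_upwards [ae_lt_top (Measurable.tsum fun n => hf _) hfin] with ω hω
  exact (tendsto_add_atTop_iff_nat (N + 1)).1
    (ENNReal.tendsto_atTop_zero_of_tsum_ne_top hω.ne)

/-- The bound for the last `M` variables gives a bound for all of them. -/
lemma lintegral_coeff_genPoly_le (μ : Measure ℂ) [IsProbabilityMeasure μ] (lam : Measure ℂ)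
    [IsFiniteMeasure lam] {n r M k : ℕ} (hn : n = r + M) {η : ℝ} {β : ℝ≥0∞}
    (hβ : ∀ c : ℂ → ℂ[X], (∀ i, Measurable fun z => (c z).coeff i) →
      ∫⁻ z, (Measure.pi fun _ : Fin M => μ) {ζ | SmallCoeff k η (c z) z ζ} ∂lam ≤ β) :
    ∫⁻ z, (Measure.pi fun _ : Fin n => μ) {ζ | ‖(genPoly z ζ).coeff k‖ ≤ η} ∂lam ≤ β := by
  subst hn
  set νr := Measure.pi fun _ : Fin r => μ
  set νM := Measure.pi fun _ : Fin M => μ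
  have hms : MeasurableSet {q : (ℂ × (Fin r → ℂ)) × (Fin M → ℂ) |
      SmallCoeff k η (genPoly q.1.1 q.1.2) q.1.1 q.2} :=
    measurableSet_smallCoeff (by fun_prop) (by fun_prop)
      (fun i => measurable_coeff_genPoly (by fun_prop) (by fun_prop) i) _ _
  have hf : Measurable fun q : ℂ × (Fin r → ℂ) =>
      νM {b | SmallCoeff k η (genPoly q.1 q.2) q.1 b} := measurable_measure_prodMk_left hms
  have e1 : ∀ z, (Measure.pi fun _ : Fin (r + M) => μ) {ζ | ‖(genPoly z ζ).coeff k‖ ≤ η} =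
      ∫⁻ a, νM {b | SmallCoeff k η (genPoly z a) z b} ∂νr := by
    intro z
    have hmz : MeasurableSet {ζ : Fin (r + M) → ℂ | ‖(genPoly z ζ).coeff k‖ ≤ η} :=
      measurableSet_le (measurable_coeff_genPoly measurable_const measurable_id k).norm
        measurable_const
    rw [← (measurePreserving_append μ r M).measure_preimage hmz.nullMeasurableSet,
      Measure.prod_apply ((measurePreserving_append μ r M).measurable hmz)]
    refine lintegral_congr fun a => congrArg νM ?_
    ext b
    simp [SmallCoeff, genPoly_append, coeff_zero_genPoly]
  rw [lintegral_congr e1]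
  have hf' : Measurable (Function.uncurry fun (z : ℂ) (a : Fin r → ℂ) =>
      νM {b | SmallCoeff k η (genPoly z a) z b}) := hf
  rw [lintegral_lintegral_swap hf'.aemeasurable]
  calc _ ≤ ∫⁻ a, β ∂νr := by
        refine lintegral_mono fun a => ?_
        -- The first `r` variables, once frozen, only enter through the coefficient `c`; its
        -- constant term is `1`, so the relative smallness is absolute.
        exact hβ (fun z => genPoly z a)
          fun i => measurable_coeff_genPoly measurable_id measurable_const i
    _ = β := by simp

/-- Off the null set of roots one may divide by the polynomial; the factor `k! ≥ 1` is then
discarded. -/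
lemma volume_small_derivative_le {z : ℕ → ℂ} {n k : ℕ} {R η : ℝ} :
    volume {w ∈ Metric.ball (0 : ℂ) R |
      ‖(derivative^[k] (rootPoly z n)).eval w‖ ≤ η * ‖(rootPoly z n).eval w‖} ≤
      (volume.restrict (Metric.ball (0 : ℂ) R))
        {w | ‖(genPoly w fun j : Fin n => z j).coeff k‖ ≤ η} := by
  have hms : MeasurableSet {w | ‖(genPoly w fun j : Fin n => z j).coeff k‖ ≤ η} :=
    measurableSet_le (measurable_coeff_genPoly measurable_id measurable_const k).norm
      measurable_const
  rw [Measure.restrict_apply hms]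
  have hnull : volume (Set.range fun j : Fin n => z j) = 0 := (Set.finite_range _).measure_zero _
  refine (measure_mono (t := ({w | ‖(genPoly w fun j : Fin n => z j).coeff k‖ ≤ η} ∩
    Metric.ball (0 : ℂ) R) ∪ Set.range fun j : Fin n => z j) ?_).trans
      ((measure_union_le _ _).trans (by rw [hnull, add_zero]))
  rintro w ⟨hw, h⟩
  by_cases hwr : w ∈ Set.range fun j : Fin n => z j
  · exact Or.inr hwr
  refine Or.inl ⟨?_, hw⟩
  have hne : ∀ j ∈ Finset.range n, w - z j ≠ 0 := fun j hj h0 =>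
    hwr ⟨⟨j, Finset.mem_range.1 hj⟩, (sub_eq_zero.1 h0).symm⟩
  rw [rootPoly, eval_iterate_derivative_prod _ _ _ hne, eval_prod] at h
  simp only [eval_sub, eval_X, eval_C] at h
  rw [norm_mul, norm_mul, Complex.norm_natCast] at h
  have hpos : 0 < ‖∏ j ∈ Finset.range n, (w - z j)‖ :=
    norm_pos_iff.2 (Finset.prod_ne_zero_iff.2 hne)
  have h1 := le_of_mul_le_mul_right h hpos
  have hfac : (1 : ℝ) ≤ k.factorial := by exact_mod_cast Nat.factorial_pos k
  have h2 : (genPoly w fun j : Fin n => z j) = ∏ j ∈ Finset.range n, (1 + C (w - z j)⁻¹ * X) := by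
    rw [genPoly, Finset.prod_range]
  show ‖(genPoly w fun j : Fin n => z j).coeff k‖ ≤ η
  rw [h2]
  exact (le_mul_of_one_le_left (norm_nonneg _) hfac).trans h1

/-- Almost surely, the `k`-th derivative is exponentially smaller than the polynomial only on sets
of vanishing area. -/
lemma ae_tendsto_volume_small_derivative {Ω : Type*} [MeasurableSpace Ω] (P : Measure Ω)
    [IsProbabilityMeasure P] (μ : Measure ℂ) [IsProbabilityMeasure μ] (hμ : μ.support.Infinite)
    (Z : ℕ → Ω → ℂ) (hmeas : ∀ j, Measurable (Z j)) (hlaw : ∀ j, P.map (Z j) = μ)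
    (hindep : iIndepFun Z P) (k : ℕ) {R ε : ℝ} (hR : 0 ≤ R) (hε : 0 < ε) :
    ∀ᵐ ω ∂P, Tendsto (fun n : ℕ => volume {w ∈ Metric.ball (0 : ℂ) R |
      ‖(derivative^[k] (rootPoly (fun j => Z j ω) n)).eval w‖ ≤
        Real.exp (-ε * n) * ‖(rootPoly (fun j => Z j ω) n).eval w‖}) atTop (𝓝 0) := by
  set lam := volume.restrict (Metric.ball (0 : ℂ) R) with hlam
  have : IsFiniteMeasure lam := isFiniteMeasure_restrict.2 measure_ball_lt_top.ne
  let f : ℕ → Ω → ℝ≥0∞ := fun n ω =>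
    lam {w | ‖(genPoly w fun j : Fin n => Z j ω).coeff k‖ ≤ Real.exp (-ε * n)}
  have hmsF : ∀ n : ℕ, MeasurableSet {q : (Fin n → ℂ) × ℂ |
      ‖(genPoly q.2 q.1).coeff k‖ ≤ Real.exp (-ε * n)} := fun n =>
    measurableSet_le (measurable_coeff_genPoly measurable_snd measurable_fst k).norm
      measurable_const
  have hF : ∀ n : ℕ, Measurable fun ζ : Fin n → ℂ =>
      lam {w | ‖(genPoly w ζ).coeff k‖ ≤ Real.exp (-ε * n)} := fun n =>
    measurable_measure_prodMk_left (hmsF n)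
  have hZ : ∀ n : ℕ, Measurable fun ω => fun j : Fin n => Z j ω := fun n =>
    measurable_pi_lambda _ fun j => hmeas j
  have hf : ∀ n, Measurable (f n) := fun n => (hF n).comp (hZ n)
  have hlawn : ∀ n : ℕ, P.map (fun ω => fun j : Fin n => Z j ω) = Measure.pi fun _ : Fin n => μ := by
    intro n
    have h1 : iIndepFun (fun j : Fin n => Z j) P := hindep.precomp Fin.val_injective
    have h2 : ∀ j : Fin n, AEMeasurable (Z j) P := fun j => (hmeas j).aemeasurable
    rw [h1.map_fun_eq_pi_map h2]
    simp_rw [hlaw]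
  have hbound : ∀ᶠ n : ℕ in atTop, ∫⁻ ω, f n ω ∂P ≤ (Nat.sqrt n : ℝ≥0∞)⁻¹ ^ 4 := by
    -- The fourth power of `1 / √n` is comparable to `n^(-2)`, hence summable; `√n ≥ k` makes room
    -- for `k` blocks among `n` variables.
    filter_upwards [(rapidAnticoncentration μ hμ hR).smallCoeff k ε hε 4,
      tendsto_sqrt_atTop.eventually_ge_atTop k] with n h1 h2
    have hle : Nat.sqrt n * k ≤ n := (Nat.mul_le_mul_left _ h2).trans (Nat.sqrt_le n)
    have h3 := lintegral_coeff_genPoly_le μ lam (n := n) (r := n - Nat.sqrt n * k) (by omega) h1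
    refine le_trans (le_of_eq ?_) h3
    calc ∫⁻ ω, f n ω ∂P = ∫⁻ ζ, lam {w | ‖(genPoly w ζ).coeff k‖ ≤ Real.exp (-ε * n)}
          ∂(P.map (fun ω => fun j : Fin n => Z j ω)) := (lintegral_map (hF n) (hZ n)).symm
      _ = _ := by
          rw [hlawn n]
          exact (Measure.prod_apply (hmsF n)).symm.trans (Measure.prod_apply_symm (hmsF n))
  filter_upwards [ae_tendsto_zero_of_lintegral_le P hf hbound] with ω hω
  exact tendsto_of_tendsto_of_tendsto_of_le_of_le tendsto_const_nhds hω (fun _ => zero_le)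
    fun n => volume_small_derivative_le

/-! ### From convergence in measure to convergence in mean. -/

lemma one_add_le_exp_add_exp_neg_mul {a x : ℝ} (ha : 0 ≤ a) :
    1 + x ≤ Real.exp (a + Real.exp (-a) * x) := by
  have h1 : Real.exp (-a) ≤ 1 := Real.exp_le_one_iff.2 (by linarith)
  have h2 := Real.add_one_le_exp (Real.exp (-a) * (1 + x) - 1)
  calc 1 + x = Real.exp a * (Real.exp (-a) * (1 + x) - 1 + 1) := by
        rw [sub_add_cancel, ← mul_assoc, ← Real.exp_add, add_neg_cancel, Real.exp_zero, one_mul]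
    _ ≤ Real.exp a * Real.exp (Real.exp (-a) * (1 + x) - 1) := by gcongr
    _ = Real.exp (a + (Real.exp (-a) * (1 + x) - 1)) := (Real.exp_add _ _).symm
    _ ≤ _ := by
        gcongr
        linarith

/-- The sum of `2 R / ‖z - w‖` over the points `w` of a multiset. -/
def poleSum (R : ℝ) (s : Multiset ℂ) (z : ℂ) : ℝ := (s.map fun w => 2 * R * ‖z - w‖⁻¹).sum

lemma poleSum_nonneg {R : ℝ} (hR : 0 ≤ R) (s : Multiset ℂ) (z : ℂ) : 0 ≤ poleSum R s z :=
  Multiset.sum_nonneg (by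
    simp only [Multiset.mem_map, forall_exists_index, and_imp, forall_apply_eq_imp_iff₂]
    intros
    positivity)

/-- Each root contributes at most `log (1 + 2R / |z' - w|)`, and `log (1 + x) ≤ a + e^(-a) x`. A
large `a` makes the unbounded part cheap at the price of a constant per root; this is the source of
uniform integrability. -/
lemma log_norm_eval_sub_le {R : ℝ} {p : ℂ[X]} {z z' : ℂ} (hz : ‖z‖ < R) (hz' : ‖z'‖ < R)
    (hpz : p.eval z ≠ 0) (hpz' : p.eval z' ≠ 0) {a : ℝ} (ha : 0 ≤ a) :
    Real.log ‖p.eval z‖ - Real.log ‖p.eval z'‖ ≤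
      p.natDegree * a + Real.exp (-a) * poleSum R p.roots z' := by
  have hp0 : p ≠ 0 := by
    rintro rfl
    simp at hpz
  have hR : 0 ≤ R := (norm_nonneg z).trans hz.le
  have h1 : (p.roots.map fun w => ‖z - w‖).prod ≤
      (p.roots.map fun w => Real.exp (a + Real.exp (-a) * (2 * R * ‖z' - w‖⁻¹))).prod *
        (p.roots.map fun w => ‖z' - w‖).prod := by
    rw [← Multiset.prod_map_mul]
    refine Multiset.prod_map_le_prod_map₀ _ _ (fun w _ => norm_nonneg _) fun w hw => ?_
    have hzw : z' - w ≠ 0 := by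
      intro h0
      rw [sub_eq_zero] at h0
      subst h0
      exact hpz' ((mem_roots hp0).1 hw)
    have h3 : ‖z' - w‖ ≠ 0 := norm_ne_zero_iff.2 hzw
    calc ‖z - w‖ = ‖(z' - w) + (z - z')‖ := by ring_nf
      _ ≤ ‖z' - w‖ + ‖z - z'‖ := norm_add_le _ _
      _ ≤ ‖z' - w‖ + 2 * R := by
        gcongr
        refine (norm_sub_le _ _).trans ?_
        linarith
      _ = (1 + 2 * R * ‖z' - w‖⁻¹) * ‖z' - w‖ := by field_simp
      _ ≤ _ := by
        gcongr
        exact one_add_le_exp_add_exp_neg_mul ha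
  have h2 : (p.roots.map fun w => Real.exp (a + Real.exp (-a) * (2 * R * ‖z' - w‖⁻¹))).prod =
      Real.exp (p.natDegree * a + Real.exp (-a) * poleSum R p.roots z') := by
    rw [← (IsAlgClosed.card_roots_eq_natDegree : p.roots.card = p.natDegree), poleSum]
    induction p.roots using Multiset.induction_on with
    | empty => simp
    | cons w s ih =>
      simp only [Multiset.map_cons, Multiset.prod_cons, Multiset.card_cons, Multiset.sum_cons, ih]
      rw [← Real.exp_add]
      push_cast
      congr 1
      ring
  have h3 : ‖p.eval z‖ ≤ Real.exp (p.natDegree * a + Real.exp (-a) * poleSum R p.roots z') *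
      ‖p.eval z'‖ := by
    rw [norm_eval_eq_prod_roots p z, norm_eval_eq_prod_roots p z', ← h2, mul_left_comm]
    gcongr
  have h4 := Real.log_le_log (norm_pos_iff.2 hpz) h3
  rw [Real.log_mul (Real.exp_pos _).ne' (norm_ne_zero_iff.2 hpz'), Real.log_exp] at h4
  linarith

lemma measurable_log_ratio (p q : ℂ[X]) :
    Measurable fun z => |Real.log ‖q.eval z‖ - Real.log ‖p.eval z‖| := by
  have h1 := (Polynomial.continuous p).measurable
  have h2 := (Polynomial.continuous q).measurable
  fun_prop

lemma ofReal_poleSum {R : ℝ} (hR : 0 ≤ R) (s : Multiset ℂ) (z : ℂ) :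
    ENNReal.ofReal (poleSum R s z) = (s.map fun w => ENNReal.ofReal (2 * R * ‖z - w‖⁻¹)).sum := by
  induction s using Multiset.induction_on with
  | empty => simp [poleSum]
  | cons a s ih =>
    have e : poleSum R (a ::ₘ s) z = 2 * R * ‖z - a‖⁻¹ + poleSum R s z := by simp [poleSum]
    rw [e, ENNReal.ofReal_add (by positivity) (poleSum_nonneg hR s z), ih]
    simp

lemma measurable_ofReal_poleSum {R : ℝ} (hR : 0 ≤ R) (s : Multiset ℂ) :
    Measurable fun z => ENNReal.ofReal (poleSum R s z) := by
  simp_rw [ofReal_poleSum hR]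
  exact measurable_multiset_sum_map s _ fun w => by fun_prop

/-- Uniform integrability of the logarithm of a quotient of polynomials that is often close
to `1`. -/
lemma exists_lintegral_log_ratio_le {R : ℝ} (hR : 0 < R) : ∃ (K : ℝ≥0∞) (c δ : ℝ), K ≠ ∞ ∧ 0 ≤ c ∧
    0 < δ ∧ ∀ (n : ℕ) (p q : ℂ[X]), 0 < n → p ≠ 0 → q ≠ 0 → p.natDegree ≤ n → q.natDegree ≤ n →
    ∀ ε a : ℝ, 0 ≤ ε → 0 ≤ a →
    volume {z ∈ Metric.ball (0 : ℂ) R |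
      ε * n < |Real.log ‖q.eval z‖ - Real.log ‖p.eval z‖|} ≤ ENNReal.ofReal δ →
    ∫⁻ z in Metric.ball (0 : ℂ) R, ENNReal.ofReal |Real.log ‖q.eval z‖ - Real.log ‖p.eval z‖| ≤
      n * (ENNReal.ofReal ε * volume (Metric.ball (0 : ℂ) R) +
        ENNReal.ofReal (c + 2 * a) * volume {z ∈ Metric.ball (0 : ℂ) R |
          ε * n < |Real.log ‖q.eval z‖ - Real.log ‖p.eval z‖|} +
        ENNReal.ofReal (Real.exp (-a)) * K) := by
  obtain ⟨K₀, hK₀, hKw⟩ := exists_lintegral_one_add_inv_norm_le R (2 * R) (by positivity)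
  set D := volume (Metric.ball (0 : ℂ) R) with hD
  have hDtop : D ≠ ∞ := measure_ball_lt_top.ne
  have hDpos : D ≠ 0 := (Metric.measure_ball_pos volume 0 hR).ne'
  have hDr : 0 < D.toReal := ENNReal.toReal_pos hDpos hDtop
  set K : ℝ≥0∞ := 2 * K₀ with hK
  have hKtop : K ≠ ∞ := ENNReal.mul_ne_top (by simp) hK₀
  -- By Markov the pole sum exceeds `n c` on at most a quarter of the disc; `δ` allows another
  -- quarter for `B`, so a good reference point remains.
  set c : ℝ := 4 * K.toReal / D.toReal + 1 with hc
  have hc0 : 0 < c := by positivity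
  refine ⟨K, c, D.toReal / 4, hKtop, hc0.le, by positivity, ?_⟩
  intro n p q hn hp hq hpn hqn ε a hε ha hB
  have hn0 : (0 : ℝ) < n := by exact_mod_cast hn
  set U : ℂ → ℝ := fun z => |Real.log ‖q.eval z‖ - Real.log ‖p.eval z‖| with hU
  have hUm : Measurable U := measurable_log_ratio p q
  set B : Set ℂ := {z ∈ Metric.ball (0 : ℂ) R | ε * n < U z} with hBdef
  have hBm : MeasurableSet B :=
    Metric.isOpen_ball.measurableSet.inter (measurableSet_lt measurable_const hUm)
  set s := p.roots + q.roots with hs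
  have hcard : s.card ≤ 2 * n := by
    rw [hs, Multiset.card_add]
    have := card_roots' p
    have := card_roots' q
    omega
  have hSint : ∫⁻ z in Metric.ball (0 : ℂ) R, ENNReal.ofReal (poleSum R s z) ≤ n * K := by
    simp_rw [ofReal_poleSum hR.le]
    rw [lintegral_multiset_sum _ _ _ fun w => by fun_prop]
    calc _ ≤ (s.map fun _ => K₀).sum := by
          refine Multiset.sum_map_le_sum_map _ _ fun w _ => ?_
          refine le_trans (lintegral_mono fun z => ENNReal.ofReal_le_ofReal ?_) (hKw w)
          linarith
      _ = s.card * K₀ := by simp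
      _ ≤ ((2 * n : ℕ) : ℝ≥0∞) * K₀ := by gcongr
      _ = _ := by
          rw [hK]
          push_cast
          ring
  let N : Set ℂ := {z | p.eval z = 0} ∪ {z | q.eval z = 0}
  have hN : volume N = 0 := by
    have : ∀ f : ℂ[X], f ≠ 0 → {z : ℂ | f.eval z = 0}.Finite := fun f hf =>
      Set.Finite.subset (rootSet_finite f ℂ) fun z hz => by
        rw [mem_rootSet]
        exact ⟨hf, by simpa using hz⟩
    exact ((this p hp).union (this q hq)).measure_zero _
  obtain ⟨z', hz'D, hz'B, hz'N, hz'S⟩ : ∃ z' ∈ Metric.ball (0 : ℂ) R, z' ∉ B ∧ z' ∉ N ∧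
      poleSum R s z' ≤ n * c := by
    by_contra! hcon
    have hsub : Metric.ball (0 : ℂ) R ⊆ B ∪ N ∪
        {z ∈ Metric.ball (0 : ℂ) R | ENNReal.ofReal (n * c) ≤ ENNReal.ofReal (poleSum R s z)} := by
      intro z hz
      by_cases h1 : z ∈ B
      · exact Or.inl (Or.inl h1)
      by_cases h2 : z ∈ N
      · exact Or.inl (Or.inr h2)
      · exact Or.inr ⟨hz, ENNReal.ofReal_le_ofReal (hcon z hz h1 h2).le⟩
    have hmark : volume {z ∈ Metric.ball (0 : ℂ) R |
        ENNReal.ofReal (n * c) ≤ ENNReal.ofReal (poleSum R s z)} ≤ ENNReal.ofReal (D.toReal / 4) := by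
      have h1 := meas_ge_le_lintegral_div (μ := volume.restrict (Metric.ball (0 : ℂ) R))
        (measurable_ofReal_poleSum hR.le s).aemeasurable (ε := ENNReal.ofReal (n * c))
        (by simp only [ne_eq, ENNReal.ofReal_eq_zero, not_le]; positivity) ENNReal.ofReal_ne_top
      rw [Measure.restrict_apply (measurableSet_le measurable_const
        (measurable_ofReal_poleSum hR.le s)), Set.inter_comm] at h1
      refine h1.trans ((ENNReal.div_le_div_right hSint _).trans ?_)
      rw [← ENNReal.ofReal_toReal hKtop, ← ENNReal.ofReal_natCast, ← ENNReal.ofReal_mul hn0.le,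
        ← ENNReal.ofReal_div_of_pos (by positivity)]
      refine ENNReal.ofReal_le_ofReal ?_
      rw [mul_div_mul_left _ _ hn0.ne', div_le_iff₀ hc0, hc]
      have : D.toReal / 4 * (4 * K.toReal / D.toReal + 1) = K.toReal + D.toReal / 4 := by
        field_simp
      rw [this]
      linarith
    have h2 : D ≤ ENNReal.ofReal (D.toReal / 4) + 0 + ENNReal.ofReal (D.toReal / 4) :=
      (measure_mono hsub).trans ((measure_union_le _ _).trans
        (add_le_add ((measure_union_le _ _).trans (add_le_add hB hN.le)) hmark))
    rw [add_zero, ← ENNReal.ofReal_add (by positivity) (by positivity)] at h2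
    nth_rewrite 1 [← ENNReal.ofReal_toReal hDtop] at h2
    rw [ENNReal.ofReal_le_ofReal_iff (by positivity)] at h2
    linarith
  have hz'R : ‖z'‖ < R := by simpa using hz'D
  have hUz' : U z' ≤ ε * n := by
    by_contra hcon
    exact hz'B ⟨hz'D, not_le.1 hcon⟩
  simp only [N, Set.mem_union, Set.mem_ofPred_eq, not_or] at hz'N
  have hsum : ∀ z, poleSum R s z = poleSum R p.roots z + poleSum R q.roots z := fun z => by
    simp [poleSum, hs]
  have hpt : ∀ z ∈ Metric.ball (0 : ℂ) R, z ∉ N → U z ≤ ε * n +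
      B.indicator (fun _ => n * (c + 2 * a)) z + Real.exp (-a) * poleSum R s z := by
    intro z hz hzN
    have hS0 : 0 ≤ Real.exp (-a) * poleSum R s z :=
      mul_nonneg (Real.exp_pos _).le (poleSum_nonneg hR.le s z)
    by_cases hzB : z ∈ B
    swap
    · rw [Set.indicator_of_notMem hzB]
      have : U z ≤ ε * n := by
        by_contra hcon
        exact hzB ⟨hz, not_le.1 hcon⟩
      linarith
    rw [Set.indicator_of_mem hzB]
    have hzR : ‖z‖ < R := by simpa using hz
    simp only [N, Set.mem_union, Set.mem_ofPred_eq, not_or] at hzN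
    -- Where the pole sum is taken at the good point `z'`, `a = 0` suffices; where it is taken at
    -- `z`, the small factor `e^(-a)` is needed.
    have q1 := log_norm_eval_sub_le hzR hz'R hzN.2 hz'N.2 le_rfl
    have q2 := log_norm_eval_sub_le hz'R hzR hz'N.2 hzN.2 ha
    have p1 := log_norm_eval_sub_le hzR hz'R hzN.1 hz'N.1 le_rfl
    have p2 := log_norm_eval_sub_le hz'R hzR hz'N.1 hzN.1 ha
    simp only [mul_zero, neg_zero, Real.exp_zero, one_mul, zero_add] at q1 p1
    have hpa : (p.natDegree : ℝ) * a ≤ n * a := by gcongr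
    have hqa : (q.natDegree : ℝ) * a ≤ n * a := by gcongr
    have s1 := poleSum_nonneg hR.le p.roots z'
    have s2 := poleSum_nonneg hR.le q.roots z'
    have s3 := mul_nonneg (Real.exp_pos (-a)).le (poleSum_nonneg hR.le p.roots z)
    have s4 := mul_nonneg (Real.exp_pos (-a)).le (poleSum_nonneg hR.le q.roots z)
    have na : 0 ≤ (n : ℝ) * a := by positivity
    rw [hsum] at hz'S ⊢
    rw [mul_add (Real.exp (-a))]
    simp only [hU] at hUz' ⊢
    rw [abs_le] at hUz' ⊢
    constructor <;> nlinarith [hUz'.1, hUz'.2]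
  calc ∫⁻ z in Metric.ball (0 : ℂ) R, ENNReal.ofReal (U z)
      ≤ ∫⁻ z in Metric.ball (0 : ℂ) R, (ENNReal.ofReal (ε * n) +
          B.indicator (fun _ => ENNReal.ofReal (n * (c + 2 * a))) z +
          ENNReal.ofReal (Real.exp (-a)) * ENNReal.ofReal (poleSum R s z)) := by
        refine lintegral_mono_ae ?_
        have hNae : ∀ᵐ z ∂(volume.restrict (Metric.ball (0 : ℂ) R)), z ∉ N :=
          ae_restrict_of_ae (measure_eq_zero_iff_ae_notMem.1 hN)
        filter_upwards [ae_restrict_mem Metric.isOpen_ball.measurableSet, hNae] with z hz hzN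
        refine (ENNReal.ofReal_le_ofReal (hpt z hz hzN)).trans ?_
        refine ENNReal.ofReal_add_le.trans ?_
        rw [ENNReal.ofReal_mul (Real.exp_pos _).le]
        gcongr
        refine ENNReal.ofReal_add_le.trans ?_
        gcongr
        by_cases hzB : z ∈ B
        · simp [Set.indicator_of_mem hzB]
        · simp [Set.indicator_of_notMem hzB]
    _ = ENNReal.ofReal (ε * n) * D + ENNReal.ofReal (n * (c + 2 * a)) * volume B +
        ENNReal.ofReal (Real.exp (-a)) *
          ∫⁻ z in Metric.ball (0 : ℂ) R, ENNReal.ofReal (poleSum R s z) := by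
        have hBD : (volume.restrict (Metric.ball (0 : ℂ) R)) B = volume B := by
          rw [Measure.restrict_apply hBm, Set.inter_eq_left.2 fun z hz => hz.1]
        have hm1 : Measurable fun z : ℂ => ENNReal.ofReal (ε * n) +
            B.indicator (fun _ => ENNReal.ofReal (n * (c + 2 * a))) z :=
          Measurable.const_add (measurable_const.indicator hBm) _
        rw [lintegral_add_left hm1,
          lintegral_add_left measurable_const, lintegral_const, Measure.restrict_apply_univ,
          lintegral_indicator_const hBm, hBD, lintegral_const_mul _ (measurable_ofReal_poleSum hR.le s)]
    _ ≤ ENNReal.ofReal (ε * n) * D + ENNReal.ofReal (n * (c + 2 * a)) * volume B +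
        ENNReal.ofReal (Real.exp (-a)) * (n * K) := by gcongr
    _ = _ := by
        rw [ENNReal.ofReal_mul hε, ENNReal.ofReal_mul hn0.le, ENNReal.ofReal_natCast]
        ring

/-- If `log (|qₙ| / |pₙ|) = o(n)` in measure on discs, then also in mean. -/
lemma tendsto_lintegral_log_ratio {p q : ℕ → ℂ[X]} (hp : ∀ n, p n ≠ 0) (hq : ∀ᶠ n in atTop, q n ≠ 0)
    (hpn : ∀ n, (p n).natDegree ≤ n) (hqn : ∀ n, (q n).natDegree ≤ n) {R : ℝ} (hR : 0 < R)
    (h1 : ∀ ε > 0, Tendsto (fun n : ℕ => volume {z ∈ Metric.ball (0 : ℂ) R |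
      ‖(q n).eval z‖ ≤ Real.exp (-ε * n) * ‖(p n).eval z‖}) atTop (𝓝 0))
    (h2 : ∀ ε > 0, Tendsto (fun n : ℕ => volume {z ∈ Metric.ball (0 : ℂ) R |
      ‖(p n).eval z‖ ≤ Real.exp (-ε * n) * ‖(q n).eval z‖}) atTop (𝓝 0)) :
    Tendsto (fun n : ℕ => (n : ℝ≥0∞)⁻¹ * ∫⁻ z in Metric.ball (0 : ℂ) R,
      ENNReal.ofReal |Real.log ‖(q n).eval z‖ - Real.log ‖(p n).eval z‖|) atTop (𝓝 0) := by
  obtain ⟨K, c, δ, hK, hc, hδ, hmain⟩ := exists_lintegral_log_ratio_le hR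
  set D := volume (Metric.ball (0 : ℂ) R) with hD
  have hDtop : D ≠ ∞ := measure_ball_lt_top.ne
  have hB : ∀ ε > 0, Tendsto (fun n : ℕ => volume {z ∈ Metric.ball (0 : ℂ) R |
      ε * n < |Real.log ‖(q n).eval z‖ - Real.log ‖(p n).eval z‖|}) atTop (𝓝 0) := by
    intro ε hε
    have h3 := (h1 ε hε).add (h2 ε hε)
    rw [add_zero] at h3
    refine tendsto_of_tendsto_of_tendsto_of_le_of_le' tendsto_const_nhds h3
      (Eventually.of_forall fun _ => zero_le) ?_
    filter_upwards [eventually_gt_atTop 0] with n hn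
    refine (measure_mono ?_).trans (measure_union_le _ _)
    rintro z ⟨hz, h⟩
    by_cases hqz : (q n).eval z = 0
    · refine Or.inl ⟨hz, ?_⟩
      rw [hqz, norm_zero]
      positivity
    by_cases hpz : (p n).eval z = 0
    · refine Or.inr ⟨hz, ?_⟩
      rw [hpz, norm_zero]
      positivity
    have hq0 := norm_pos_iff.2 hqz
    have hp0 := norm_pos_iff.2 hpz
    rcases lt_abs.1 h with h | h
    · refine Or.inr ⟨hz, ?_⟩
      rw [← Real.exp_log hq0, ← Real.exp_log hp0, ← Real.exp_add]
      refine Real.exp_le_exp.2 ?_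
      linarith
    · refine Or.inl ⟨hz, ?_⟩
      rw [← Real.exp_log hq0, ← Real.exp_log hp0, ← Real.exp_add]
      refine Real.exp_le_exp.2 ?_
      linarith
  rw [ENNReal.tendsto_nhds_zero]
  intro τ hτ
  have hlim1 : Tendsto (fun ε : ℝ => ENNReal.ofReal ε * D) (𝓝[>] 0) (𝓝 0) := by
    have : Tendsto (fun ε : ℝ => ENNReal.ofReal ε * D) (𝓝 0) (𝓝 (ENNReal.ofReal 0 * D)) :=
      ENNReal.Tendsto.mul_const (ENNReal.tendsto_ofReal tendsto_id) (Or.inr hDtop)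
    rw [ENNReal.ofReal_zero, zero_mul] at this
    exact this.mono_left nhdsWithin_le_nhds
  have hlim2 : Tendsto (fun a : ℝ => ENNReal.ofReal (Real.exp (-a)) * K) atTop (𝓝 0) := by
    have : Tendsto (fun a : ℝ => ENNReal.ofReal (Real.exp (-a)) * K) atTop
        (𝓝 (ENNReal.ofReal 0 * K)) :=
      ENNReal.Tendsto.mul_const (ENNReal.tendsto_ofReal Real.tendsto_exp_neg_atTop_nhds_zero)
        (Or.inr hK)
    rwa [ENNReal.ofReal_zero, zero_mul] at this
  have hτ3 : 0 < τ / 3 := ENNReal.div_pos hτ.ne' (by simp)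
  obtain ⟨ε, hε1, hε0⟩ :=
    (((ENNReal.tendsto_nhds_zero.1 hlim1) _ hτ3).and self_mem_nhdsWithin).exists
  obtain ⟨a, ha1, ha0⟩ :=
    (((ENNReal.tendsto_nhds_zero.1 hlim2) _ hτ3).and (eventually_ge_atTop 0)).exists
  have hlim3 : Tendsto (fun n : ℕ => ENNReal.ofReal (c + 2 * a) *
      volume {z ∈ Metric.ball (0 : ℂ) R |
        ε * n < |Real.log ‖(q n).eval z‖ - Real.log ‖(p n).eval z‖|}) atTop (𝓝 0) := by
    have := ENNReal.Tendsto.const_mul (a := ENNReal.ofReal (c + 2 * a)) (hB ε hε0)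
      (Or.inr ENNReal.ofReal_ne_top)
    rwa [mul_zero] at this
  filter_upwards [hq, eventually_gt_atTop 0, (ENNReal.tendsto_nhds_zero.1 hlim3) _ hτ3,
    (ENNReal.tendsto_nhds_zero.1 (hB ε hε0)) _ (ENNReal.ofReal_pos.2 hδ)] with n hqn0 hn h3 h4
  have h5 := hmain n (p n) (q n) hn (hp n) hqn0 (hpn n) (hqn n) ε a (le_of_lt hε0) ha0 h4
  have hn0 : (n : ℝ≥0∞) ≠ 0 := by
    simp only [ne_eq, Nat.cast_eq_zero]
    omega
  calc _ ≤ (n : ℝ≥0∞)⁻¹ * _ := mul_le_mul_right h5 _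
    _ = _ := by rw [← mul_assoc, ENNReal.inv_mul_cancel hn0 (ENNReal.natCast_ne_top _), one_mul]
    _ ≤ τ / 3 + τ / 3 + τ / 3 := add_le_add (add_le_add hε1 h3) ha1
    _ = τ := ENNReal.add_thirds τ

/-! ### Jensen's formula and a compactly supported bump. -/

/-- The average over the circle of radius `r` around a point at distance `x` from `0` of
`log ‖·‖`, for `r ≥ ρ`. -/
def logMax (ρ r x : ℝ) : ℝ := Real.log (max ρ (max r x))

/-- The floor `ρ` keeps the argument of the logarithm away from zero, which makes continuity global.
-/
lemma continuous_logMax {ρ : ℝ} (hρ : 0 < ρ) : Continuous fun y : ℝ × ℝ => logMax ρ y.1 y.2 := by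
  unfold logMax
  refine Continuous.log (by fun_prop) fun y => ?_
  exact (hρ.trans_le (le_max_left _ _)).ne'

lemma continuous_logMax_left {ρ : ℝ} (hρ : 0 < ρ) (x : ℝ) : Continuous fun r => logMax ρ r x :=
  (continuous_logMax hρ).comp (by fun_prop : Continuous fun r : ℝ => (r, x))

lemma circleAverage_log_norm_sub_eq_logMax {ρ r : ℝ} (hρ : 0 < ρ) (hr : ρ ≤ r) (c w : ℂ) :
    Real.circleAverage (fun z => Real.log ‖z - w‖) c r = logMax ρ r ‖w - c‖ := by
  have hr0 : 0 < r := hρ.trans_le hr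
  rw [circleAverage_log_norm_sub_const_eq_log_radius_add_posLog hr0.ne', logMax,
    max_eq_right (hr.trans (le_max_left _ _)), norm_sub_rev w c]
  rcases le_total ‖c - w‖ r with h | h
  · rw [max_eq_left h, add_eq_left, Real.posLog_eq_zero_iff, abs_of_nonneg (by positivity)]
    exact inv_mul_le_one_of_le₀ h hr0.le
  · have h0 : 0 < ‖c - w‖ := hr0.trans_le h
    rw [max_eq_right h, Real.posLog_eq_log, Real.log_mul (by positivity) h0.ne', Real.log_inv]
    · ring
    · rw [abs_of_nonneg (by positivity), ← div_eq_inv_mul]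
      exact (one_le_div hr0).2 h

/-- The radial profile of a compactly supported bump: the difference of the averages of the
logarithmic potential over two annuli. -/
def annulusProfile (ρ x : ℝ) : ℝ := ∫ r in ρ..2 * ρ, (logMax ρ (r + ρ) x - logMax ρ r x)

lemma annulusProfile_integrand_nonneg {ρ : ℝ} (hρ : 0 < ρ) (r x : ℝ) :
    0 ≤ logMax ρ (r + ρ) x - logMax ρ r x := by
  rw [sub_nonneg]
  refine Real.log_le_log (hρ.trans_le (le_max_left _ _)) ?_
  gcongr
  linarith

lemma continuous_annulusProfile {ρ : ℝ} (hρ : 0 < ρ) : Continuous (annulusProfile ρ) := by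
  refine intervalIntegral.continuous_parametric_intervalIntegral_of_continuous' ?_ _ _
  have h1 : Continuous fun y : ℝ × ℝ => logMax ρ (y.2 + ρ) y.1 :=
    (continuous_logMax hρ).comp (by fun_prop : Continuous fun y : ℝ × ℝ => (y.2 + ρ, y.1))
  have h2 : Continuous fun y : ℝ × ℝ => logMax ρ y.2 y.1 :=
    (continuous_logMax hρ).comp (by fun_prop : Continuous fun y : ℝ × ℝ => (y.2, y.1))
  exact h1.sub h2

lemma annulusProfile_nonneg {ρ : ℝ} (hρ : 0 < ρ) (x : ℝ) : 0 ≤ annulusProfile ρ x :=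
  intervalIntegral.integral_nonneg (by linarith) fun r _ => annulusProfile_integrand_nonneg hρ r x

/-- Both radii are at most `3 * ρ`, and beyond them both circle averages equal `log x`. -/
lemma annulusProfile_eq_zero {ρ x : ℝ} (hρ : 0 < ρ) (hx : 4 * ρ ≤ x) : annulusProfile ρ x = 0 := by
  rw [annulusProfile, ← intervalIntegral.integral_zero (a := ρ) (b := 2 * ρ)]
  refine intervalIntegral.integral_congr fun r hr => ?_
  rw [Set.uIcc_of_le (by linarith)] at hr
  simp only [logMax]
  rw [max_eq_right (a := r + ρ) (by linarith [hr.2]), max_eq_right (a := r) (by linarith [hr.2]),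
    sub_self]

lemma annulusProfile_zero_pos {ρ : ℝ} (hρ : 0 < ρ) : 0 < annulusProfile ρ 0 := by
  refine intervalIntegral.intervalIntegral_pos_of_pos_on ?_ ?_ (by linarith)
  · refine Continuous.intervalIntegrable ?_ _ _
    exact ((continuous_logMax_left hρ 0).comp (continuous_add_const ρ)).sub
      (continuous_logMax_left hρ 0)
  · intro r hr
    simp only [logMax]
    rw [sub_pos]
    refine Real.log_lt_log (hρ.trans_le (le_max_left _ _)) ?_
    have hr1 := hr.1
    rw [max_eq_left (a := r) (by linarith), max_eq_left (a := r + ρ) (by linarith),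
      max_eq_right hr1.le, max_eq_right (by linarith)]
    linarith

/-- The bump `annulusProfile ρ ‖·‖`, with values in `ℝ≥0∞`. -/
def annulusKernel (ρ : ℝ) (z : ℂ) : ℝ≥0∞ := ENNReal.ofReal (annulusProfile ρ ‖z‖)

lemma continuous_annulusProfile_norm {ρ : ℝ} (hρ : 0 < ρ) :
    Continuous fun z : ℂ => annulusProfile ρ ‖z‖ :=
  (continuous_annulusProfile hρ).comp continuous_norm

lemma measurable_annulusKernel {ρ : ℝ} (hρ : 0 < ρ) : Measurable (annulusKernel ρ) :=
  (continuous_annulusProfile_norm hρ).measurable.ennreal_ofReal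

lemma annulusKernel_eq_zero {ρ : ℝ} (hρ : 0 < ρ) {z : ℂ} (hz : 4 * ρ ≤ ‖z‖) :
    annulusKernel ρ z = 0 := by
  rw [annulusKernel, annulusProfile_eq_zero hρ hz, ENNReal.ofReal_zero]

lemma lintegral_annulusKernel_ne_top {ρ : ℝ} (hρ : 0 < ρ) :
    ∫⁻ z, annulusKernel ρ z ≠ ∞ := by
  have hi : Integrable (fun z : ℂ => annulusProfile ρ ‖z‖) := by
    refine (continuous_annulusProfile_norm hρ).integrable_of_hasCompactSupport ?_
    refine HasCompactSupport.intro (isCompact_closedBall (0 : ℂ) (4 * ρ)) fun z hz => ?_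
    rw [mem_closedBall_zero_iff, not_le] at hz
    exact annulusProfile_eq_zero hρ hz.le
  exact (hi.lintegral_lt_top).ne

lemma lintegral_annulusKernel_ne_zero {ρ : ℝ} (hρ : 0 < ρ) :
    ∫⁻ z, annulusKernel ρ z ≠ 0 := by
  refine ((lintegral_pos_iff_support (measurable_annulusKernel hρ)).2 ?_).ne'
  have hopen : IsOpen {z : ℂ | 0 < annulusProfile ρ ‖z‖} :=
    isOpen_lt continuous_const (continuous_annulusProfile_norm hρ)
  refine (hopen.measure_pos volume ⟨0, by simpa using annulusProfile_zero_pos hρ⟩).trans_le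
    (measure_mono fun z hz => ?_)
  exact (ENNReal.ofReal_pos.2 hz).ne'

/-- Integrating absolute values of circle averages over the radius is controlled by an area
integral. -/
lemma lintegral_abs_circleAverage_le {V : ℂ → ℝ} (hV : Measurable V) {ρ R : ℝ} (hρ : 0 < ρ) (c : ℂ) :
    ∫⁻ r in Set.Ioo ρ R, ENNReal.ofReal |Real.circleAverage V c r| ≤
      ENNReal.ofReal ρ⁻¹ * ∫⁻ z in Metric.ball c R, ENNReal.ofReal |V z| := by
  set F : ℂ → ℝ≥0∞ := (Metric.ball (0 : ℂ) R).indicator fun z => ENNReal.ofReal |V (z + c)| with hF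
  have hFm : Measurable F :=
    (Measurable.ennreal_ofReal (by fun_prop)).indicator Metric.isOpen_ball.measurableSet
  have hFint : ∫⁻ z, F z = ∫⁻ z in Metric.ball c R, ENNReal.ofReal |V z| := by
    rw [← lintegral_indicator Metric.isOpen_ball.measurableSet,
      ← lintegral_add_right_eq_self ((Metric.ball c R).indicator _) c]
    refine lintegral_congr fun z => ?_
    simp only [hF, Set.indicator, Metric.mem_ball, dist_eq_norm, add_sub_cancel_right, sub_zero]
  have hcirc : ∀ r ∈ Set.Ioo ρ R, ENNReal.ofReal |Real.circleAverage V c r| ≤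
      ENNReal.ofReal ρ⁻¹ * ∫⁻ θ in Set.Ioo (-Real.pi) Real.pi,
        ENNReal.ofReal r * F (Complex.polarCoord.symm (r, θ)) := by
    intro r hr
    have hr0 : 0 < r := hρ.trans hr.1
    have h1 : Real.circleAverage V c r =
        (2 * Real.pi)⁻¹ * ∫ θ in Set.Ioc (-Real.pi) Real.pi, V (circleMap c r θ) := by
      rw [Real.circleAverage_eq_integral_add (-Real.pi),
        intervalIntegral.integral_comp_add_right (fun θ => V (circleMap c r θ)),
        intervalIntegral.integral_of_le (by linarith [Real.pi_pos]), smul_eq_mul]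
      ring_nf
    have h2 : ENNReal.ofReal |Real.circleAverage V c r| ≤
        ∫⁻ θ in Set.Ioo (-Real.pi) Real.pi, ENNReal.ofReal |V (circleMap c r θ)| := by
      rw [h1, abs_mul, abs_of_pos (by positivity), ENNReal.ofReal_mul (by positivity),
        restrict_Ioo_eq_restrict_Ioc]
      refine (mul_le_of_le_one_left zero_le ?_).trans ?_
      · rw [ENNReal.ofReal_le_one]
        exact inv_le_one_of_one_le₀ (by linarith [Real.pi_gt_three])
      · have := enorm_integral_le_lintegral_enorm (μ := volume.restrict (Set.Ioc (-Real.pi) Real.pi))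
          (fun θ => V (circleMap c r θ))
        simpa only [Real.enorm_eq_ofReal_abs] using this
    refine h2.trans ?_
    rw [← lintegral_const_mul]
    · refine lintegral_mono fun θ => ?_
      rw [← mul_assoc, ← ENNReal.ofReal_mul (by positivity)]
      have h3 : Complex.polarCoord.symm (r, θ) + c = circleMap c r θ := by
        rw [Complex.polarCoord_symm_apply, circleMap, Complex.exp_mul_I]
        push_cast
        ring
      have h4 : Complex.polarCoord.symm (r, θ) ∈ Metric.ball (0 : ℂ) R := by
        rw [mem_ball_zero_iff, Complex.norm_polarCoord_symm, abs_of_pos hr0]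
        exact hr.2
      simp only [hF]
      rw [Set.indicator_of_mem h4, h3]
      -- The polar Jacobian `r` exceeds `ρ`, so it can be inserted at the cost of `ρ⁻¹`.
      refine le_mul_of_one_le_left zero_le ?_
      rw [ENNReal.one_le_ofReal, ← div_eq_inv_mul]
      exact (one_le_div hρ).2 hr.1.le
    · have h5 : Measurable fun θ : ℝ => Complex.polarCoord.symm (r, θ) := by
        simp only [Complex.polarCoord_symm_apply]
        fun_prop
      exact (hFm.comp h5).const_mul _
  have hm : Measurable fun y : ℝ × ℝ => ENNReal.ofReal y.1 * F (Complex.polarCoord.symm y) := by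
    have h5 : Measurable fun y : ℝ × ℝ => Complex.polarCoord.symm y := by
      simp only [Complex.polarCoord_symm_apply]
      fun_prop
    exact (measurable_fst.ennreal_ofReal).mul (hFm.comp h5)
  calc ∫⁻ r in Set.Ioo ρ R, ENNReal.ofReal |Real.circleAverage V c r|
      ≤ ∫⁻ r in Set.Ioo ρ R, ENNReal.ofReal ρ⁻¹ * ∫⁻ θ in Set.Ioo (-Real.pi) Real.pi,
        ENNReal.ofReal r * F (Complex.polarCoord.symm (r, θ)) :=
        setLIntegral_mono' measurableSet_Ioo hcirc
    _ = ENNReal.ofReal ρ⁻¹ * ∫⁻ r in Set.Ioo ρ R, ∫⁻ θ in Set.Ioo (-Real.pi) Real.pi,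
        ENNReal.ofReal r * F (Complex.polarCoord.symm (r, θ)) :=
        lintegral_const_mul _ hm.lintegral_prod_right'
    _ ≤ ENNReal.ofReal ρ⁻¹ * ∫⁻ r in Set.Ioi 0, ∫⁻ θ in Set.Ioo (-Real.pi) Real.pi,
        ENNReal.ofReal r * F (Complex.polarCoord.symm (r, θ)) := by
        gcongr
        exact fun r hr => hρ.trans hr.1
    _ = ENNReal.ofReal ρ⁻¹ * ∫⁻ z, F z := by
        rw [← Complex.lintegral_comp_polarCoord_symm, polarCoord_target, Measure.volume_eq_prod,
          ← Measure.prod_restrict, lintegral_prod _ (by simpa using hm.aemeasurable)]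
        simp only [smul_eq_mul]
    _ = _ := by rw [hFint]

/-- The sum of `log ‖z - w‖` over a multiset. -/
def logPotential (s : Multiset ℂ) (z : ℂ) : ℝ := (s.map fun w => Real.log ‖z - w‖).sum

lemma measurable_logPotential (s : Multiset ℂ) : Measurable (logPotential s) := by
  induction s using Multiset.induction_on with
  | empty =>
    have : logPotential 0 = fun _ => 0 := by ext; simp [logPotential]
    rw [this]
    exact measurable_const
  | cons a s ih =>
    have : logPotential (a ::ₘ s) = fun z => Real.log ‖z - a‖ + logPotential s z := by
      ext
      simp [logPotential]
    rw [this]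
    fun_prop

lemma circleIntegrable_logPotential (s : Multiset ℂ) (c : ℂ) (r : ℝ) :
    CircleIntegrable (logPotential s) c r := by
  induction s using Multiset.induction_on with
  | empty =>
    have : logPotential 0 = fun _ => 0 := by ext; simp [logPotential]
    rw [this]
    exact circleIntegrable_const _ _ _
  | cons a s ih =>
    have : logPotential (a ::ₘ s) = (fun z => Real.log ‖z - a‖) + logPotential s := by
      ext
      simp [logPotential]
    rw [this]
    exact (circleIntegrable_log_norm_sub_const r).add ih

lemma circleAverage_logPotential {ρ r : ℝ} (hρ : 0 < ρ) (hr : ρ ≤ r) (s : Multiset ℂ) (c : ℂ) :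
    Real.circleAverage (logPotential s) c r = (s.map fun w => logMax ρ r ‖w - c‖).sum := by
  induction s using Multiset.induction_on with
  | empty =>
    have : logPotential 0 = fun _ => 0 := by ext; simp [logPotential]
    rw [this, Real.circleAverage_const]
    simp
  | cons a s ih =>
    have : logPotential (a ::ₘ s) = (fun z => Real.log ‖z - a‖) + logPotential s := by
      ext
      simp [logPotential]
    rw [this, Real.circleAverage_add (circleIntegrable_log_norm_sub_const r)
      (circleIntegrable_logPotential s c r), ih, circleAverage_log_norm_sub_eq_logMax hρ hr]
    simp

lemma log_norm_eval_eq_logPotential {p : ℂ[X]} {z : ℂ} (hz : p.eval z ≠ 0) :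
    Real.log ‖p.eval z‖ = Real.log ‖p.leadingCoeff‖ + logPotential p.roots z := by
  have hp0 : p ≠ 0 := by
    rintro rfl
    simp at hz
  rw [norm_eval_eq_prod_roots, Real.log_mul (by simpa using hp0)]
  · rw [logPotential, Real.log_multiset_prod, Multiset.map_map]
    · rfl
    · simp only [Multiset.mem_map, forall_exists_index, and_imp, forall_apply_eq_imp_iff₂]
      intro w hw
      rw [norm_ne_zero_iff, sub_ne_zero]
      rintro rfl
      exact hz ((mem_roots hp0).1 hw)
  · refine Multiset.prod_ne_zero ?_
    simp only [Multiset.mem_map, not_exists, not_and]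
    intro w hw
    rw [norm_eq_zero, sub_eq_zero]
    rintro rfl
    exact hz ((mem_roots hp0).1 hw)

lemma ae_eval_ne_zero {p : ℂ[X]} (hp : p ≠ 0) : ∀ᵐ z : ℂ, p.eval z ≠ 0 := by
  have : (p.rootSet ℂ).Finite := p.rootSet_finite ℂ
  have h0 := measure_eq_zero_iff_ae_notMem.1 (this.measure_zero (volume : Measure ℂ))
  filter_upwards [h0] with z hz h
  exact hz ((mem_rootSet_of_ne hp).2 (by simpa [aeval_def] using h))

/-- Two polynomials that are close in the mean of the logarithm have close root counts, when the
roots are counted with the bump `annulusProfile`. -/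
lemma abs_sum_annulusProfile_sub_le {p q : ℂ[X]} (hp : p ≠ 0) (hq : q ≠ 0) {ρ : ℝ} (hρ : 0 < ρ)
    (c : ℂ) :
    ENNReal.ofReal |(q.roots.map fun w => annulusProfile ρ ‖w - c‖).sum -
        (p.roots.map fun w => annulusProfile ρ ‖w - c‖).sum| ≤
      ENNReal.ofReal ρ⁻¹ * ∫⁻ z in Metric.ball c (3 * ρ),
        ENNReal.ofReal |Real.log ‖q.eval z‖ - Real.log ‖p.eval z‖| := by
  set κ := Real.log ‖q.leadingCoeff‖ - Real.log ‖p.leadingCoeff‖ with hκ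
  set V : ℂ → ℝ := fun z => κ + (logPotential q.roots z - logPotential p.roots z) with hV
  have hVm : Measurable V :=
    ((measurable_logPotential _).sub (measurable_logPotential _)).const_add κ
  set L : Multiset ℂ → ℝ → ℝ := fun s r => (s.map fun w => logMax ρ r ‖w - c‖).sum with hL
  have hLc : ∀ s, Continuous (L s) := fun s =>
    continuous_multiset_sum _ fun w _ => continuous_logMax_left hρ _
  have hA : ∀ r, ρ ≤ r → Real.circleAverage V c r = κ + (L q.roots r - L p.roots r) := by
    intro r hr
    have : V = (fun _ => κ) + (logPotential q.roots - logPotential p.roots) := rfl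
    rw [this, Real.circleAverage_add (circleIntegrable_const _ _ _)
      ((circleIntegrable_logPotential _ c r).sub (circleIntegrable_logPotential _ c r)),
      Real.circleAverage_const, Real.circleAverage_sub (circleIntegrable_logPotential _ c r)
      (circleIntegrable_logPotential _ c r), circleAverage_logPotential hρ hr,
      circleAverage_logPotential hρ hr]
  set A : ℝ → ℝ := fun r => κ + (L q.roots r - L p.roots r) with hAdef
  have hAc : Continuous A := by
    have := hLc q.roots
    have := hLc p.roots
    fun_prop
  have hsum : ∀ s : Multiset ℂ, (s.map fun w => annulusProfile ρ ‖w - c‖).sum =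
      ∫ r in ρ..2 * ρ, (L s (r + ρ) - L s r) := by
    intro s
    induction s using Multiset.induction_on with
    | empty => simp [hL]
    | cons a s ih =>
      have h1 : ∀ r, L (a ::ₘ s) r = logMax ρ r ‖a - c‖ + L s r := fun r => by simp [hL]
      have h2 := continuous_logMax_left hρ ‖a - c‖
      have h3 := hLc s
      rw [Multiset.map_cons, Multiset.sum_cons, ih, annulusProfile,
        ← intervalIntegral.integral_add]
      · refine intervalIntegral.integral_congr fun r _ => ?_
        simp only [h1]
        ring
      · exact Continuous.intervalIntegrable (by fun_prop) _ _
      · exact Continuous.intervalIntegrable (by fun_prop) _ _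
  -- The two intervals of radii have equal length, so the constant `κ` from the leading coefficients
  -- cancels.
  have hdiff : (q.roots.map fun w => annulusProfile ρ ‖w - c‖).sum -
      (p.roots.map fun w => annulusProfile ρ ‖w - c‖).sum =
      (∫ r in 2 * ρ..3 * ρ, A r) - ∫ r in ρ..2 * ρ, A r := by
    have h3 := hLc q.roots
    have h4 := hLc p.roots
    have h5 : (∫ r in 2 * ρ..3 * ρ, A r) = ∫ r in ρ..2 * ρ, A (r + ρ) := by
      rw [intervalIntegral.integral_comp_add_right]
      ring_nf
    rw [hsum, hsum, h5, ← intervalIntegral.integral_sub, ← intervalIntegral.integral_sub]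
    · refine intervalIntegral.integral_congr fun r _ => ?_
      simp only [hAdef]
      ring
    all_goals exact Continuous.intervalIntegrable (by fun_prop) _ _
  have habs : |(q.roots.map fun w => annulusProfile ρ ‖w - c‖).sum -
      (p.roots.map fun w => annulusProfile ρ ‖w - c‖).sum| ≤ ∫ r in ρ..3 * ρ, |A r| := by
    rw [hdiff]
    refine (abs_sub _ _).trans ?_
    rw [← intervalIntegral.integral_add_adjacent_intervals (a := ρ) (b := 2 * ρ) (c := 3 * ρ)
      (hAc.abs.intervalIntegrable _ _) (hAc.abs.intervalIntegrable _ _), add_comm]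
    gcongr
    · exact intervalIntegral.abs_integral_le_integral_abs (by linarith)
    · exact intervalIntegral.abs_integral_le_integral_abs (by linarith)
  calc _ ≤ ENNReal.ofReal (∫ r in ρ..3 * ρ, |A r|) := ENNReal.ofReal_le_ofReal habs
    _ = ∫⁻ r in Set.Ioo ρ (3 * ρ), ENNReal.ofReal |A r| := by
        rw [intervalIntegral.integral_of_le (by linarith), restrict_Ioo_eq_restrict_Ioc,
          ofReal_integral_eq_lintegral_ofReal]
        · exact (hAc.abs.intervalIntegrable ρ (3 * ρ)).1
        · exact Eventually.of_forall fun _ => abs_nonneg _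
    _ = ∫⁻ r in Set.Ioo ρ (3 * ρ), ENNReal.ofReal |Real.circleAverage V c r| :=
        setLIntegral_congr_fun measurableSet_Ioo fun r hr => by
          simp only [hA r hr.1.le, hAdef]
    _ ≤ ENNReal.ofReal ρ⁻¹ * ∫⁻ z in Metric.ball c (3 * ρ), ENNReal.ofReal |V z| :=
        lintegral_abs_circleAverage_le hVm hρ c
    _ = _ := by
        congr 1
        refine lintegral_congr_ae (ae_restrict_of_ae ?_)
        filter_upwards [ae_eval_ne_zero hp, ae_eval_ne_zero hq] with z hpz hqz
        rw [log_norm_eval_eq_logPotential hpz, log_norm_eval_eq_logPotential hqz]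
        congr 2
        simp only [hV, hκ]
        ring

/-! ### From kernels to the portmanteau lower bound. -/

/-- A lower bound for all translates of arbitrarily concentrated kernels implies the portmanteau
lower bound on open sets. -/
lemma measure_le_liminf_of_kernel {μ : Measure ℂ} [IsProbabilityMeasure μ] {ν : ℕ → Measure ℂ}
    [∀ n, IsFiniteMeasure (ν n)]
    (h : ∀ ρ : ℝ, 0 < ρ → ∃ K : ℂ → ℝ≥0∞, Measurable K ∧ (∀ z, ρ ≤ ‖z‖ → K z = 0) ∧
      ∫⁻ z, K z ≠ 0 ∧ ∫⁻ z, K z ≠ ∞ ∧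
      ∀ c, ∫⁻ w, K (w - c) ∂μ ≤ liminf (fun n => ∫⁻ w, K (w - c) ∂ν n) atTop)
    {U : Set ℂ} (hU : IsOpen U) : μ U ≤ liminf (fun n => ν n U) atTop := by
  set F := Uᶜ with hF
  have hFc : IsClosed F := hU.isClosed_compl
  have hstep : ∀ ρ : ℝ, 0 < ρ →
      μ (Metric.thickening (ρ + ρ) F)ᶜ ≤ liminf (fun n => ν n U) atTop := by
    intro ρ hρ
    obtain ⟨K, hKm, hK0, hI0, hItop, hlim⟩ := h ρ hρ
    -- Kernels of radius `ρ` centred in `V` ignore everything outside `U`, while a point of `W` only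
    -- sees centres in `V`. Integrating over centres in `V` thus bounds `μ W` from above and `ν n U`
    -- from below.
    set V := (Metric.thickening ρ F)ᶜ with hV
    set W := (Metric.thickening (ρ + ρ) F)ᶜ with hW
    have hVm : MeasurableSet V := Metric.isOpen_thickening.measurableSet.compl
    have hWm : MeasurableSet W := Metric.isOpen_thickening.measurableSet.compl
    have hKm2 : Measurable (Function.uncurry fun c w : ℂ => K (w - c)) :=
      hKm.comp (measurable_snd.sub measurable_fst)
    have htrans : ∀ w : ℂ, ∫⁻ c, K (w - c) = ∫⁻ z, K z := fun w => lintegral_sub_left_eq_self _ w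
    have hlow : (∫⁻ z, K z) * μ W ≤ ∫⁻ c in V, ∫⁻ w, K (w - c) ∂μ := by
      rw [lintegral_lintegral_swap hKm2.aemeasurable]
      calc (∫⁻ z, K z) * μ W = ∫⁻ _ in W, (∫⁻ z, K z) ∂μ := by
            rw [lintegral_const, Measure.restrict_apply_univ]
        _ ≤ ∫⁻ w in W, (∫⁻ c in V, K (w - c)) ∂μ := by
            refine setLIntegral_mono' hWm fun w hw => ?_
            rw [← htrans w, ← lintegral_indicator hVm]
            refine lintegral_mono fun c => ?_
            by_cases hc : c ∈ V
            · rw [Set.indicator_of_mem hc]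
            · rw [Set.indicator_of_notMem hc, nonpos_iff_eq_zero]
              refine hK0 _ ?_
              by_contra! hlt
              rw [hV, Set.notMem_compl_iff, Metric.mem_thickening_iff] at hc
              obtain ⟨y, hy, hcy⟩ := hc
              refine hw (Metric.mem_thickening_iff.2 ⟨y, hy, ?_⟩)
              rw [← dist_eq_norm] at hlt
              linarith [dist_triangle w c y]
        _ ≤ _ := setLIntegral_le_lintegral _ _
    have hup : ∀ n, ∫⁻ c in V, ∫⁻ w, K (w - c) ∂(ν n) ≤ (∫⁻ z, K z) * ν n U := by
      intro n
      rw [lintegral_lintegral_swap hKm2.aemeasurable]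
      calc ∫⁻ w, (∫⁻ c in V, K (w - c)) ∂(ν n) ≤
          ∫⁻ w, U.indicator (fun _ => ∫⁻ z, K z) w ∂(ν n) := by
            refine lintegral_mono fun w => ?_
            by_cases hw : w ∈ U
            · rw [Set.indicator_of_mem hw, ← htrans w]
              exact setLIntegral_le_lintegral _ _
            · rw [Set.indicator_of_notMem hw, nonpos_iff_eq_zero]
              rw [setLIntegral_congr_fun (g := fun _ => 0) hVm, lintegral_zero]
              intro c hc
              refine hK0 _ ?_
              by_contra! hlt
              refine hc (Metric.mem_thickening_iff.2 ⟨w, hw, ?_⟩)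
              rwa [dist_comm, dist_eq_norm]
        _ = _ := lintegral_indicator_const hU.measurableSet _
    have hfatou : (∫⁻ z, K z) * μ W ≤ liminf (fun n => (∫⁻ z, K z) * ν n U) atTop := by
      calc _ ≤ ∫⁻ c in V, ∫⁻ w, K (w - c) ∂μ := hlow
        _ ≤ ∫⁻ c in V, liminf (fun n => ∫⁻ w, K (w - c) ∂ν n) atTop := lintegral_mono hlim
        _ ≤ liminf (fun n => ∫⁻ c in V, ∫⁻ w, K (w - c) ∂ν n) atTop :=
            lintegral_liminf_le fun n => hKm2.lintegral_prod_right
        _ ≤ _ := liminf_le_liminf (Eventually.of_forall hup)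
    have hcont : liminf (fun n => (∫⁻ z, K z) * ν n U) atTop =
        (∫⁻ z, K z) * liminf (fun n => ν n U) atTop :=
      ENNReal.liminf_const_mul_of_ne_top hItop
    rw [hcont] at hfatou
    exact (ENNReal.mul_le_mul_iff_right hI0 hItop).1 hfatou
  have hlim : Tendsto (fun r => μ (Metric.thickening r F)ᶜ) (𝓝[>] 0) (𝓝 (μ U)) := by
    have h1 := tendsto_measure_thickening_of_isClosed (μ := μ) ⟨1, one_pos, measure_ne_top _ _⟩ hFc
    have h2 := ENNReal.Tendsto.sub (tendsto_const_nhds (x := (1 : ℝ≥0∞)) (f := 𝓝[>] (0 : ℝ))) h1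
      (Or.inl ENNReal.one_ne_top)
    rw [← prob_compl_eq_one_sub hFc.measurableSet, hF, compl_compl] at h2
    refine h2.congr fun r => ?_
    rw [prob_compl_eq_one_sub Metric.isOpen_thickening.measurableSet]
  refine le_of_tendsto hlim ?_
  filter_upwards [self_mem_nhdsWithin] with r hr
  have := hstep (r / 2) (half_pos hr)
  rwa [add_halves] at this

/-! ### The zero measures: degrees, roots and normalisation. -/

lemma rootPoly_ne_zero (z : ℕ → ℂ) (n : ℕ) : rootPoly z n ≠ 0 :=
  (monic_prod_of_monic _ _ fun j _ => monic_X_sub_C (z j)).ne_zero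

lemma natDegree_rootPoly (z : ℕ → ℂ) (n : ℕ) : (rootPoly z n).natDegree = n := by
  simp [rootPoly, natDegree_prod_of_monic _ _ fun j _ => monic_X_sub_C (z j)]

lemma roots_rootPoly (z : ℕ → ℂ) (n : ℕ) :
    (rootPoly z n).roots = (Multiset.range n).map z := by
  rw [rootPoly, roots_prod _ _ (rootPoly_ne_zero z n)]
  simp [Multiset.bind_singleton]

lemma natDegree_iterate_derivative_eq (p : ℂ[X]) (k : ℕ) :
    (derivative^[k] p).natDegree = p.natDegree - k := by
  induction k with
  | zero => simp
  | succ k ih =>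
    rw [Function.iterate_succ_apply', natDegree_derivative, ih]
    omega

lemma iterate_derivative_rootPoly_ne_zero (z : ℕ → ℂ) {k n : ℕ} (h : k < n) :
    derivative^[k] (rootPoly z n) ≠ 0 := by
  intro h0
  have := natDegree_iterate_derivative_eq (rootPoly z n) k
  rw [h0, natDegree_zero, natDegree_rootPoly] at this
  omega

lemma card_roots_iterate_derivative_rootPoly (z : ℕ → ℂ) (k n : ℕ) :
    (derivative^[k] (rootPoly z n)).roots.card = n - k := by
  rw [IsAlgClosed.card_roots_eq_natDegree, natDegree_iterate_derivative_eq, natDegree_rootPoly]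

lemma lintegral_sum_diracProba (s : Multiset ℂ) {f : ℂ → ℝ≥0∞} (hf : Measurable f) :
    ∫⁻ w, f w ∂((s.map fun w => (diracProba w).toFiniteMeasure).sum : FiniteMeasure ℂ) =
      (s.map f).sum := by
  induction s using Multiset.induction_on with
  | empty => simp
  | cons a s ih =>
    rw [Multiset.map_cons, Multiset.sum_cons, FiniteMeasure.toMeasure_add,
      lintegral_add_measure, ih, Multiset.map_cons, Multiset.sum_cons]
    congr 1
    exact lintegral_dirac' a hf

lemma lintegral_derivZeroMeasure (z : ℕ → ℂ) {k n : ℕ} (h : k < n) {f : ℂ → ℝ≥0∞}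
    (hf : Measurable f) :
    ∫⁻ w, f w ∂(derivZeroMeasure z k n : Measure ℂ) =
      ((n - k : ℕ) : ℝ≥0∞)⁻¹ * ((derivative^[k] (rootPoly z n)).roots.map f).sum := by
  rw [derivZeroMeasure, FiniteMeasure.toMeasure_smul, lintegral_smul_measure,
    lintegral_sum_diracProba _ hf, ENNReal.smul_def, smul_eq_mul, ENNReal.coe_inv, ENNReal.coe_natCast]
  rw [Nat.cast_ne_zero]
  omega

lemma derivZeroMeasure_apply (z : ℕ → ℂ) {k n : ℕ} (h : k < n) {s : Set ℂ} (hs : MeasurableSet s) :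
    (derivZeroMeasure z k n : Measure ℂ) s =
      ((n - k : ℕ) : ℝ≥0∞)⁻¹ * ((derivative^[k] (rootPoly z n)).roots.map (s.indicator 1)).sum := by
  rw [← lintegral_indicator_one hs]
  exact lintegral_derivZeroMeasure z h (measurable_one.indicator hs)

lemma isProbabilityMeasure_derivZeroMeasure (z : ℕ → ℂ) {k n : ℕ} (h : k < n) :
    IsProbabilityMeasure (derivZeroMeasure z k n : Measure ℂ) := by
  constructor
  rw [derivZeroMeasure_apply z h MeasurableSet.univ]
  simp only [Set.indicator_univ, Pi.one_apply, Multiset.map_const', Multiset.sum_replicate,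
    card_roots_iterate_derivative_rootPoly, nsmul_eq_mul, mul_one]
  have : n - k ≠ 0 := by omega
  exact ENNReal.inv_mul_cancel (by exact_mod_cast this) (ENNReal.natCast_ne_top _)

/-- The portmanteau theorem for the empirical measures of the zeros of derivatives. -/
lemma tendsto_derivZeroMeasure_of_isOpen {μ : ProbabilityMeasure ℂ} {z : ℕ → ℂ} {k : ℕ}
    (h : ∀ U : Set ℂ, IsOpen U →
      (μ : Measure ℂ) U ≤ liminf (fun n => (derivZeroMeasure z k n : Measure ℂ) U) atTop) :
    Tendsto (fun n => derivZeroMeasure z k n) atTop (𝓝 μ.toFiniteMeasure) := by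
  -- The shift discards the indices `n ≤ k`, where the measure is zero by convention.
  rw [← tendsto_add_atTop_iff_nat (k + 1)]
  let ν : ℕ → ProbabilityMeasure ℂ := fun n =>
    ⟨derivZeroMeasure z k (n + (k + 1)), isProbabilityMeasure_derivZeroMeasure z (by omega)⟩
  have hν : Tendsto ν atTop (𝓝 μ) := by
    refine tendsto_of_forall_isOpen_le_liminf_nat' fun U hU => (h U hU).trans_eq ?_
    exact (liminf_nat_add (fun n => (derivZeroMeasure z k n : Measure ℂ) U) (k + 1)).symm
  exact (ProbabilityMeasure.tendsto_nhds_iff_toFiniteMeasure_tendsto_nhds atTop).1 hν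

/-! ### Passing from the roots to the zeros of the derivatives. -/

/-- The ratio of the derivative and the polynomial is subexponential in measure on discs. -/
lemma tendsto_volume_large_derivative (z : ℕ → ℂ) (k : ℕ) (R : ℝ) {ε : ℝ} (hε : 0 < ε) :
    Tendsto (fun n : ℕ => volume {w ∈ Metric.ball (0 : ℂ) R | ‖(rootPoly z n).eval w‖ ≤
      Real.exp (-ε * n) * ‖(derivative^[k] (rootPoly z n)).eval w‖}) atTop (𝓝 0) := by
  obtain ⟨K, hK, hKw⟩ := exists_lintegral_inv_norm_sub_le R
  have hlim : Tendsto (fun n : ℕ => K * (n : ℝ≥0∞)⁻¹) atTop (𝓝 0) := by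
    have := ENNReal.Tendsto.const_mul ENNReal.tendsto_inv_nat_nhds_zero (Or.inr hK)
    rwa [mul_zero] at this
  have hexp : ∀ᶠ n : ℕ in atTop, Real.exp (-ε * n) * (k.factorial * ((n : ℝ) ^ 2) ^ k) < 1 := by
    have h1 : Tendsto (fun n : ℕ => (ε * n) ^ (2 * k) * Real.exp (-(ε * n))) atTop (𝓝 0) :=
      (Real.tendsto_pow_mul_exp_neg_atTop_nhds_zero (2 * k)).comp
        (tendsto_natCast_atTop_atTop.const_mul_atTop hε)
    have h2 := h1.const_mul ((k.factorial : ℝ) / ε ^ (2 * k))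
    rw [mul_zero] at h2
    filter_upwards [h2.eventually (gt_mem_nhds one_pos)] with n hn
    refine lt_of_eq_of_lt ?_ hn
    rw [mul_pow, ← pow_mul, neg_mul]
    field_simp
  refine tendsto_of_tendsto_of_tendsto_of_le_of_le' tendsto_const_nhds hlim
    (Eventually.of_forall fun _ => zero_le) ?_
  filter_upwards [hexp, eventually_gt_atTop 0] with n hn hn0
  have hn0' : (n : ℝ≥0∞) ≠ 0 := by exact_mod_cast hn0.ne'
  let S : ℂ → ℝ≥0∞ := fun w => ∑ j ∈ Finset.range n, ENNReal.ofReal ‖w - z j‖⁻¹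
  have hSm : Measurable S := by
    refine Finset.measurable_sum _ fun j _ => ?_
    fun_prop
  -- The mean of `S` is at most `n K`, so the level `n²` is exceeded on area at most `K / n`, while
  -- `(n²)^k` stays subexponential.
  have hmark : volume.restrict (Metric.ball (0 : ℂ) R) {w | (n : ℝ≥0∞) ^ 2 ≤ S w} ≤
      K * (n : ℝ≥0∞)⁻¹ := by
    have h1 := mul_meas_ge_le_lintegral (μ := volume.restrict (Metric.ball (0 : ℂ) R)) hSm
      ((n : ℝ≥0∞) ^ 2)
    have h2 : ∫⁻ w in Metric.ball (0 : ℂ) R, S w ≤ n * K := by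
      rw [lintegral_finsetSum]
      · refine (Finset.sum_le_sum fun j _ => hKw (z j)).trans ?_
        simp
      · intro j _
        fun_prop
    have h3 := h1.trans h2
    rw [pow_two, mul_assoc, ENNReal.mul_le_mul_iff_right hn0' (ENNReal.natCast_ne_top n)] at h3
    rw [← div_eq_mul_inv, ENNReal.le_div_iff_mul_le (Or.inl hn0') (Or.inl (ENNReal.natCast_ne_top n)),
      mul_comm]
    simpa only [pow_two] using h3
  refine le_trans ?_ hmark
  rw [Measure.restrict_apply (measurableSet_le measurable_const hSm)]
  refine measure_mono_ae ?_
  filter_upwards [ae_eval_ne_zero (rootPoly_ne_zero z n)] with w hw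
  rintro ⟨hwR, hle⟩
  refine ⟨?_, hwR⟩
  rw [Set.mem_ofPred_eq]
  by_contra! hlt
  have hprod : (rootPoly z n).eval w = ∏ j ∈ Finset.range n, (w - z j) := by
    simp [rootPoly, eval_prod]
  have hne : ∀ j ∈ Finset.range n, w - z j ≠ 0 := by
    rw [hprod, Finset.prod_ne_zero_iff] at hw
    exact hw
  have hS : ∑ j ∈ Finset.range n, ‖(w - z j)⁻¹‖ < (n : ℝ) ^ 2 := by
    have : S w = ENNReal.ofReal (∑ j ∈ Finset.range n, ‖(w - z j)⁻¹‖) := by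
      rw [ENNReal.ofReal_sum_of_nonneg fun j _ => norm_nonneg _]
      simp only [norm_inv, S]
    rw [this, ENNReal.ofReal_lt_iff_lt_toReal (Finset.sum_nonneg fun j _ => norm_nonneg _)
      (ENNReal.pow_ne_top (ENNReal.natCast_ne_top n))] at hlt
    simpa using hlt
  have hq : ‖(derivative^[k] (rootPoly z n)).eval w‖ ≤
      k.factorial * ((n : ℝ) ^ 2) ^ k * ‖(rootPoly z n).eval w‖ := by
    rw [rootPoly, eval_iterate_derivative_prod _ _ _ hne, ← rootPoly, hprod, norm_mul, norm_mul,
      Complex.norm_natCast]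
    gcongr
    refine (norm_coeff_prod_one_add_le _ _ _).trans ?_
    gcongr
  have hpos : 0 < ‖(rootPoly z n).eval w‖ := norm_pos_iff.2 hw
  have : ‖(rootPoly z n).eval w‖ < ‖(rootPoly z n).eval w‖ := by
    calc ‖(rootPoly z n).eval w‖ ≤ _ := hle
      _ ≤ Real.exp (-ε * n) * (k.factorial * ((n : ℝ) ^ 2) ^ k * ‖(rootPoly z n).eval w‖) := by
          gcongr
      _ = Real.exp (-ε * n) * (k.factorial * ((n : ℝ) ^ 2) ^ k) * ‖(rootPoly z n).eval w‖ := by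
          ring
      _ < 1 * ‖(rootPoly z n).eval w‖ := by gcongr
      _ = _ := one_mul _
  exact lt_irrefl _ this

/-- If the derivatives are not exponentially smaller than the polynomials, in measure on discs,
then the portmanteau lower bound passes from the roots to the zeros of the derivatives. -/
lemma measure_le_liminf_derivZeroMeasure {μ : Measure ℂ} [IsProbabilityMeasure μ] {z : ℕ → ℂ} {k : ℕ}
    (h0 : ∀ U : Set ℂ, IsOpen U →
      μ U ≤ liminf (fun n => (derivZeroMeasure z 0 n : Measure ℂ) U) atTop)
    (h1 : ∀ R ε : ℝ, 0 < ε → Tendsto (fun n : ℕ => volume {w ∈ Metric.ball (0 : ℂ) R |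
      ‖(derivative^[k] (rootPoly z n)).eval w‖ ≤
        Real.exp (-ε * n) * ‖(rootPoly z n).eval w‖}) atTop (𝓝 0))
    {U : Set ℂ} (hU : IsOpen U) :
    μ U ≤ liminf (fun n => (derivZeroMeasure z k n : Measure ℂ) U) atTop := by
  refine measure_le_liminf_of_kernel (fun δ hδ => ?_) hU
  set ρ := δ / 4 with hρdef
  have hρ : 0 < ρ := by positivity
  refine ⟨annulusKernel ρ, measurable_annulusKernel hρ,
    fun w hw => annulusKernel_eq_zero hρ (by linarith), lintegral_annulusKernel_ne_zero hρ,
    lintegral_annulusKernel_ne_top hρ, fun c => ?_⟩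
  set R := ‖c‖ + 3 * ρ with hR
  have hRpos : 0 < R := by positivity
  set E : ℕ → ℝ≥0∞ := fun n => (n : ℝ≥0∞)⁻¹ * ∫⁻ w in Metric.ball (0 : ℂ) R,
    ENNReal.ofReal |Real.log ‖(derivative^[k] (rootPoly z n)).eval w‖ -
      Real.log ‖(rootPoly z n).eval w‖| with hE
  have hElim : Tendsto (fun n => ENNReal.ofReal ρ⁻¹ * E n) atTop (𝓝 0) := by
    have := ENNReal.Tendsto.const_mul (tendsto_lintegral_log_ratio
      (p := rootPoly z) (q := fun n => derivative^[k] (rootPoly z n)) (rootPoly_ne_zero z)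
      ((eventually_gt_atTop k).mono fun n hn => iterate_derivative_rootPoly_ne_zero z hn)
      (fun n => (natDegree_rootPoly z n).le)
      (fun n => by rw [natDegree_iterate_derivative_eq, natDegree_rootPoly]; omega)
      hRpos (fun ε hε => h1 R ε hε) (fun ε hε => tendsto_volume_large_derivative z k R hε))
      (Or.inr (ENNReal.ofReal_ne_top (r := ρ⁻¹)))
    rwa [mul_zero] at this
  have hKm : Measurable fun w => annulusKernel ρ (w - c) :=
    (measurable_annulusKernel hρ).comp (measurable_id.sub_const c)
  have hsum : ∀ s : Multiset ℂ, (s.map fun w => annulusKernel ρ (w - c)).sum =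
      ENNReal.ofReal (s.map fun w => annulusProfile ρ ‖w - c‖).sum := by
    intro s
    induction s using Multiset.induction_on with
    | empty => simp
    | cons a s ih =>
      rw [Multiset.map_cons, Multiset.sum_cons, Multiset.map_cons, Multiset.sum_cons,
        ENNReal.ofReal_add (annulusProfile_nonneg hρ _), ih]
      · rfl
      · refine Multiset.sum_nonneg ?_
        simp only [Multiset.mem_map, forall_exists_index, and_imp, forall_apply_eq_imp_iff₂]
        exact fun w _ => annulusProfile_nonneg hρ _
  have hbound : ∀ n, k < n → ∫⁻ w, annulusKernel ρ (w - c) ∂(derivZeroMeasure z 0 n : Measure ℂ) ≤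
      ∫⁻ w, annulusKernel ρ (w - c) ∂(derivZeroMeasure z k n : Measure ℂ) +
        ENNReal.ofReal ρ⁻¹ * E n := by
    intro n hn
    have hq := iterate_derivative_rootPoly_ne_zero z hn
    rw [lintegral_derivZeroMeasure z (by omega) hKm, lintegral_derivZeroMeasure z hn hKm, hsum, hsum,
      Function.iterate_zero, id, Nat.sub_zero]
    have h2 := abs_sum_annulusProfile_sub_le (rootPoly_ne_zero z n) hq hρ c
    set a := ((rootPoly z n).roots.map fun w => annulusProfile ρ ‖w - c‖).sum
    set b := ((derivative^[k] (rootPoly z n)).roots.map fun w => annulusProfile ρ ‖w - c‖).sum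
    have h3 : ENNReal.ofReal a ≤ ENNReal.ofReal b + ENNReal.ofReal |b - a| := by
      refine (ENNReal.ofReal_le_ofReal ?_).trans ENNReal.ofReal_add_le
      linarith [neg_abs_le (b - a)]
    have h4 : Metric.ball c (3 * ρ) ⊆ Metric.ball 0 R :=
      Metric.ball_subset_ball' (by rw [dist_zero_right, hR, add_comm])
    calc (n : ℝ≥0∞)⁻¹ * ENNReal.ofReal a
        ≤ (n : ℝ≥0∞)⁻¹ * (ENNReal.ofReal b + ENNReal.ofReal ρ⁻¹ *
          ∫⁻ w in Metric.ball (0 : ℂ) R, ENNReal.ofReal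
            |Real.log ‖(derivative^[k] (rootPoly z n)).eval w‖ -
              Real.log ‖(rootPoly z n).eval w‖|) := by
          gcongr
          refine h3.trans ?_
          gcongr
          refine h2.trans ?_
          gcongr
      _ = (n : ℝ≥0∞)⁻¹ * ENNReal.ofReal b + ENNReal.ofReal ρ⁻¹ * E n := by
          rw [hE]
          ring
      -- Replacing the normalisation `n` by `n - k` only increases the right-hand side.
      _ ≤ _ := by
          gcongr
          omega
  calc ∫⁻ w, annulusKernel ρ (w - c) ∂μ
      ≤ liminf (fun n => ∫⁻ w, annulusKernel ρ (w - c) ∂(derivZeroMeasure z 0 n : Measure ℂ)) atTop :=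
        lintegral_le_liminf_lintegral_of_forall_isOpen_measure_le_liminf_measure
          ((continuous_annulusProfile_norm hρ).comp (continuous_sub_right c))
          (fun w => annulusProfile_nonneg hρ _) h0
    _ ≤ liminf (fun n => ∫⁻ w, annulusKernel ρ (w - c) ∂(derivZeroMeasure z k n : Measure ℂ) +
        ENNReal.ofReal ρ⁻¹ * E n) atTop :=
        liminf_le_liminf ((eventually_gt_atTop k).mono hbound)
    _ = _ := ENNReal.liminf_add_of_right_tendsto_zero hElim _

/-! ### The law of large numbers for the roots. -/

lemma derivZeroMeasure_zero_apply (z : ℕ → ℂ) {n : ℕ} (h : 0 < n) {s : Set ℂ}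
    (hs : MeasurableSet s) :
    (derivZeroMeasure z 0 n : Measure ℂ) s =
      ENNReal.ofReal ((∑ j ∈ Finset.range n, s.indicator 1 (z j)) / n) := by
  rw [derivZeroMeasure_apply z h hs, Function.iterate_zero, id, roots_rootPoly, Multiset.map_map,
    Nat.sub_zero, ENNReal.ofReal_div_of_pos (by exact_mod_cast h), ENNReal.ofReal_natCast,
    ENNReal.div_eq_inv_mul, ENNReal.ofReal_sum_of_nonneg]
  · congr 1
    change ∑ j ∈ Finset.range n, _ = _
    refine Finset.sum_congr rfl fun j _ => ?_
    by_cases hj : z j ∈ s <;> simp [hj]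
  · intro j _
    exact Set.indicator_nonneg (fun _ _ => zero_le_one) _

/-- The strong law of large numbers for the frequency of a set. -/
lemma ae_tendsto_derivZeroMeasure_zero {Ω : Type*} [MeasurableSpace Ω] {P : Measure Ω}
    {μ : Measure ℂ} [IsProbabilityMeasure μ] {Z : ℕ → Ω → ℂ}
    (hmeas : ∀ j, Measurable (Z j))
    (hlaw : ∀ j, P.map (Z j) = μ) (hindep : iIndepFun Z P) {s : Set ℂ} (hs : MeasurableSet s) :
    ∀ᵐ ω ∂P, Tendsto (fun n => (derivZeroMeasure (fun j => Z j ω) 0 n : Measure ℂ) s) atTop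
      (𝓝 (μ s)) := by
  have hf : Measurable (s.indicator (1 : ℂ → ℝ)) := measurable_one.indicator hs
  have hint : Integrable (s.indicator (1 : ℂ → ℝ)) μ :=
    (integrable_const (1 : ℝ)).indicator hs
  have h := strong_law_ae_real (μ := P) (fun j ω => s.indicator (1 : ℂ → ℝ) (Z j ω))
    (by
      rw [← hlaw 0] at hint
      exact hint.comp_measurable (hmeas 0))
    (fun i j hij => (hindep.indepFun hij).comp hf hf)
    (fun i => IdentDistrib.comp ⟨(hmeas i).aemeasurable, (hmeas 0).aemeasurable,
      by rw [hlaw, hlaw]⟩ hf)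
  have hexp : ∫ ω, s.indicator (1 : ℂ → ℝ) (Z 0 ω) ∂P = μ.real s := by
    rw [← integral_indicator_one hs, ← hlaw 0, integral_map (hmeas 0).aemeasurable]
    rw [hlaw 0]
    exact hf.aestronglyMeasurable
  filter_upwards [h] with ω hω
  rw [hexp] at hω
  have h2 := ENNReal.tendsto_ofReal hω
  rw [ofReal_measureReal] at h2
  refine h2.congr' ?_
  filter_upwards [eventually_gt_atTop 0] with n hn
  rw [derivZeroMeasure_zero_apply _ hn hs]

/-- Almost surely, the empirical measures satisfy the portmanteau lower bound on all open sets. -/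
lemma ae_forall_isOpen_measure_le_liminf {Ω : Type*} [MeasurableSpace Ω] {P : Measure Ω}
    {μ : ProbabilityMeasure ℂ} {Z : ℕ → Ω → ℂ}
    (hmeas : ∀ j, Measurable (Z j))
    (hlaw : ∀ j, P.map (Z j) = (μ : Measure ℂ)) (hindep : iIndepFun Z P) :
    ∀ᵐ ω ∂P, ∀ U : Set ℂ, IsOpen U →
      (μ : Measure ℂ) U ≤ liminf (fun n => (derivZeroMeasure (fun j => Z j ω) 0 n : Measure ℂ) U) atTop := by
  set S := TopologicalSpace.countableBasis ℂ with hS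
  have hSb := TopologicalSpace.isBasis_countableBasis ℂ
  have hSo : ∀ t ∈ S, IsOpen t := fun t ht => TopologicalSpace.isOpen_of_mem_countableBasis ht
  -- Finite unions of basic open sets are countably many, so one null set serves all of them, and
  -- they exhaust every open set in measure from inside.
  have hcount : {T : Finset (Set ℂ) | (T : Set (Set ℂ)) ⊆ S}.Countable := by
    have h := Set.countable_ofPred_finite_subset (TopologicalSpace.countable_countableBasis ℂ)
    have h' := h.preimage (Finset.coe_injective (α := Set ℂ))
    refine h'.mono fun T hT => ?_
    exact ⟨T.finite_toSet, hT⟩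
  have hae : ∀ᵐ ω ∂P, ∀ T ∈ {T : Finset (Set ℂ) | (T : Set (Set ℂ)) ⊆ S},
      Tendsto (fun n => (derivZeroMeasure (fun j => Z j ω) 0 n : Measure ℂ) (⋃ t ∈ T, t)) atTop
        (𝓝 ((μ : Measure ℂ) (⋃ t ∈ T, t))) := by
    rw [ae_ball_iff hcount]
    intro T hT
    refine ae_tendsto_derivZeroMeasure_zero hmeas hlaw hindep ?_
    exact (isOpen_biUnion fun t ht => hSo t (hT ht)).measurableSet
  filter_upwards [hae] with ω hω U hU
  refine le_of_forall_lt fun r hr => ?_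
  obtain ⟨r', hrr', hr'⟩ := exists_between hr
  lift r' to ℝ≥0 using hr'.ne_top
  obtain ⟨T, hTS, hrT, hTU⟩ := ProbabilityMeasure.exists_lt_measure_biUnion_of_isOpen
    (S := S) μ
    (fun u hu x hx => by
      obtain ⟨t, ht, hxt, htu⟩ := hSb.exists_subset_of_mem_open hx hu
      exact ⟨t, ht, (hSo t ht).mem_nhds hxt, htu⟩) hU (r := r')
    (by
      rw [← ENNReal.coe_lt_coe, ProbabilityMeasure.ennreal_coeFn_eq_coeFn_toMeasure]
      exact hr')
  rw [← ENNReal.coe_lt_coe, ProbabilityMeasure.ennreal_coeFn_eq_coeFn_toMeasure] at hrT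
  calc r < r' := hrr'
    _ < (μ : Measure ℂ) (⋃ t ∈ T, t) := hrT
    _ = liminf (fun n => (derivZeroMeasure (fun j => Z j ω) 0 n : Measure ℂ) (⋃ t ∈ T, t)) atTop :=
        (hω T hTS).liminf_eq.symm
    _ ≤ _ := liminf_le_liminf (Eventually.of_forall fun n => measure_mono hTU)

/-- The sets grow with `R` and shrink as `ε` grows, so integer radii and the values `1 / (l + 1)`
suffice. -/
lemma ae_forall_tendsto_volume_small_derivative {Ω : Type*} [MeasurableSpace Ω] {P : Measure Ω}
    [IsProbabilityMeasure P] {μ : Measure ℂ} [IsProbabilityMeasure μ] {Z : ℕ → Ω → ℂ}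
    (hμ : μ.support.Infinite)
    (hmeas : ∀ j, Measurable (Z j)) (hlaw : ∀ j, P.map (Z j) = μ) (hindep : iIndepFun Z P) (k : ℕ) :
    ∀ᵐ ω ∂P, ∀ R ε : ℝ, 0 < ε → Tendsto (fun n : ℕ => volume {w ∈ Metric.ball (0 : ℂ) R |
      ‖(derivative^[k] (rootPoly (fun j => Z j ω) n)).eval w‖ ≤
        Real.exp (-ε * n) * ‖(rootPoly (fun j => Z j ω) n).eval w‖}) atTop (𝓝 0) := by
  have hae : ∀ᵐ ω ∂P, ∀ m l : ℕ, Tendsto (fun n : ℕ => volume {w ∈ Metric.ball (0 : ℂ) m |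
      ‖(derivative^[k] (rootPoly (fun j => Z j ω) n)).eval w‖ ≤
        Real.exp (-(1 / ((l : ℝ) + 1)) * n) * ‖(rootPoly (fun j => Z j ω) n).eval w‖})
      atTop (𝓝 0) := by
    rw [ae_all_iff]
    intro m
    rw [ae_all_iff]
    intro l
    exact ae_tendsto_volume_small_derivative P μ hμ Z hmeas hlaw hindep k (Nat.cast_nonneg m)
      (by positivity)
  filter_upwards [hae] with ω hω R ε hε
  obtain ⟨m, hm⟩ := exists_nat_ge R
  obtain ⟨l, hl⟩ := exists_nat_one_div_lt hε
  refine tendsto_of_tendsto_of_tendsto_of_le_of_le tendsto_const_nhds (hω m l)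
    (fun _ => zero_le) fun n => measure_mono ?_
  rintro w ⟨hw, hle⟩
  refine ⟨Metric.ball_subset_ball hm hw, hle.trans ?_⟩
  gcongr

/-! ### Measures with finite support. -/

lemma rootMultiplicity_sub_le_iterate_derivative (p : ℂ[X]) (a : ℂ) (k : ℕ) :
    p.rootMultiplicity a - k ≤ (derivative^[k] p).rootMultiplicity a := by
  induction k with
  | zero => simp
  | succ k ih =>
    rw [Function.iterate_succ_apply']
    have := rootMultiplicity_sub_one_le_derivative_rootMultiplicity (derivative^[k] p) a
    omega

lemma sum_map_indicator_singleton (s : Multiset ℂ) (a : ℂ) :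
    (s.map (({a} : Set ℂ).indicator (1 : ℂ → ℝ≥0∞))).sum = s.count a := by
  induction s using Multiset.induction_on with
  | empty => simp
  | cons b s ih =>
    rw [Multiset.map_cons, Multiset.sum_cons, ih, Multiset.count_cons, add_comm]
    by_cases h : a = b
    · simp [h]
    · simp [h, Ne.symm h]

/-- The weight of a point changes by at most `k / n` when passing to the `k`-th derivative. -/
lemma derivZeroMeasure_zero_singleton_le (z : ℕ → ℂ) {k n : ℕ} (h : k < n) (a : ℂ) :
    (derivZeroMeasure z 0 n : Measure ℂ) {a} ≤
      (derivZeroMeasure z k n : Measure ℂ) {a} + k * (n : ℝ≥0∞)⁻¹ := by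
  rw [derivZeroMeasure_apply z (by omega) (measurableSet_singleton a),
    derivZeroMeasure_apply z h (measurableSet_singleton a), sum_map_indicator_singleton,
    sum_map_indicator_singleton, count_roots, count_roots, Function.iterate_zero, id, Nat.sub_zero]
  have h1 := rootMultiplicity_sub_le_iterate_derivative (rootPoly z n) a k
  have h2 : ((rootPoly z n).rootMultiplicity a : ℝ≥0∞) ≤
      (derivative^[k] (rootPoly z n)).rootMultiplicity a + k := by
    exact_mod_cast (by omega : (rootPoly z n).rootMultiplicity a ≤
      (derivative^[k] (rootPoly z n)).rootMultiplicity a + k)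
  calc _ ≤ (n : ℝ≥0∞)⁻¹ * ((derivative^[k] (rootPoly z n)).rootMultiplicity a + k) := by gcongr
    _ = (n : ℝ≥0∞)⁻¹ * (derivative^[k] (rootPoly z n)).rootMultiplicity a + k * (n : ℝ≥0∞)⁻¹ := by
        ring
    _ ≤ _ := by
        gcongr
        omega

/-- For finitely supported measures, the portmanteau lower bound for the zeros of the derivatives
follows from the convergence of the weights of the atoms. -/
lemma measure_le_liminf_derivZeroMeasure_of_finite {μ : Measure ℂ} {S : Finset ℂ}
    (hS : μ (S : Set ℂ)ᶜ = 0) {z : ℕ → ℂ} {k : ℕ}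
    (h : ∀ a ∈ S, Tendsto (fun n => (derivZeroMeasure z 0 n : Measure ℂ) {a}) atTop (𝓝 (μ {a})))
    (U : Set ℂ) : μ U ≤ liminf (fun n => (derivZeroMeasure z k n : Measure ℂ) U) atTop := by
  classical
  set T := S.filter (· ∈ U) with hT
  have hTU : (T : Set ℂ) ⊆ U := fun a ha => (Finset.mem_filter.1 ha).2
  have hμU : μ U ≤ ∑ a ∈ T, μ {a} := by
    rw [sum_measure_singleton]
    have h1 : U ⊆ (T : Set ℂ) ∪ (S : Set ℂ)ᶜ := by
      intro a ha
      by_cases haS : a ∈ S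
      · exact Or.inl (Finset.mem_filter.2 ⟨haS, ha⟩)
      · exact Or.inr haS
    refine (measure_mono h1).trans ((measure_union_le _ _).trans ?_)
    rw [hS, add_zero]
  have hlim : Tendsto (fun n => ∑ a ∈ T, (derivZeroMeasure z 0 n : Measure ℂ) {a}) atTop
      (𝓝 (∑ a ∈ T, μ {a})) :=
    tendsto_finsetSum _ fun a ha => h a (Finset.mem_filter.1 ha).1
  have herr : Tendsto (fun n : ℕ => (T.card * k : ℝ≥0∞) * (n : ℝ≥0∞)⁻¹) atTop (𝓝 0) := by
    have := ENNReal.Tendsto.const_mul ENNReal.tendsto_inv_nat_nhds_zero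
      (Or.inr (ENNReal.mul_ne_top (ENNReal.natCast_ne_top T.card) (ENNReal.natCast_ne_top k)))
    rwa [mul_zero] at this
  calc μ U ≤ ∑ a ∈ T, μ {a} := hμU
    _ = liminf (fun n => ∑ a ∈ T, (derivZeroMeasure z 0 n : Measure ℂ) {a}) atTop :=
        hlim.liminf_eq.symm
    _ ≤ liminf (fun n => (derivZeroMeasure z k n : Measure ℂ) U +
        (T.card * k : ℝ≥0∞) * (n : ℝ≥0∞)⁻¹) atTop := by
        refine liminf_le_liminf ((eventually_gt_atTop k).mono fun n hn => ?_)
        refine (Finset.sum_le_sum fun a _ => derivZeroMeasure_zero_singleton_le z hn a).trans ?_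
        rw [Finset.sum_add_distrib, Finset.sum_const, nsmul_eq_mul, ← mul_assoc,
          sum_measure_singleton]
        gcongr
    _ = _ := ENNReal.liminf_add_of_right_tendsto_zero herr _

end

theorem theorem1p1 {Ω : Type*} [MeasurableSpace Ω] (P : Measure Ω) [IsProbabilityMeasure P]
    (μ : ProbabilityMeasure ℂ) (Z : ℕ → Ω → ℂ)
    (hmeas : ∀ j, Measurable (Z j))
    (hlaw : ∀ j, P.map (Z j) = (μ : Measure ℂ))
    (hindep : iIndepFun Z P) :
    ∀ᵐ ω ∂P, ∀ k : ℕ,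
      Tendsto (fun n : ℕ => derivZeroMeasure (fun j => Z j ω) k n) atTop
        (𝓝 μ.toFiniteMeasure) := by
  -- Infinite support is what supplies arbitrarily many disjoint discs of positive mass.
  by_cases hμ : (μ : Measure ℂ).support.Finite
  · have hS : (μ : Measure ℂ) (hμ.toFinset : Set ℂ)ᶜ = 0 := by
      rw [hμ.coe_toFinset]
      exact Measure.measure_compl_support
    have hae : ∀ᵐ ω ∂P, ∀ a ∈ hμ.toFinset,
        Tendsto (fun n => (derivZeroMeasure (fun j => Z j ω) 0 n : Measure ℂ) {a}) atTop
          (𝓝 ((μ : Measure ℂ) {a})) := by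
      rw [Finset.eventually_all]
      exact fun a _ =>
        ae_tendsto_derivZeroMeasure_zero hmeas hlaw hindep (measurableSet_singleton a)
    filter_upwards [hae] with ω hω k
    exact tendsto_derivZeroMeasure_of_isOpen fun U _ =>
      measure_le_liminf_derivZeroMeasure_of_finite hS hω U
  · filter_upwards [ae_forall_isOpen_measure_le_liminf hmeas hlaw hindep,
      ae_all_iff.2 fun k => ae_forall_tendsto_volume_small_derivative hμ hmeas hlaw hindep k]
      with ω h0 h1 k
    exact tendsto_derivZeroMeasure_of_isOpen fun U hU =>
      measure_le_liminf_derivZeroMeasure h0 (h1 k) hU
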